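/- Let $\Gamma$ be a 1-point periodic graph in $\mathbb{R}^d$: its vertex set is a lattice $\mathcal{L}=\bigoplus_{i=1}^d\mathbb{Z}\mathbf{v}_i$ generated by a basis of $\mathbb{R}^d$, and it is a simple, connected, locally finite graph on $\mathcal{L}$ whose edge set is invariant under translations by $\mathcal{L}$. Let $e_1,\dots,e_k\in\mathcal{L}$ be such that the $2k$ vectors $\pm e_j$ are distinct and the neighbours of each vertex $x$ are exactly the points $x\pm e_j$. Let $E$ be the $k\times d$ matrix with rows $e_1,\dots,e_k$, let $|x|_\Gamma=\sqrt{x^{T}(E^{T}E)^{-1}x}$ and $B_r=\{x\in\mathbb{R}^d: |x|_\Gamma\le r\}$. For $h>0$ let $h\Gamma$ be the graph scaled by $h$, with vertex set $h\mathcal{V}=h\mathcal{L}$ and neighbour relation $x\sim y$; for $u:h\mathcal{V}\to\mathbb{R}$ put $$\Delta_{h\Gamma}u(x)=\sum_{y\sim x}(u(y)-u(x)),\qquad D_j^su(x)=u(x+he_j)-u(x-he_j),\qquad \|u\|_{\ell^2(B_r)}^2=\sum_{x\in h\mathcal{V}\cap B_r}|u(x)|^2 .$$ For an integer $L\ge 0$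 let $\mathcal{P}_L=\{\sum_j\alpha_je_j:\alpha_j\in\mathbb{Z},\ \sum_j|\alpha_j|\le L\}$, and for $B_j,V_e:h\mathcal{V}\to\mathbb{R}$ $(1\le j\le k,\ e\in\mathcal{P}_L)$ let $$H^L_{h\Gamma}u(x)=h^{-2}\Delta_{h\Gamma}u(x)+h^{-1}\sum_{j=1}^kB_j(x)D_j^su(x)+\sum_{e\in\mathcal{P}_L}V_e(x+he)\,u(x+he).$$ Let $M$ be a real number. All constants below depend only on $\Gamma$, $(e_j)$, $L$ and $M$. (1) There exist $h_0,\delta_0\in(0,1)$, $c_1,c_2>0$, $\tau_0>1$ and $C>0$ such that for all $h\in(0,h_0)$, all $\tau\in(\tau_0,\delta_0h^{-1})$, all $B_j,V_e$ with $|B_j|\le M$ and $|V_e|\le M$ on $h\mathcal{V}$, and all $u:h\mathcal{V}\to\mathbb{R}$ with $H^L_{h\Gamma}u=0$ on $h\mathcal{V}\cap B_4$, $$\|u\|_{\ell^2(B_1)}\le C\left(e^{c_1\tau}\|u\|_{\ell^2(B_{1/2})}+e^{-c_2\tau}\|u\|_{\ell^2(B_2)}\right).$$ (2) There exist $\alpha\in(0,1)$,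 $c_0>0$, $h_0\in(0,1)$ and $D>1$ such that for all $h\in(0,h_0)$, all $B_j,V_e$ with $|B_j|\le M$ and $|V_e|\le M$ on $h\mathcal{V}$, and all $u:h\mathcal{V}\to\mathbb{R}$ with $H^L_{h\Gamma}u=0$ on $h\mathcal{V}\cap B_4$, $$\|u\|_{\ell^2(B_1)}\le D\left(\|u\|_{\ell^2(B_{1/2})}^{\alpha}\|u\|_{\ell^2(B_2)}^{1-\alpha}+e^{-c_0/h}\|u\|_{\ell^2(B_2)}\right).$$ -/

import Mathlib

open scoped Pointwise Matrix

noncomputable section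

/-- A one-point periodic graph in `ℝ^d`: its vertices are the points of the lattice spanned over `ℤ`
by a basis of `ℝ^d`; its edges are invariant under the translations of the lattice; every vertex has
finitely many neighbours; the graph is connected. -/
structure OnePointPeriodicGraph (d : ℕ) where
  basis : Module.Basis (Fin d) ℝ (Fin d → ℝ)
  graph : SimpleGraph (Submodule.span ℤ (Set.range basis))
  periodic : ∀ m x y, graph.Adj x y → graph.Adj (x + m) (y + m)
  finite_neighbors : ∀ x, (graph.neighborSet x).Finite
  connected : graph.Connected

namespace OnePointPeriodicGraph

variable {d : ℕ} (Γ : OnePointPeriodicGraph d)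

/-- The lattice, which is also the vertex set of the unscaled graph. -/
abbrev lattice : Submodule ℤ (Fin d → ℝ) := Submodule.span ℤ (Set.range Γ.basis)

/-- The vertex set of the graph with mesh size `h`, i.e. the lattice multiplied by `h`. -/
abbrev vertices (h : ℝ) : Submodule ℤ (Fin d → ℝ) := h • Γ.lattice

/-- The vertex `h v` of the graph with mesh size `h`. -/
def scale (h : ℝ) (v : Γ.lattice) : Γ.vertices h :=
  ⟨h • (v : Fin d → ℝ), Submodule.smul_mem_pointwise_smul _ h Γ.lattice v.2⟩

/-- The edges of the graph with mesh size `h` are the pairs `(h a, h b)` with `(a, b)` an edge of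
the unscaled graph. -/
def ScaledAdj (h : ℝ) (x y : Γ.vertices h) : Prop :=
  ∃ a b : Γ.lattice, Γ.graph.Adj a b ∧ x = Γ.scale h a ∧ y = Γ.scale h b

/-- The graph Laplacian `∑_{y ∼ x} (f y - f x)` of the graph with mesh size `h`. -/
def laplacian (h : ℝ) (f : Γ.vertices h → ℝ) (x : Γ.vertices h) : ℝ :=
  ∑ᶠ y ∈ {y | Γ.ScaledAdj h x y}, (f y - f x)

variable {Γ} {k : ℕ}

/-- The vectors `e 1, …, e k` list the edge directions of the graph, one of each pair of opposite
directions: the `2k` neighbours of `x` are the distinct points `x ± e j`. -/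
structure IsEdgeSystem (e : Fin k → Γ.lattice) : Prop where
  adj_iff : ∀ x y, Γ.graph.Adj x y ↔ ∃ j, y = x + e j ∨ y = x - e j
  ne : ∀ i j, i ≠ j → e i ≠ e j ∧ e i ≠ -e j

/-- The symmetric difference `D_j^s f(x) = f(x + h e_j) - f(x - h e_j)`. -/
def centralDiff (e : Fin k → Γ.lattice) (h : ℝ) (j : Fin k) (f : Γ.vertices h → ℝ)
    (x : Γ.vertices h) : ℝ :=
  f (x + Γ.scale h (e j)) - f (x - Γ.scale h (e j))

/-- The `k × d` matrix `E` whose rows are the vectors `e j`. -/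
def edgeMatrix (e : Fin k → Γ.lattice) : Matrix (Fin k) (Fin d) ℝ :=
  Matrix.of fun j i => (e j : Fin d → ℝ) i

/-- The norm `|x|_Γ = √(xᵀ (Eᵀ E)⁻¹ x)` on `ℝ^d`. -/
def graphNorm (e : Fin k → Γ.lattice) (x : Fin d → ℝ) : ℝ :=
  √(x ⬝ᵥ (((edgeMatrix e)ᵀ * edgeMatrix e)⁻¹ *ᵥ x))

/-- The closed ball `B_r` for the norm `|·|_Γ`. -/
def ball (e : Fin k → Γ.lattice) (r : ℝ) : Set (Fin d → ℝ) := {x | graphNorm e x ≤ r}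

/-- The `ℓ²` norm of `u` over the (finitely many, for `h > 0`) vertices in `B_r`. -/
def l2Norm (e : Fin k → Γ.lattice) (h r : ℝ) (u : Γ.vertices h → ℝ) : ℝ :=
  √(∑' x : {x : Γ.vertices h // (x : Fin d → ℝ) ∈ ball e r}, u x ^ 2)

/-- The set `P_L` of the vectors `∑ α_j e_j` with integers `α_j` such that `∑ |α_j| ≤ L`, i.e. the
displacements along paths of at most `L` edges. -/
def pathVectors (e : Fin k → Γ.lattice) (L : ℕ) : Set Γ.lattice :=
  {v | ∃ α : Fin k → ℤ, ∑ j, |α j| ≤ (L : ℤ) ∧ v = ∑ j, α j • e j}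

/-- The magnetic Schrödinger operator
`h⁻² Δ u(x) + h⁻¹ ∑_j B_j(x) D_j^s u(x) + ∑_{v ∈ P_L} V_v(x + h v) u(x + h v)`. -/
def schrodinger (e : Fin k → Γ.lattice) (L : ℕ) (h : ℝ) (B : Fin k → Γ.vertices h → ℝ)
    (V : Γ.lattice → Γ.vertices h → ℝ) (u : Γ.vertices h → ℝ) (x : Γ.vertices h) : ℝ :=
  (h ^ 2)⁻¹ * Γ.laplacian h u x + h⁻¹ * ∑ j, B j x * centralDiff e h j u x
    + ∑ᶠ v ∈ pathVectors e L, V v (x + Γ.scale h v) * u (x + Γ.scale h v)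

end OnePointPeriodicGraph

end

/-! The proof is a Carleman estimate on the lattice, with constants uniform in the mesh size.

Geometry. The map x ↦ E(EᵀE)⁻¹x (`frameMap`) carries the graph norm to the Euclidean norm of ℝᵏ, and
the images of the 2k steps ±e_j form a tight frame of their span. To second order the graph
Laplacian is then isotropic. The analysis uses only this symmetric frame (`IsSymmetricFrame`), and
it uses the equation only through the bound of Δu by first differences and nearby values of u.

Carleman estimate. Conjugate Δ by e^W with W = τ(s - 1)², s = |y|², and write the result as S - R,
where S is symmetric with coefficients cosh and R is skew with coefficients sinh. Then ‖(S - R)f‖²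
is at least ‖Sf‖² - 2⟨Sf, Rf⟩, and the cross term is a commutator quadratic form
(`sum_conjugated_sq_ge`). Taylor expansion of that form (`commutator_form_ge`) gives a zeroth order
gain 64τ³h⁴(s-1)²s(12s-4)f² and a gradient loss (18/5)τh²|∇f|², with errors smaller by κ = 1/τ + τh;
hence τ must be large and τh small. Testing S against f converts ‖Sf‖² into a gradient gain
4τh²|∇f|², at the price of replacing 12s - 4 by 12s - 6. Both coefficients are positive for 3/5 ≤ s
≤ 19/20 (`carleman_estimate`).

Three balls. Apply this to a cut-off of a solution (`carleman_cutoff`). The lower order terms are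
absorbed for large τ, and only two thin shells remain, where a Caccioppoli inequality
(`caccioppoli`, `shell_bound`) removes the differences. Since W decreases in s, comparing its values
on the shells with its values up to s = 4/5 gives `three_balls_step`, which enlarges the squared
radius by the factor 20/17. Dilation and nine iterations lead from 1/4 to 1 (`threeBalls_one`),
which is (1).

Part (2) follows by optimising τ (`le_rpow_mul_rpow_add_of_forall_exp`). The balancing τ may exceed
the admissible range τ < δ/h, and this is the source of the term e^{-c₀/h}. -/

/-! ### Scalar Taylor expansions of the coefficients. -/

theorem abs_sinh_sub_self_le {x : ℝ} (hx : |x| ≤ 1) : |Real.sinh x - x| ≤ |x| ^ 3 := by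
  have h1 := Real.exp_bound hx (n := 3) (by norm_num)
  have h2 := Real.exp_bound (x := -x) (by rwa [abs_neg]) (n := 3) (by norm_num)
  simp only [Finset.sum_range_succ, Finset.sum_range_zero, Nat.factorial, abs_neg] at h1 h2
  norm_num at h1 h2
  rw [Real.sinh_eq]
  have h3 : 0 ≤ |x| ^ 3 := by positivity
  rw [abs_le] at h1 h2 ⊢
  constructor <;> linarith

theorem abs_cosh_sub_le {x : ℝ} (hx : |x| ≤ 1) : |Real.cosh x - 1 - x ^ 2 / 2| ≤ x ^ 4 := by
  have h1 := Real.exp_bound hx (n := 4) (by norm_num)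
  have h2 := Real.exp_bound (x := -x) (by rwa [abs_neg]) (n := 4) (by norm_num)
  simp only [Finset.sum_range_succ, Finset.sum_range_zero, Nat.factorial, abs_neg] at h1 h2
  norm_num at h1 h2
  rw [Real.cosh_eq]
  have h3 : |x| ^ 4 = x ^ 4 := by rw [← abs_pow, abs_of_nonneg (by positivity)]
  have h4 : 0 ≤ x ^ 4 := by positivity
  rw [h3] at h1 h2
  rw [abs_le] at h1 h2 ⊢
  constructor <;> linarith

theorem cosh_le_two {x : ℝ} (hx : |x| ≤ 1) : Real.cosh x ≤ 3 := by
  have h := abs_cosh_sub_le hx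
  have h1 : x ^ 2 ≤ 1 := by rw [← sq_abs]; exact pow_le_one₀ (abs_nonneg x) hx
  have h2 : x ^ 4 ≤ 1 := by nlinarith [sq_nonneg x]
  rw [abs_le] at h
  linarith [h.2]

/-- The mixed second difference of the weight is graded by powers of h as H + T + F, and Z is the
leading part of the first difference Y. The terms kept are those that are not small relative to the
main terms. The discarded ones are O(τ⁴h⁵) or O(τ²h⁴), the two summands of h⁴τ³(1/τ + τh). -/
theorem abs_sinh_mul_cosh_sub_le {τ h H T F Y Z : ℝ} (hτ : 1 ≤ τ) (hh : 0 < h)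
    (hτh : τ * h ≤ 1 / 100) (hH : |H| ≤ 12 * h ^ 2) (hT : |T| ≤ 24 * h ^ 3) (hF : |F| ≤ 14 * h ^ 4)
    (hY : |Y| ≤ 80 * (τ * h)) (hYZ : |Y - Z| ≤ 72 * (τ * h ^ 2)) (hZ : |Z| ≤ 8 * (τ * h)) :
    |Real.sinh (τ * (H + T + F)) * Real.cosh Y - τ * (H + T + H * Z ^ 2 / 2)|
      ≤ 10 ^ 8 * (h ^ 4 * τ ^ 3 * (1 / τ + τ * h)) := by
  have hτ0 : 0 < τ := by linarith
  have hh1 : h ≤ 1 / 100 := by nlinarith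
  have hX : |τ * (H + T + F)| ≤ 50 * (τ * h ^ 2) := by
    rw [abs_mul, abs_of_pos hτ0]
    have h1 : |H + T + F| ≤ |H| + |T| + |F| := abs_add_three H T F
    have h3 : h ^ 3 ≤ h ^ 2 := pow_le_pow_of_le_one hh.le (by linarith) (by norm_num)
    have h4 : h ^ 4 ≤ h ^ 2 := pow_le_pow_of_le_one hh.le (by linarith) (by norm_num)
    have : |H + T + F| ≤ 50 * h ^ 2 := by linarith
    nlinarith
  set X := τ * (H + T + F) with hXdef
  have hX1 : |X| ≤ 1 := by nlinarith
  have hY1 : |Y| ≤ 1 := by linarith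
  have e1 : |(Real.sinh X - X) * Real.cosh Y| ≤ 375000 * (τ ^ 4 * h ^ 5) := by
    rw [abs_mul, abs_of_pos (Real.cosh_pos Y)]
    calc |Real.sinh X - X| * Real.cosh Y ≤ |X| ^ 3 * 3 := by
          gcongr
          · exact abs_sinh_sub_self_le hX1
          · exact cosh_le_two hY1
      _ ≤ (50 * (τ * h ^ 2)) ^ 3 * 3 := by gcongr
      _ = 375000 * (τ ^ 3 * h ^ 5) * h := by ring
      _ ≤ 375000 * (τ ^ 3 * h ^ 5) * τ := by gcongr; linarith
      _ = _ := by ring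
  have e2 : |X * (Real.cosh Y - 1 - Y ^ 2 / 2)| ≤ 20480000 * (τ ^ 4 * h ^ 5) := by
    rw [abs_mul]
    have hY4 : Y ^ 4 = |Y| ^ 4 := by rw [← abs_pow, abs_of_nonneg (by positivity)]
    calc |X| * |Real.cosh Y - 1 - Y ^ 2 / 2| ≤ (50 * (τ * h ^ 2)) * (80 * (τ * h)) ^ 4 := by
          gcongr
          refine (abs_cosh_sub_le hY1).trans ?_
          rw [hY4]; gcongr
      _ = 2048000000 * (τ ^ 4 * h ^ 5) * (τ * h) := by ring
      _ ≤ 2048000000 * (τ ^ 4 * h ^ 5) * (1 / 100) := by gcongr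
      _ = _ := by ring
  have e3 : |τ * (T + F) * Y ^ 2 / 2| ≤ 121600 * (τ ^ 4 * h ^ 5) := by
    have h4 : h ^ 4 ≤ h ^ 3 := pow_le_pow_of_le_one hh.le (by linarith) (by norm_num)
    have hTF : |T + F| ≤ 38 * h ^ 3 := (abs_add_le T F).trans (by linarith)
    have : |τ * (T + F) * Y ^ 2 / 2| = τ * |T + F| * |Y| ^ 2 / 2 := by
      rw [abs_div, abs_mul, abs_mul, abs_of_pos hτ0, abs_pow, abs_two]
    rw [this]
    calc τ * |T + F| * |Y| ^ 2 / 2 ≤ τ * (38 * h ^ 3) * (80 * (τ * h)) ^ 2 / 2 := by gcongr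
      _ = 121600 * (τ ^ 3 * h ^ 5) * 1 := by ring
      _ ≤ 121600 * (τ ^ 3 * h ^ 5) * τ := by gcongr
      _ = _ := by ring
  have e4 : |τ * H * ((Y - Z) * (Y + Z)) / 2| ≤ 38016 * (τ ^ 4 * h ^ 5) := by
    have hYZ' : |Y + Z| ≤ 88 * (τ * h) := (abs_add_le Y Z).trans (by linarith)
    have : |τ * H * ((Y - Z) * (Y + Z)) / 2| = τ * |H| * (|Y - Z| * |Y + Z|) / 2 := by
      rw [abs_div, abs_mul, abs_mul, abs_mul, abs_of_pos hτ0, abs_two]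
    rw [this]
    calc τ * |H| * (|Y - Z| * |Y + Z|) / 2
        ≤ τ * (12 * h ^ 2) * ((72 * (τ * h ^ 2)) * (88 * (τ * h))) / 2 := by gcongr
      _ = 38016 * (τ ^ 3 * h ^ 5) * 1 := by ring
      _ ≤ 38016 * (τ ^ 3 * h ^ 5) * τ := by gcongr
      _ = _ := by ring
  have e5 : |τ * F| ≤ 14 * (τ ^ 2 * h ^ 4) := by
    rw [abs_mul, abs_of_pos hτ0]
    calc τ * |F| ≤ τ * (14 * h ^ 4) * 1 := by rw [mul_one]; gcongr
      _ ≤ τ * (14 * h ^ 4) * τ := by gcongr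
      _ = _ := by ring
  -- Linearise sinh, expand cosh to second order, drop T and F from the quadratic correction,
  -- replace Y by Z there, and drop F from the linear term.
  have key : Real.sinh X * Real.cosh Y - τ * (H + T + H * Z ^ 2 / 2) =
      (Real.sinh X - X) * Real.cosh Y + X * (Real.cosh Y - 1 - Y ^ 2 / 2)
        + τ * (T + F) * Y ^ 2 / 2 + τ * H * ((Y - Z) * (Y + Z)) / 2 + τ * F := by
    rw [hXdef]; ring
  have rhs : h ^ 4 * τ ^ 3 * (1 / τ + τ * h) = τ ^ 2 * h ^ 4 + τ ^ 4 * h ^ 5 := by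
    field_simp
  rw [key, rhs]
  have p1 : 0 ≤ τ ^ 4 * h ^ 5 := by positivity
  have p2 : 0 ≤ τ ^ 2 * h ^ 4 := by positivity
  rw [abs_le] at *
  constructor <;> linarith

/-- Expansion of the coefficients of the commutator for the weight `τ (s - 1) ^ 2`, where
`s = |y|²`, `A = ⟪y, m⟫`, `B = ⟪y, n⟫`, `M = |m|²`, `N = |n|²`, `g = ⟪m, n⟫`. -/
theorem abs_commutator_coeff_sub_le {τ h σ A B M N g : ℝ} (hτ : 1 ≤ τ) (hh : 0 < h)
    (hτh : τ * h ≤ 1 / 100) (hσ : |σ| ≤ 1) (hA : |A| ≤ h) (hB : |B| ≤ h) (hM : |M| ≤ h ^ 2)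
    (hN : |N| ≤ h ^ 2) (hg : |g| ≤ h ^ 2) :
    |Real.sinh (τ * (σ + (2 * A + M) + (2 * B + N) + 2 * g) ^ 2 - τ * (σ + (2 * A + M)) ^ 2
          - τ * (σ + (2 * B + N)) ^ 2 + τ * σ ^ 2)
        * Real.cosh (τ * (σ + (2 * A + M) + (2 * B + N) + 2 * g) ^ 2 - τ * σ ^ 2)
      - τ * ((8 * A * B + 4 * σ * g) + (4 * A * N + 4 * B * M + 8 * g * A + 8 * g * B)
          + (8 * A * B + 4 * σ * g) * (4 * τ * σ * A + 4 * τ * σ * B) ^ 2 / 2)|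
      ≤ 10 ^ 8 * (h ^ 4 * τ ^ 3 * (1 / τ + τ * h)) := by
  have hτ0 : 0 < τ := by linarith
  have hh1 : h ≤ 1 / 100 := by nlinarith
  have bd : ∀ {a b c d : ℝ}, |a| ≤ c → |b| ≤ d → |a * b| ≤ c * d := fun {a b c d} h1 h2 => by
    rw [abs_mul]; exact mul_le_mul h1 h2 (abs_nonneg _) ((abs_nonneg _).trans h1)
  have e1 : τ * (σ + (2 * A + M) + (2 * B + N) + 2 * g) ^ 2 - τ * (σ + (2 * A + M)) ^ 2
      - τ * (σ + (2 * B + N)) ^ 2 + τ * σ ^ 2 = τ * ((8 * A * B + 4 * σ * g)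
      + (4 * A * N + 4 * B * M + 8 * g * A + 8 * g * B)
      + (2 * M * N + 4 * g * M + 4 * g * N + 4 * g * g)) := by ring
  have hh2 : h ^ 2 ≤ h := by nlinarith
  have hAB := abs_le.mp (bd hA hB)
  have hσg := abs_le.mp (bd hσ hg)
  have hσA := abs_le.mp (bd hσ hA)
  have hσB := abs_le.mp (bd hσ hB)
  obtain ⟨P, hPdef⟩ : ∃ P, P = (2 * A + M) + (2 * B + N) + 2 * g := ⟨_, rfl⟩
  have hP : |P| ≤ 8 * h := by
    rw [abs_le] at *; rw [hPdef]; constructor <;> linarith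
  have hσP := abs_le.mp (bd hσ hP)
  have hPP := abs_le.mp (bd hP hP)
  have e2 : τ * (σ + (2 * A + M) + (2 * B + N) + 2 * g) ^ 2 - τ * σ ^ 2
      = τ * (2 * (σ * P) + P * P) := by rw [hPdef]; ring
  rw [e1, e2]
  apply abs_sinh_mul_cosh_sub_le hτ hh hτh
  · rw [abs_le]; constructor <;> linarith
  · have hAN := abs_le.mp (bd hA hN)
    have hBM := abs_le.mp (bd hB hM)
    have hgA := abs_le.mp (bd hg hA)
    have hgB := abs_le.mp (bd hg hB)
    rw [abs_le]; constructor <;> linarith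
  · have hMN := abs_le.mp (bd hM hN)
    have hgM := abs_le.mp (bd hg hM)
    have hgN := abs_le.mp (bd hg hN)
    have hgg := abs_le.mp (bd hg hg)
    rw [abs_le]; constructor <;> linarith
  · rw [abs_mul, abs_of_pos hτ0, show 80 * (τ * h) = τ * (80 * h) by ring]
    apply mul_le_mul_of_nonneg_left _ hτ0.le
    rw [abs_le]; constructor <;> linarith
  · have hσM := abs_le.mp (bd hσ hM)
    have hσN := abs_le.mp (bd hσ hN)
    have : τ * (2 * (σ * P) + P * P) - (4 * τ * σ * A + 4 * τ * σ * B)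
        = τ * (2 * (σ * M) + 2 * (σ * N) + 4 * (σ * g) + P * P) := by
      linear_combination 2 * τ * σ * hPdef
    rw [this, abs_mul, abs_of_pos hτ0, show 72 * (τ * h ^ 2) = τ * (72 * h ^ 2) by ring]
    apply mul_le_mul_of_nonneg_left _ hτ0.le
    rw [abs_le]; constructor <;> linarith
  · rw [show 4 * τ * σ * A + 4 * τ * σ * B = τ * (4 * (σ * A) + 4 * (σ * B)) by ring, abs_mul,
      abs_of_pos hτ0, show 8 * (τ * h) = τ * (8 * h) by ring]
    apply mul_le_mul_of_nonneg_left _ hτ0.le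
    rw [abs_le]; constructor <;> linarith

/-- Upper bound for the zeroth order coefficient of the symmetric part. -/
theorem cosh_weight_diff_sub_one_le {τ h σ A M : ℝ} (hτ : 1 ≤ τ) (hh : 0 < h)
    (hτh : τ * h ≤ 1 / 100) (hσ : |σ| ≤ 1) (hA : |A| ≤ h) (hM : |M| ≤ h ^ 2) :
    Real.cosh (τ * (σ + (2 * A + M)) ^ 2 - τ * σ ^ 2) - 1
      ≤ 8 * τ ^ 2 * σ ^ 2 * A ^ 2 + 10 ^ 8 * (h ^ 2 * τ ^ 2 * (1 / τ + τ * h)) := by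
  have hτ0 : 0 < τ := by linarith
  have hh1 : h ≤ 1 / 100 := by nlinarith
  have hh2 : h ^ 2 ≤ h := by nlinarith
  have bd : ∀ {a b c d : ℝ}, |a| ≤ c → |b| ≤ d → |a * b| ≤ c * d := fun {a b c d} h1 h2 => by
    rw [abs_mul]; exact mul_le_mul h1 h2 (abs_nonneg _) ((abs_nonneg _).trans h1)
  obtain ⟨P, hPdef⟩ : ∃ P, P = 2 * A + M := ⟨_, rfl⟩
  have hP : |P| ≤ 3 * h := by rw [abs_le] at *; rw [hPdef]; constructor <;> linarith
  have hσM := abs_le.mp (bd hσ hM)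
  have hσP := abs_le.mp (bd hσ hP)
  have hPP := abs_le.mp (bd hP hP)
  have hσA := abs_le.mp (bd hσ hA)
  obtain ⟨Y, eY⟩ : ∃ Y, Y = τ * (2 * (σ * P) + P * P) := ⟨_, rfl⟩
  have hY : |Y| ≤ 15 * (τ * h) := by
    rw [eY, abs_mul, abs_of_pos hτ0, show 15 * (τ * h) = τ * (15 * h) by ring]
    apply mul_le_mul_of_nonneg_left _ hτ0.le
    have : h * h ≤ h := by linarith
    rw [abs_le]; constructor <;> linarith
  obtain ⟨Z, eZ⟩ : ∃ Z, Z = τ * (4 * (σ * A)) := ⟨_, rfl⟩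
  have hYZ : |Y - Z| ≤ 11 * (τ * h ^ 2) := by
    rw [show Y - Z = τ * (2 * (σ * M) + P * P) by
        rw [eY, eZ]; linear_combination 2 * τ * σ * hPdef,
      abs_mul, abs_of_pos hτ0, show 11 * (τ * h ^ 2) = τ * (11 * h ^ 2) by ring]
    apply mul_le_mul_of_nonneg_left _ hτ0.le
    rw [abs_le]; constructor <;> linarith
  have hZ : |Z| ≤ 4 * (τ * h) := by
    rw [eZ, abs_mul, abs_of_pos hτ0, show 4 * (τ * h) = τ * (4 * h) by ring]
    apply mul_le_mul_of_nonneg_left _ hτ0.le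
    rw [abs_le]; constructor <;> linarith
  have hYZ' : |Y + Z| ≤ 19 * (τ * h) := (abs_add_le _ _).trans (by linarith)
  have hprod := abs_le.mp (bd hYZ hYZ')
  have h1 := abs_le.mp (abs_cosh_sub_le (x := Y) (by linarith))
  have hY4 : Y ^ 4 ≤ (15 * (τ * h)) ^ 4 := by
    rw [show Y ^ 4 = |Y| ^ 4 by rw [← abs_pow, abs_of_nonneg (by positivity)]]; gcongr
  have rhs : h ^ 2 * τ ^ 2 * (1 / τ + τ * h) = τ * h ^ 2 + τ ^ 3 * h ^ 3 := by field_simp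
  have p1 : 0 ≤ τ * h ^ 2 := by positivity
  have p3 : τ ^ 4 * h ^ 4 ≤ τ ^ 3 * h ^ 3 := by
    rw [← mul_pow, ← mul_pow]
    exact pow_le_pow_of_le_one (by positivity) (by linarith) (by norm_num)
  have p4 : τ * h ^ 2 * (τ * h) ≤ τ * h ^ 2 := by nlinarith
  have p2 : 0 ≤ τ ^ 3 * h ^ 3 := by positivity
  have e4 : 8 * τ ^ 2 * σ ^ 2 * A ^ 2 = Z ^ 2 / 2 := by rw [eZ]; ring
  have e5 : τ * (σ + (2 * A + M)) ^ 2 - τ * σ ^ 2 = Y := by rw [eY, hPdef]; ring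
  rw [rhs, e4, e5]
  linarith [h1.2, hprod.2]

/-! ### The commutator quadratic form at one point. -/

section PointwiseForm

open scoped InnerProductSpace

variable {ι : Type*} [Fintype ι]

theorem sum_eq_zero_of_odd (ν : Equiv.Perm ι) {c : ι → ℝ} (hc : ∀ i, c (ν i) = -c i) :
    ∑ i, c i = 0 := by
  have h : ∑ i, c (ν i) = ∑ i, c i := Equiv.sum_comp ν c
  simp only [hc, Finset.sum_neg_distrib] at h
  linarith

/-- Coefficients odd in the second index annihilate constants, so F j may be replaced by F j - f.
This turns one factor into a first difference, and hence gains a power of h over the trivial bound.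
-/
theorem abs_sum_sum_odd_le (ν : Equiv.Perm ι) {c : ι → ι → ℝ} {K : ℝ}
    (hc : ∀ i j, c i (ν j) = -c i j) (hK : ∀ i j, |c i j| ≤ K) (F : ι → ℝ) (f : ℝ) :
    |∑ i, ∑ j, c i j * F i * F j| ≤ K * (∑ i, |F i|) * ∑ i, |F i - f| := by
  have h1 : ∀ i, ∑ j, c i j * F i * F j = ∑ j, c i j * F i * (F j - f) := fun i => by
    have := sum_eq_zero_of_odd ν (hc i)
    have h2 : ∑ j, c i j * F i * (F j - f) = ∑ j, c i j * F i * F j - (∑ j, c i j) * (F i * f) := by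
      rw [Finset.sum_mul, ← Finset.sum_sub_distrib]
      exact Finset.sum_congr rfl fun j _ => by ring
    rw [h2, this]; ring
  simp only [h1]
  calc |∑ i, ∑ j, c i j * F i * (F j - f)| ≤ ∑ i, ∑ j, |c i j * F i * (F j - f)| :=
        (Finset.abs_sum_le_sum_abs _ _).trans
          (Finset.sum_le_sum fun i _ => Finset.abs_sum_le_sum_abs _ _)
    _ ≤ ∑ i, ∑ j, K * |F i| * |F j - f| := by
        refine Finset.sum_le_sum fun i _ => Finset.sum_le_sum fun j _ => ?_
        rw [abs_mul, abs_mul]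
        gcongr
        exact hK i j
    _ = K * (∑ i, |F i|) * ∑ i, |F i - f| := by
        rw [mul_assoc, Finset.sum_mul_sum, Finset.mul_sum]
        refine Finset.sum_congr rfl fun i _ => ?_
        rw [Finset.mul_sum]
        exact Finset.sum_congr rfl fun j _ => by ring

/-- Without oddness the mean value of the coefficients survives; freezing both factors at the centre
value f costs one first difference. The frozen term supplies the positive zeroth order contribution.
-/
theorem abs_sum_sum_sub_le {c : ι → ι → ℝ} {K : ℝ} (hK : ∀ i j, |c i j| ≤ K) (hK0 : 0 ≤ K)
    (F : ι → ℝ) (f : ℝ) :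
    |∑ i, ∑ j, c i j * F i * F j - f ^ 2 * ∑ i, ∑ j, c i j|
      ≤ K * (Fintype.card ι + 1) * (|f| + ∑ i, |F i|) * ∑ i, |F i - f| := by
  have h1 : ∑ i, ∑ j, c i j * F i * F j - f ^ 2 * ∑ i, ∑ j, c i j
      = ∑ i, ∑ j, c i j * ((F i - f) * F j + f * (F j - f)) := by
    rw [Finset.mul_sum, ← Finset.sum_sub_distrib]
    refine Finset.sum_congr rfl fun i _ => ?_
    rw [Finset.mul_sum, ← Finset.sum_sub_distrib]
    exact Finset.sum_congr rfl fun j _ => by ring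
  rw [h1]
  have hS : 0 ≤ ∑ i, |F i - f| := Finset.sum_nonneg fun i _ => abs_nonneg _
  have hF : 0 ≤ ∑ i, |F i| := Finset.sum_nonneg fun i _ => abs_nonneg _
  calc |∑ i, ∑ j, c i j * ((F i - f) * F j + f * (F j - f))|
      ≤ ∑ i, ∑ j, |c i j * ((F i - f) * F j + f * (F j - f))| :=
        (Finset.abs_sum_le_sum_abs _ _).trans
          (Finset.sum_le_sum fun i _ => Finset.abs_sum_le_sum_abs _ _)
    _ ≤ ∑ i, ∑ j, K * (|F i - f| * |F j| + |f| * |F j - f|) := by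
        refine Finset.sum_le_sum fun i _ => Finset.sum_le_sum fun j _ => ?_
        rw [abs_mul]
        gcongr
        · exact hK i j
        · refine (abs_add_le _ _).trans_eq ?_
          rw [abs_mul, abs_mul]
    _ = K * ((∑ i, |F i - f|) * (∑ i, |F i|) + Fintype.card ι * (|f| * ∑ i, |F i - f|)) := by
        simp only [← Finset.mul_sum, Finset.sum_add_distrib, ← Finset.sum_mul]
        simp only [Finset.sum_const, Finset.card_univ, nsmul_eq_mul]
        ring
    _ ≤ _ := by
        rw [mul_assoc, mul_assoc]
        apply mul_le_mul_of_nonneg_left _ hK0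
        have hn : (0 : ℝ) ≤ Fintype.card ι := Nat.cast_nonneg _
        have p1 := mul_nonneg hn (mul_nonneg hF hS)
        have p2 := mul_nonneg (abs_nonneg f) hS
        nlinarith

variable {V : Type*} [NormedAddCommGroup V] [InnerProductSpace ℝ V]

theorem norm_add_sq_sub_one (y m : V) :
    ‖y + m‖ ^ 2 - 1 = (‖y‖ ^ 2 - 1) + (2 * ⟪y, m⟫_ℝ + ‖m‖ ^ 2) := by
  rw [norm_add_sq_real]; ring

theorem norm_add_add_sq_sub_one (y m n : V) :
    ‖y + m + n‖ ^ 2 - 1 = (‖y‖ ^ 2 - 1) + (2 * ⟪y, m⟫_ℝ + ‖m‖ ^ 2)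
      + (2 * ⟪y, n⟫_ℝ + ‖n‖ ^ 2) + 2 * ⟪m, n⟫_ℝ := by
  rw [norm_add_sq_real, norm_add_sq_real, inner_add_left]; ring

/-- A product of a value and a difference is split by the arithmetic-geometric mean inequality, with
the value weighted by τh, so that the two halves have the sizes τ³h⁴ and τh² of the main terms. The
spare factor is exactly κ, because τ²κ = τ + τ³h. -/
theorem mixed_error_le {τ h κ n E Q S0 S1 : ℝ} (hτ : 1 ≤ τ) (hh : 0 < h)
    (hκ : κ = 1 / τ + τ * h) (hn0 : 0 ≤ n) (hE0 : 0 ≤ E) (hQ0 : 0 ≤ Q) (hS00 : 0 ≤ S0)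
    (hS10 : 0 ≤ S1) (hS1sq : S1 ^ 2 ≤ n * E) (hS0sq : S0 ^ 2 ≤ 2 * (n + 1) * Q) :
    τ * (216 * (h ^ 3 + τ ^ 2 * h ^ 4) + 192 * τ ^ 2 * h ^ 4 * (n + 1)) * (S0 * S1)
      ≤ 500 * (n + 1) ^ 2 * κ * (τ ^ 3 * h ^ 4 * Q + τ * h ^ 2 * E) := by
  have hτ0 : 0 < τ := by linarith
  have hκ0 : 0 < κ := by rw [hκ]; positivity
  have hκτ : τ ^ 2 * κ = τ + τ ^ 3 * h := by rw [hκ]; field_simp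
  have h0 : 2 * (h ^ 3 * τ ^ 2 * (S0 * S1)) ≤ τ ^ 3 * h ^ 4 * S0 ^ 2 + τ * h ^ 2 * S1 ^ 2 := by
    have := mul_nonneg (mul_nonneg hτ0.le (sq_nonneg h)) (sq_nonneg (τ * h * S0 - S1))
    linarith
  have h00 : τ ^ 3 * h ^ 4 * S0 ^ 2 + τ * h ^ 2 * S1 ^ 2
      ≤ 2 * (n + 1) * (τ ^ 3 * h ^ 4 * Q + τ * h ^ 2 * E) := by
    have a1 := mul_le_mul_of_nonneg_left hS0sq (show 0 ≤ τ ^ 3 * h ^ 4 by positivity)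
    have a2 := mul_le_mul_of_nonneg_left hS1sq (show 0 ≤ τ * h ^ 2 by positivity)
    have a3 : 0 ≤ τ * h ^ 2 * E := by positivity
    have a4 : 0 ≤ n * (τ * h ^ 2 * E) := by positivity
    linarith
  have h1 : τ * (216 * (h ^ 3 + τ ^ 2 * h ^ 4) + 192 * τ ^ 2 * h ^ 4 * (n + 1))
      ≤ 408 * (n + 1) * (h ^ 3 * (τ ^ 2 * κ)) := by
    rw [hκτ]
    have b1 : 0 ≤ n * (h ^ 3 * τ) := by positivity
    have b2 : 0 ≤ n * (h ^ 4 * τ ^ 3) := by positivity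
    have b3 : 0 ≤ h ^ 3 * τ := by positivity
    linarith
  calc τ * (216 * (h ^ 3 + τ ^ 2 * h ^ 4) + 192 * τ ^ 2 * h ^ 4 * (n + 1)) * (S0 * S1)
      ≤ 408 * (n + 1) * (h ^ 3 * (τ ^ 2 * κ)) * (S0 * S1) := by gcongr
    _ = 204 * (n + 1) * κ * (2 * (h ^ 3 * τ ^ 2 * (S0 * S1))) := by ring
    _ ≤ 204 * (n + 1) * κ * (2 * (n + 1) * (τ ^ 3 * h ^ 4 * Q + τ * h ^ 2 * E)) := by
        exact mul_le_mul_of_nonneg_left (h0.trans h00) (by positivity)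
    _ = 408 * ((n + 1) ^ 2 * κ * (τ ^ 3 * h ^ 4 * Q + τ * h ^ 2 * E)) := by ring
    _ ≤ 500 * ((n + 1) ^ 2 * κ * (τ ^ 3 * h ^ 4 * Q + τ * h ^ 2 * E)) := by
        have : 0 ≤ (n + 1) ^ 2 * κ * (τ ^ 3 * h ^ 4 * Q + τ * h ^ 2 * E) := by positivity
        linarith
    _ = _ := by ring

set_option maxHeartbeats 1000000 in
-- The coefficient splits into the Hessian part H, parts that are odd in one index, and the product
-- part c'. The first costs gradient energy, the second is an error by oddness, and the third,
-- evaluated by the tight frame identity `hy`, gives the zeroth order gain.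
theorem commutator_form_ge {ν : Equiv.Perm ι} {m : ι → V} {y : V} {τ h : ℝ} (hτ : 1 ≤ τ)
    (hh : 0 < h) (hτh : τ * h ≤ 1 / 100) (hneg : ∀ i, m (ν i) = -m i) (hm : ∀ i, ‖m i‖ ≤ h)
    (hsyn : ∀ c : ι → ℝ, ‖∑ i, c i • m i‖ ^ 2 ≤ 2 * h ^ 2 * ∑ i, c i ^ 2)
    (hy : ∑ i, ⟪y, m i⟫_ℝ • m i = (2 * h ^ 2) • y) (hs1 : 11 / 20 ≤ ‖y‖ ^ 2) (hs2 : ‖y‖ ^ 2 ≤ 1)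
    (F : ι → ℝ) (f : ℝ) :
    64 * τ ^ 3 * h ^ 4 * (‖y‖ ^ 2 - 1) ^ 2 * ‖y‖ ^ 2 * (12 * ‖y‖ ^ 2 - 4) * f ^ 2
      - 18 / 5 * τ * h ^ 2 * ∑ i, (F i - f) ^ 2
      - 2 * 10 ^ 8 * (Fintype.card ι + 1) ^ 2 * (1 / τ + τ * h) *
        (τ ^ 3 * h ^ 4 * (f ^ 2 + ∑ i, F i ^ 2) + τ * h ^ 2 * ∑ i, (F i - f) ^ 2)
    ≤ ∑ i, ∑ j, Real.sinh (τ * (‖y + m i + m j‖ ^ 2 - 1) ^ 2 - τ * (‖y + m i‖ ^ 2 - 1) ^ 2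
          - τ * (‖y + m j‖ ^ 2 - 1) ^ 2 + τ * (‖y‖ ^ 2 - 1) ^ 2)
        * Real.cosh (τ * (‖y + m i + m j‖ ^ 2 - 1) ^ 2 - τ * (‖y‖ ^ 2 - 1) ^ 2) * F i * F j := by
  have hτ0 : 0 < τ := by linarith
  have hh1 : h ≤ 1 / 100 := by nlinarith
  have hynorm : ‖y‖ ≤ 1 := by nlinarith [norm_nonneg y]
  set σ := ‖y‖ ^ 2 - 1 with hσdef
  set A : ι → ℝ := fun i => ⟪y, m i⟫_ℝ with hAdef
  set M : ι → ℝ := fun i => ‖m i‖ ^ 2 with hMdef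
  set g : ι → ι → ℝ := fun i j => ⟪m i, m j⟫_ℝ with hgdef
  have hA : ∀ i, |A i| ≤ h := fun i => by
    refine (abs_real_inner_le_norm _ _).trans ?_
    have := mul_le_mul hynorm (hm i) (norm_nonneg _) zero_le_one
    linarith
  have hM : ∀ i, |M i| ≤ h ^ 2 := fun i => by
    rw [hMdef, abs_of_nonneg (by positivity)]
    exact pow_le_pow_left₀ (norm_nonneg _) (hm i) 2
  have hg : ∀ i j, |g i j| ≤ h ^ 2 := fun i j => by
    refine (abs_real_inner_le_norm _ _).trans ?_
    have := mul_le_mul (hm i) (hm j) (norm_nonneg _) hh.le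
    linarith
  have hσ : |σ| ≤ 1 := by rw [abs_le]; constructor <;> linarith
  have hAν : ∀ i, A (ν i) = -A i := fun i => by simp [hAdef, hneg]
  have hgν : ∀ i j, g i (ν j) = -g i j := fun i j => by simp [hgdef, hneg]
  have bd : ∀ {a b c d : ℝ}, |a| ≤ c → |b| ≤ d → |a * b| ≤ c * d := fun {a b c d} h1 h2 => by
    rw [abs_mul]; exact mul_le_mul h1 h2 (abs_nonneg _) ((abs_nonneg _).trans h1)
  set κ := 1 / τ + τ * h with hκ
  have hκ0 : 0 < κ := by positivity
  set H : ι → ι → ℝ := fun i j => 8 * A i * A j + 4 * σ * g i j with hHdef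
  have hH : ∀ i j, |H i j| ≤ 12 * h ^ 2 := fun i j => by
    have h1 := abs_le.mp (bd (hA i) (hA j))
    have h2 := abs_le.mp (bd hσ (hg i j))
    rw [abs_le]; constructor <;> simp only [hHdef] <;> linarith
  have hHν : ∀ i j, H i (ν j) = -H i j := fun i j => by simp only [hHdef, hAν, hgν]; ring
  -- The cubic terms and the two pure squares of (4τσA i + 4τσA j)² are distributed between `c i j`
  -- and `c j i`, so that `c` is odd in its second index.
  set c : ι → ι → ℝ := fun i j => 4 * A j * M i + 8 * g i j * A i
    + H i j * (4 * τ * σ * A i) ^ 2 / 2 with hcdef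
  have hα : ∀ i, |4 * τ * σ * A i| ≤ 4 * τ * h := fun i => by
    rw [show 4 * τ * σ * A i = 4 * τ * (σ * A i) by ring, abs_mul, abs_of_pos (by positivity)]
    have := bd hσ (hA i)
    gcongr; linarith
  have hcν : ∀ i j, c i (ν j) = -c i j := fun i j => by
    simp only [hcdef, hHν, hAν, hgν]; ring
  have hc : ∀ i j, |c i j| ≤ 108 * (h ^ 3 + τ ^ 2 * h ^ 4) := fun i j => by
    have h1 := abs_le.mp (bd (hA j) (hM i))
    have h2 := abs_le.mp (bd (hg i j) (hA i))
    have h3 := abs_le.mp (bd (hH i j) (bd (hα i) (hα i)))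
    have p1 : 0 ≤ h ^ 3 := by positivity
    have p2 : 0 ≤ τ ^ 2 * h ^ 4 := by positivity
    rw [abs_le]; constructor <;> simp only [hcdef] <;> linarith
  -- The cross term of the same square is even in each index, so its sum does not cancel.
  set c' : ι → ι → ℝ := fun i j => H i j * (4 * τ * σ * A i) * (4 * τ * σ * A j) with hc'def
  have hc' : ∀ i j, |c' i j| ≤ 192 * τ ^ 2 * h ^ 4 := fun i j =>
    (bd (bd (hH i j) (hα i)) (hα j)).trans_eq (by ring)
  set S0 := |f| + ∑ i, |F i| with hS0
  set S1 := ∑ i, |F i - f| with hS1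
  have hFS : ∑ i, |F i| ≤ S0 := by rw [hS0]; linarith [abs_nonneg f]
  have hF0 : 0 ≤ ∑ i, |F i| := Finset.sum_nonneg fun i _ => abs_nonneg _
  have hS00 : 0 ≤ S0 := hF0.trans hFS
  have hS10 : 0 ≤ S1 := Finset.sum_nonneg fun i _ => abs_nonneg _
  -- the leading part
  have hlead : -(18 / 5 * h ^ 2 * ∑ i, (F i - f) ^ 2) ≤ ∑ i, ∑ j, H i j * F i * F j := by
    set D := ∑ i, F i • m i with hD
    have hDeq : ∑ i, ∑ j, H i j * F i * F j = 8 * ⟪y, D⟫_ℝ ^ 2 + 4 * σ * ‖D‖ ^ 2 := by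
      have e1 : ⟪y, D⟫_ℝ = ∑ i, F i * A i := by
        rw [hD, inner_sum]; exact Finset.sum_congr rfl fun i _ => by rw [real_inner_smul_right]
      have e2 : ‖D‖ ^ 2 = ∑ i, ∑ j, F i * F j * g i j := by
        rw [← real_inner_self_eq_norm_sq, hD, sum_inner]
        refine Finset.sum_congr rfl fun i _ => ?_
        rw [inner_sum]
        refine Finset.sum_congr rfl fun j _ => ?_
        rw [real_inner_smul_right, real_inner_smul_left]; ring
      rw [e1, e2, sq, Finset.sum_mul_sum, Finset.mul_sum, Finset.mul_sum, ← Finset.sum_add_distrib]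
      refine Finset.sum_congr rfl fun i _ => ?_
      rw [Finset.mul_sum, Finset.mul_sum, ← Finset.sum_add_distrib]
      exact Finset.sum_congr rfl fun j _ => by simp only [hHdef]; ring
    -- The steps come in opposite pairs, so D sees only the odd part of F and is controlled by the
    -- differences F i - f.
    have hDd : D = ∑ i, ((F i - F (ν i)) / 2) • m i := by
      have e : ∑ i, F (ν i) • m i = -D := by
        rw [hD, ← Equiv.sum_comp ν (fun i => F i • m i), ← Finset.sum_neg_distrib]
        refine Finset.sum_congr rfl fun i _ => ?_
        rw [hneg, smul_neg, neg_neg]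
      have : ∑ i, ((F i - F (ν i)) / 2) • m i = (1 / 2 : ℝ) • (D - ∑ i, F (ν i) • m i) := by
        rw [hD, ← Finset.sum_sub_distrib, Finset.smul_sum]
        refine Finset.sum_congr rfl fun i _ => ?_
        rw [← sub_smul, smul_smul]; ring_nf
      rw [this, e, sub_neg_eq_add, ← two_smul ℝ D, smul_smul]; norm_num
    have hDn : ‖D‖ ^ 2 ≤ 2 * h ^ 2 * ∑ i, (F i - f) ^ 2 := by
      have e : ∑ i, (F (ν i) - f) ^ 2 = ∑ i, (F i - f) ^ 2 :=
        Equiv.sum_comp ν fun i => (F i - f) ^ 2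
      have h1 : ∑ i, ((F i - F (ν i)) / 2) ^ 2 ≤ ∑ i, (F i - f) ^ 2 := by
        calc ∑ i, ((F i - F (ν i)) / 2) ^ 2
            ≤ ∑ i, ((F i - f) ^ 2 / 2 + (F (ν i) - f) ^ 2 / 2) := by
              refine Finset.sum_le_sum fun i _ => ?_
              nlinarith [sq_nonneg ((F i - f) + (F (ν i) - f))]
          _ = ∑ i, (F i - f) ^ 2 := by
              rw [Finset.sum_add_distrib, ← Finset.sum_div, ← Finset.sum_div, e]; ring
      have h2 := hsyn fun i => (F i - F (ν i)) / 2
      rw [← hDd] at h2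
      exact h2.trans (by gcongr)
    rw [hDeq]
    have hE : 0 ≤ 2 * h ^ 2 * ∑ i, (F i - f) ^ 2 :=
      mul_nonneg (by positivity) (Finset.sum_nonneg fun i _ => sq_nonneg _)
    -- The square of ⟪y, D⟫ is dropped, and 4 · (9/20) · 2 gives the constant 18/5.
    have hσ2 : -(9 / 20) ≤ σ := by rw [hσdef]; linarith
    nlinarith [sq_nonneg ⟪y, D⟫_ℝ, sq_nonneg ‖D‖]
  -- the zeroth order part
  have hzero : ∑ i, ∑ j, c' i j
      = 64 * τ ^ 2 * h ^ 4 * σ ^ 2 * ‖y‖ ^ 2 * (12 * ‖y‖ ^ 2 - 4) := by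
    have e1 : ∑ i, A i * A i = 2 * h ^ 2 * ‖y‖ ^ 2 := by
      have := congrArg (fun v => ⟪y, v⟫_ℝ) hy
      simp only [inner_sum, real_inner_smul_right, real_inner_self_eq_norm_sq] at this
      exact this
    have e2 : ∑ i, ∑ j, A i * A j * g i j = 4 * h ^ 4 * ‖y‖ ^ 2 := by
      have := congrArg (fun v => ⟪v, v⟫_ℝ) hy
      simp only [sum_inner, inner_sum, real_inner_smul_right, real_inner_smul_left,
        real_inner_self_eq_norm_sq] at this
      rw [show 4 * h ^ 4 * ‖y‖ ^ 2 = ‖(2 * h ^ 2) • y‖ ^ 2 by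
        rw [norm_smul, mul_pow, Real.norm_eq_abs, sq_abs]; ring, ← this]
      refine Finset.sum_congr rfl fun i _ => Finset.sum_congr rfl fun j _ => ?_
      simp only [hAdef, hgdef]
      rw [real_inner_comm (m j) (m i)]
      ring
    have e3 : ∑ i, ∑ j, c' i j = 16 * τ ^ 2 * σ ^ 2 * (8 * ((∑ i, A i * A i) * ∑ j, A j * A j)
        + 4 * σ * ∑ i, ∑ j, A i * A j * g i j) := by
      rw [Finset.sum_mul_sum, Finset.mul_sum, Finset.mul_sum, ← Finset.sum_add_distrib,
        Finset.mul_sum]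
      refine Finset.sum_congr rfl fun i _ => ?_
      rw [Finset.mul_sum, Finset.mul_sum, ← Finset.sum_add_distrib, Finset.mul_sum]
      refine Finset.sum_congr rfl fun j _ => ?_
      simp only [hc'def, hHdef]; ring
    rw [e3, e1, e2, hσdef]; ring
  have herr1 := abs_le.mp (abs_sum_sum_odd_le ν hcν hc F f)
  have herr2 := abs_le.mp (abs_sum_sum_sub_le hc' (by positivity) F f)
  rw [hzero] at herr2
  -- the remainder
  have hΘ : ∀ i j, τ * (H i j * F i * F j) + τ * (c i j * F i * F j) + τ * (c j i * F j * F i)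
      + τ * (c' i j * F i * F j) - 10 ^ 8 * (h ^ 4 * τ ^ 3 * κ) * (|F i| * |F j|) ≤
      Real.sinh (τ * (‖y + m i + m j‖ ^ 2 - 1) ^ 2 - τ * (‖y + m i‖ ^ 2 - 1) ^ 2
          - τ * (‖y + m j‖ ^ 2 - 1) ^ 2 + τ * σ ^ 2)
        * Real.cosh (τ * (‖y + m i + m j‖ ^ 2 - 1) ^ 2 - τ * σ ^ 2) * F i * F j := fun i j => by
    have h1 := abs_commutator_coeff_sub_le hτ hh hτh hσ (hA i) (hA j) (hM i) (hM j) (hg i j)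
    rw [norm_add_add_sq_sub_one, norm_add_sq_sub_one, norm_add_sq_sub_one]
    set Θ := Real.sinh (τ * (σ + (2 * A i + M i) + (2 * A j + M j) + 2 * g i j) ^ 2
        - τ * (σ + (2 * A i + M i)) ^ 2 - τ * (σ + (2 * A j + M j)) ^ 2 + τ * σ ^ 2)
        * Real.cosh (τ * (σ + (2 * A i + M i) + (2 * A j + M j) + 2 * g i j) ^ 2 - τ * σ ^ 2)
      with hΘdef
    have h2 := bd h1 (le_refl |F i * F j|)
    rw [abs_mul (F i)] at h2
    have h3 := (abs_le.mp h2).1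
    have hgs : g j i = g i j := real_inner_comm _ _
    have h4 : (Θ - τ * ((8 * A i * A j + 4 * σ * g i j) + (4 * A i * M j + 4 * A j * M i
        + 8 * g i j * A i + 8 * g i j * A j) + (8 * A i * A j + 4 * σ * g i j)
        * (4 * τ * σ * A i + 4 * τ * σ * A j) ^ 2 / 2)) * (F i * F j)
        = Θ * F i * F j - (τ * (H i j * F i * F j) + τ * (c i j * F i * F j)
          + τ * (c j i * F j * F i) + τ * (c' i j * F i * F j)) := by
      simp only [hHdef, hcdef, hc'def, hgs]; ring
    rw [h4] at h3
    simp only [hκ]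
    linarith
  have hsum := Finset.sum_le_sum fun i (_ : i ∈ Finset.univ) =>
    Finset.sum_le_sum fun j (_ : j ∈ Finset.univ) => hΘ i j
  refine le_trans ?_ hsum
  have hsplit : ∑ i, ∑ j, (τ * (H i j * F i * F j) + τ * (c i j * F i * F j)
      + τ * (c j i * F j * F i) + τ * (c' i j * F i * F j)
      - 10 ^ 8 * (h ^ 4 * τ ^ 3 * κ) * (|F i| * |F j|))
      = τ * (∑ i, ∑ j, H i j * F i * F j) + τ * (∑ i, ∑ j, c i j * F i * F j)
        + τ * (∑ i, ∑ j, c i j * F i * F j) + τ * (∑ i, ∑ j, c' i j * F i * F j)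
        - 10 ^ 8 * (h ^ 4 * τ ^ 3 * κ) * ((∑ i, |F i|) * ∑ i, |F i|) := by
    simp only [Finset.sum_sub_distrib, Finset.sum_add_distrib, ← Finset.mul_sum]
    rw [Finset.sum_comm (f := fun i j => c j i * F j * F i), Finset.sum_mul_sum]
    simp only [← Finset.mul_sum]
  rw [hsplit]
  set n : ℝ := (Fintype.card ι : ℝ) with hn
  have hn0 : 0 ≤ n := Nat.cast_nonneg _
  set E := ∑ i, (F i - f) ^ 2 with hE
  set Q := f ^ 2 + ∑ i, F i ^ 2 with hQ
  have hE0 : 0 ≤ E := Finset.sum_nonneg fun i _ => sq_nonneg _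
  have hQ0 : 0 ≤ Q := add_nonneg (sq_nonneg _) (Finset.sum_nonneg fun i _ => sq_nonneg _)
  have hS1sq : S1 ^ 2 ≤ n * E := by
    have := sq_sum_le_card_mul_sum_sq (s := Finset.univ) (f := fun i => |F i - f|)
    simpa [hn, hE, sq_abs] using this
  have hFsq : (∑ i, |F i|) ^ 2 ≤ n * ∑ i, F i ^ 2 := by
    have := sq_sum_le_card_mul_sum_sq (s := Finset.univ) (f := fun i => |F i|)
    simpa [hn, sq_abs] using this
  have hS0sq : S0 ^ 2 ≤ 2 * (n + 1) * Q := by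
    have h1 : S0 ^ 2 ≤ 2 * (|f| ^ 2 + (∑ i, |F i|) ^ 2) := add_sq_le
    rw [sq_abs] at h1
    have h2 : 0 ≤ ∑ i, F i ^ 2 := Finset.sum_nonneg fun i _ => sq_nonneg _
    have h3 := mul_nonneg hn0 (sq_nonneg f)
    rw [hQ]
    linarith
  have hκτ : τ ^ 2 * κ = τ + τ ^ 3 * h := by rw [hκ]; field_simp
  have hmix := mixed_error_le hτ hh hκ hn0 hE0 hQ0 hS00 hS10 hS1sq hS0sq
  have hrem : 10 ^ 8 * (h ^ 4 * τ ^ 3 * κ) * ((∑ i, |F i|) * ∑ i, |F i|)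
      ≤ 10 ^ 8 * (n + 1) ^ 2 * κ * (τ ^ 3 * h ^ 4 * Q) := by
    have h1 : (∑ i, |F i|) * ∑ i, |F i| ≤ (n + 1) ^ 2 * Q := by
      have h2 : 0 ≤ ∑ i, F i ^ 2 := Finset.sum_nonneg fun i _ => sq_nonneg _
      have h3 : n * ∑ i, F i ^ 2 ≤ (n + 1) ^ 2 * ∑ i, F i ^ 2 :=
        mul_le_mul_of_nonneg_right (by linarith [sq_nonneg n]) h2
      have h4 : 0 ≤ (n + 1) ^ 2 * f ^ 2 := by positivity
      have h5 : (∑ i, |F i|) * ∑ i, |F i| = (∑ i, |F i|) ^ 2 := (sq _).symm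
      rw [hQ]; linarith
    calc _ ≤ 10 ^ 8 * (h ^ 4 * τ ^ 3 * κ) * ((n + 1) ^ 2 * Q) := by gcongr
      _ = _ := by ring
  have hodd : τ * (108 * (h ^ 3 + τ ^ 2 * h ^ 4) * (∑ i, |F i|) * S1)
      ≤ τ * (108 * (h ^ 3 + τ ^ 2 * h ^ 4) * S0 * S1) := by gcongr
  have herr1' := mul_le_mul_of_nonneg_left herr1.1 hτ0.le
  have herr2' := mul_le_mul_of_nonneg_left herr2.1 hτ0.le
  rw [← hS1] at herr1'
  rw [← hS0, ← hS1] at herr2'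
  have hlead' := mul_le_mul_of_nonneg_left hlead hτ0.le
  have hfin : 500 * (n + 1) ^ 2 * κ * (τ ^ 3 * h ^ 4 * Q + τ * h ^ 2 * E)
      + 10 ^ 8 * (n + 1) ^ 2 * κ * (τ ^ 3 * h ^ 4 * Q)
      ≤ 2 * 10 ^ 8 * (n + 1) ^ 2 * κ * (τ ^ 3 * h ^ 4 * Q + τ * h ^ 2 * E) := by
    have q1 : 0 ≤ (n + 1) ^ 2 * κ * (τ ^ 3 * h ^ 4 * Q) := by positivity
    have q2 : 0 ≤ (n + 1) ^ 2 * κ * (τ * h ^ 2 * E) := by positivity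
    linarith
  refine le_trans ?_ (sub_le_sub_left hrem _)
  generalize ∑ i, ∑ j, c i j * F i * F j = C1 at *
  generalize ∑ i, ∑ j, c' i j * F i * F j = C2 at *
  generalize ∑ i, ∑ j, H i j * F i * F j = C3 at *
  have t1 : -(τ * (108 * (h ^ 3 + τ ^ 2 * h ^ 4) * S0 * S1)) ≤ τ * C1 := by linarith
  clear_value κ S0 S1 E Q n σ
  clear hsum hΘ
  linarith
end PointwiseForm

/-! ### Summation by parts and the Carleman estimate. -/

section Carleman

open scoped InnerProductSpace

/-- The support of F and its translate by -v both lie in Z, so both finite sums are sums over the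
whole group, where translation invariance applies. -/
theorem sum_shift_eq {G : Type*} [AddCommGroup G] {Z : Finset G} {F : G → ℝ} {v : G}
    (hF : ∀ x, F x ≠ 0 → x ∈ Z ∧ x - v ∈ Z) : ∑ x ∈ Z, F (x + v) = ∑ x ∈ Z, F x := by
  rw [← finsum_eq_sum_of_support_subset F (s := Z) fun x hx => (hF x hx).1,
    ← finsum_eq_sum_of_support_subset (fun x => F (x + v)) (s := Z) fun x hx => by
      simpa using (hF _ hx).2]
  exact finsum_comp_equiv (Equiv.addRight v)

theorem abs_sq_sub_sq_le {r t η : ℝ} (hr0 : 0 ≤ r) (ht0 : 0 ≤ t) (hr : r ≤ 1) (hη : η ≤ 1)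
    (h : |t - r| ≤ η) : |t ^ 2 - r ^ 2| ≤ 3 * η := by
  have h0 := (abs_nonneg _).trans h
  have h1 := (abs_le.mp h).2
  rw [show t ^ 2 - r ^ 2 = (t - r) * (t + r) by ring, abs_mul, abs_of_nonneg (add_nonneg ht0 hr0),
    mul_comm 3]
  exact mul_le_mul h (by linarith) (by positivity) h0

variable {G : Type*} [AddCommGroup G] {ι : Type*} [Fintype ι]

/-- The conjugated Laplacian is S - R. In the expanded square ‖Rf‖² is discarded and -2⟨Sf, Rf⟩ is
rewritten as the commutator form, with mixed second differences of W inside sinh. These are small,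
whereas the first differences in ⟨Sf, Rf⟩ itself are not. -/
theorem sum_conjugated_sq_ge {n : ι → G} {ν : Equiv.Perm ι} (hν : ∀ i, n (ν i) = -n i)
    (W f : G → ℝ) {Z : Finset G} (hf : ∀ x, f x ≠ 0 → x ∈ Z ∧ ∀ i, x + n i ∈ Z) :
    ∑ x ∈ Z, (∑ i, (Real.cosh (W (x + n i) - W x) * f (x + n i) - f x)) ^ 2
      + ∑ x ∈ Z, ∑ i, ∑ j, Real.sinh (W (x + n i + n j) - W (x + n i) - W (x + n j) + W x)
        * Real.cosh (W (x + n i + n j) - W x) * f (x + n i) * f (x + n j)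
    ≤ ∑ x ∈ Z, (∑ i, (Real.exp (W x - W (x + n i)) * f (x + n i) - f x)) ^ 2 := by
  set S : G → ℝ := fun x => ∑ i, (Real.cosh (W (x + n i) - W x) * f (x + n i) - f x) with hS
  set C : G → ℝ := fun x => ∑ i, Real.cosh (W (x + n i) - W x) * f (x + n i) with hC
  set R : G → ℝ := fun x => ∑ i, Real.sinh (W (x + n i) - W x) * f (x + n i) with hR
  have hSC : ∀ x, S x = C x - Fintype.card ι * f x := fun x => by
    simp only [hS, hC, Finset.sum_sub_distrib, Finset.sum_const, Finset.card_univ, nsmul_eq_mul]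
  have hg : ∀ x, ∑ i, (Real.exp (W x - W (x + n i)) * f (x + n i) - f x) = S x - R x := fun x => by
    simp only [hS, hR]
    rw [← Finset.sum_sub_distrib]
    refine Finset.sum_congr rfl fun i _ => ?_
    rw [← neg_sub (W (x + n i)) (W x), ← Real.cosh_sub_sinh]; ring
  have hneg : ∀ (x : G) i, x + n (ν i) = x - n i := fun x i => by rw [hν]; abel
  -- Thus the diagonal part of S does not contribute to the cross term.
  have hskew : ∑ x ∈ Z, f x * R x = 0 := by
    have h1 : ∑ x ∈ Z, f x * R x
        = ∑ i, ∑ x ∈ Z, Real.sinh (W (x + n i) - W x) * (f x * f (x + n i)) := by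
      rw [Finset.sum_comm]
      refine Finset.sum_congr rfl fun x _ => ?_
      rw [hR, Finset.mul_sum]
      exact Finset.sum_congr rfl fun i _ => by ring
    rw [h1]
    refine sum_eq_zero_of_odd ν fun i => ?_
    have h2 := sum_shift_eq (Z := Z) (v := n i)
      (F := fun x => Real.sinh (W (x + n (ν i)) - W x) * (f x * f (x + n (ν i)))) fun x hx => by
        have h3 : f x ≠ 0 := fun h0 => hx (by simp [h0])
        refine ⟨(hf x h3).1, ?_⟩
        rw [← hneg]; exact (hf x h3).2 _
    rw [← h2, ← Finset.sum_neg_distrib]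
    refine Finset.sum_congr rfl fun x _ => ?_
    simp only [hneg, add_sub_cancel_right]
    rw [← neg_sub (W (x + n i)) (W x), Real.sinh_neg]; ring
  set q : ι → ι → G → ℝ := fun i j x =>
    Real.sinh (W (x + n i) + W (x + n j) - 2 * W x) * f (x + n i) * f (x + n j) with hq
  have hCR : ∀ x, 2 * (C x * R x) = ∑ i, ∑ j, q i j x := fun x => by
    have e1 : C x * R x = ∑ i, ∑ j, Real.cosh (W (x + n i) - W x) * Real.sinh (W (x + n j) - W x)
        * f (x + n i) * f (x + n j) := by
      rw [hC, hR, Finset.sum_mul_sum]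
      exact Finset.sum_congr rfl fun i _ => Finset.sum_congr rfl fun j _ => by ring
    have e2 := e1
    rw [Finset.sum_comm] at e2
    rw [two_mul]
    nth_rw 1 [e1]
    rw [e2, ← Finset.sum_add_distrib]
    refine Finset.sum_congr rfl fun i _ => ?_
    rw [← Finset.sum_add_distrib]
    refine Finset.sum_congr rfl fun j _ => ?_
    simp only [hq]
    rw [show W (x + n i) + W (x + n j) - 2 * W x = (W (x + n i) - W x) + (W (x + n j) - W x) by ring,
      Real.sinh_add]
    ring
  set Q := ∑ x ∈ Z, ∑ i, ∑ j, q i j x with hQ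
  have hQ1 : Q = ∑ i, ∑ j, ∑ x ∈ Z, q i j x := by
    rw [hQ, Finset.sum_comm]
    exact Finset.sum_congr rfl fun i _ => Finset.sum_comm
  -- Translation by n i + n j sends the base point to the opposite corner of the parallelogram x, x
  -- + n i, x + n j, x + n i + n j, while the two values of f stay the same.
  have hshift : ∀ i j, ∑ x ∈ Z, q (ν j) (ν i) x = ∑ x ∈ Z, Real.sinh (W (x + n i) + W (x + n j)
      - 2 * W (x + n i + n j)) * f (x + n i) * f (x + n j) := fun i j => by
    have h2 := sum_shift_eq (Z := Z) (v := n i + n j) (F := q (ν j) (ν i)) fun x hx => by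
      have h3 : f (x + n (ν j)) ≠ 0 := fun h0 => hx (by simp [hq, h0])
      have h4 := (hf _ h3).2
      refine ⟨?_, ?_⟩
      · have := h4 j; rwa [hneg, sub_add_cancel] at this
      · have := h4 (ν i)
        rwa [hneg, hneg, show x - n j - n i = x - (n i + n j) by abel] at this
    rw [← h2]
    refine Finset.sum_congr rfl fun x _ => ?_
    simp only [hq, hneg, ← add_assoc, add_sub_cancel_right]
    rw [show x + n i + n j - n i = x + n j by abel]
  have hQ2 : Q = ∑ i, ∑ j, ∑ x ∈ Z, Real.sinh (W (x + n i) + W (x + n j)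
      - 2 * W (x + n i + n j)) * f (x + n i) * f (x + n j) := by
    simp only [← hshift]
    rw [hQ1, Finset.sum_comm, ← Equiv.sum_comp ν fun j => ∑ i, ∑ x ∈ Z, q i j x]
    refine (Finset.sum_congr rfl fun i _ => ?_)
    exact (Equiv.sum_comp ν fun j => ∑ x ∈ Z, q j (ν i) x).symm
  -- Averaging the two forms of Q and using sinh(a - b) - sinh(a + b) = -2 cosh a · sinh b, where a
  -- is the diagonal difference of W and b its mixed second difference.
  have hT : ∑ x ∈ Z, ∑ i, ∑ j, Real.sinh (W (x + n i + n j) - W (x + n i) - W (x + n j) + W x)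
        * Real.cosh (W (x + n i + n j) - W x) * f (x + n i) * f (x + n j) = -Q := by
    have : -Q = -(Q + Q) / 2 := by ring
    rw [this]
    nth_rw 1 [hQ1]
    rw [hQ2, ← Finset.sum_add_distrib, Finset.sum_comm, ← Finset.sum_neg_distrib, Finset.sum_div]
    refine Finset.sum_congr rfl fun i _ => ?_
    rw [← Finset.sum_add_distrib, Finset.sum_comm, ← Finset.sum_neg_distrib, Finset.sum_div]
    refine Finset.sum_congr rfl fun j _ => ?_
    rw [← Finset.sum_add_distrib, ← Finset.sum_neg_distrib, Finset.sum_div]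
    refine Finset.sum_congr rfl fun x _ => ?_
    simp only [hq]
    rw [show W (x + n i) + W (x + n j) - 2 * W x = (W (x + n i + n j) - W x)
        - (W (x + n i + n j) - W (x + n i) - W (x + n j) + W x) by ring,
      show W (x + n i) + W (x + n j) - 2 * W (x + n i + n j) = -((W (x + n i + n j) - W x)
        + (W (x + n i + n j) - W (x + n i) - W (x + n j) + W x)) by ring,
      Real.sinh_sub, Real.sinh_neg, Real.sinh_add (W (x + n i + n j) - W x)]
    ring
  have hSR : ∑ x ∈ Z, 2 * (S x * R x) = Q := by
    have : ∀ x, 2 * (S x * R x) = ∑ i, ∑ j, q i j x - 2 * Fintype.card ι * (f x * R x) :=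
      fun x => by rw [← hCR, hSC]; ring
    simp only [this]
    rw [Finset.sum_sub_distrib, ← Finset.mul_sum, hskew, hQ]; ring
  rw [hT, ← hSR, ← Finset.sum_neg_distrib, ← Finset.sum_add_distrib]
  refine Finset.sum_le_sum fun x _ => ?_
  rw [hg]
  linarith [sq_nonneg (R x)]

/-- Polarise f(x + n i) f(x). The conductance cosh(W(x + n i) - W x) is symmetric in its two ends,
so both squares carry the same total weight. -/
theorem sum_symmetric_mul_self {n : ι → G} {ν : Equiv.Perm ι} (hν : ∀ i, n (ν i) = -n i)
    (W f : G → ℝ) {Z : Finset G} (hf : ∀ x, f x ≠ 0 → x ∈ Z ∧ ∀ i, x + n i ∈ Z) :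
    ∑ x ∈ Z, (∑ i, (Real.cosh (W (x + n i) - W x) * f (x + n i) - f x)) * f x
      = ∑ x ∈ Z, ∑ i, ((Real.cosh (W (x + n i) - W x) - 1) * f x ^ 2
        - Real.cosh (W (x + n i) - W x) * (f (x + n i) - f x) ^ 2 / 2) := by
  have hneg : ∀ (x : G) i, x + n (ν i) = x - n i := fun x i => by rw [hν]; abel
  have h1 : ∑ i, ∑ x ∈ Z, Real.cosh (W (x + n i) - W x) * f (x + n i) ^ 2
      = ∑ i, ∑ x ∈ Z, Real.cosh (W (x + n i) - W x) * f x ^ 2 := by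
    rw [← Equiv.sum_comp ν fun i => ∑ x ∈ Z, Real.cosh (W (x + n i) - W x) * f x ^ 2]
    refine Finset.sum_congr rfl fun i _ => ?_
    rw [← sum_shift_eq (Z := Z) (v := n i)
      (F := fun x => Real.cosh (W (x + n (ν i)) - W x) * f x ^ 2) fun x hx => by
        have h3 : f x ≠ 0 := fun h0 => hx (by simp [h0])
        refine ⟨(hf x h3).1, ?_⟩
        rw [← hneg]; exact (hf x h3).2 _]
    refine Finset.sum_congr rfl fun x _ => ?_
    simp only [hneg, add_sub_cancel_right]
    rw [← Real.cosh_neg, neg_sub]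
  have h2 : ∑ x ∈ Z, ∑ i, (Real.cosh (W (x + n i) - W x) * f (x + n i) ^ 2
      - Real.cosh (W (x + n i) - W x) * f x ^ 2) = 0 := by
    rw [Finset.sum_comm]
    simp only [Finset.sum_sub_distrib]
    rw [h1, sub_self]
  rw [← sub_eq_zero, ← Finset.sum_sub_distrib, ← mul_zero (1 / 2 : ℝ), ← h2, Finset.mul_sum]
  refine Finset.sum_congr rfl fun x _ => ?_
  rw [Finset.sum_mul, ← Finset.sum_sub_distrib, Finset.mul_sum]
  exact Finset.sum_congr rfl fun i _ => by ring

theorem sum_sum_shift_sq {n : ι → G} {ν : Equiv.Perm ι} (hν : ∀ i, n (ν i) = -n i)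
    (f : G → ℝ) {Z : Finset G} (hf : ∀ x, f x ≠ 0 → x ∈ Z ∧ ∀ i, x + n i ∈ Z) :
    ∑ x ∈ Z, ∑ i, f (x + n i) ^ 2 = Fintype.card ι * ∑ x ∈ Z, f x ^ 2 := by
  rw [Finset.sum_comm, ← nsmul_eq_mul, ← Finset.card_univ, ← Finset.sum_const]
  refine Finset.sum_congr rfl fun i _ => ?_
  refine sum_shift_eq (F := fun x => f x ^ 2) fun x hx => ?_
  have h3 : f x ≠ 0 := fun h0 => hx (by simp [h0])
  refine ⟨(hf x h3).1, ?_⟩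
  have := (hf x h3).2 (ν i)
  rwa [hν, ← sub_eq_add_neg] at this

variable {V : Type*} [NormedAddCommGroup V] [InnerProductSpace ℝ V]

/-- A finite symmetric family of steps `n i` in `G` whose positions `p (n i)` in `V` form a tight
frame, with frame constant `2`, of the span of the positions. -/
structure IsSymmetricFrame (p : G →+ V) (n : ι → G) (ν : Equiv.Perm ι) : Prop where
  neg : ∀ i, n (ν i) = -n i
  frame : ∀ x, ∑ i, ⟪p x, p (n i)⟫_ℝ • p (n i) = (2 : ℝ) • p x
  norm_le : ∀ i, ‖p (n i)‖ ≤ 1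

namespace IsSymmetricFrame

variable {p : G →+ V} {n : ι → G} {ν : Equiv.Perm ι}

/-- The frame identity extends to the span, so the analysis coefficients of v have square sum 2‖v‖².
The synthesis bound follows by duality and Cauchy–Schwarz. -/
theorem norm_sum_smul_sq_le (hF : IsSymmetricFrame p n ν) (c : ι → ℝ) :
    ‖∑ i, c i • p (n i)‖ ^ 2 ≤ 2 * ∑ i, c i ^ 2 := by
  set v := ∑ i, c i • p (n i) with hv
  have h1 : ∑ i, ⟪v, p (n i)⟫_ℝ • p (n i) = (2 : ℝ) • v := by
    have : ∀ i, ⟪v, p (n i)⟫_ℝ • p (n i) = ∑ j, c j • (⟪p (n j), p (n i)⟫_ℝ • p (n i)) := fun i => by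
      rw [hv, sum_inner, Finset.sum_smul]
      exact Finset.sum_congr rfl fun j _ => by rw [real_inner_smul_left, mul_smul]
    simp only [this]
    rw [Finset.sum_comm]
    simp only [← Finset.smul_sum, hF.frame]
    rw [hv, Finset.smul_sum]
    exact Finset.sum_congr rfl fun j _ => smul_comm _ _ _
  have h2 : ∑ i, ⟪v, p (n i)⟫_ℝ ^ 2 = 2 * ‖v‖ ^ 2 := by
    have := congrArg (fun w => ⟪v, w⟫_ℝ) h1
    simp only [inner_sum, real_inner_smul_right, real_inner_self_eq_norm_sq] at this
    rw [← this]
    exact Finset.sum_congr rfl fun i _ => sq _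
  have h3 : ‖v‖ ^ 2 = ∑ i, c i * ⟪v, p (n i)⟫_ℝ := by
    rw [← real_inner_self_eq_norm_sq]
    nth_rw 2 [hv]
    rw [inner_sum]
    exact Finset.sum_congr rfl fun i _ => real_inner_smul_right _ _ _
  have h4 := Finset.sum_mul_sq_le_sq_mul_sq Finset.univ c fun i => ⟪v, p (n i)⟫_ℝ
  rw [h2, ← h3] at h4
  by_cases h5 : ‖v‖ ^ 2 = 0
  · rw [h5]; exact mul_nonneg (by norm_num) (Finset.sum_nonneg fun i _ => sq_nonneg _)
  · have h6 : 0 < ‖v‖ ^ 2 := lt_of_le_of_ne (sq_nonneg _) (Ne.symm h5)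
    nlinarith

end IsSymmetricFrame

/-- The weight of the Carleman estimate, as a function of the position. -/
def carlemanWeight (τ : ℝ) (y : V) : ℝ := τ * (‖y‖ ^ 2 - 1) ^ 2

set_option maxHeartbeats 1000000 in
-- The commutator alone controls values but loses gradient energy; the symmetric part tested against
-- f repays more than this loss. The lower bound s ≥ 3/5 keeps 12s - 6 positive, and s ≤ 19/20 keeps
-- away from the critical sphere s = 1 of the weight.
theorem carleman_estimate {p : G →+ V} {n : ι → G} {ν : Equiv.Perm ι}
    (hF : IsSymmetricFrame p n ν) :
    ∃ κ₀ > (0 : ℝ), ∀ h > (0 : ℝ), ∀ τ ≥ (1 : ℝ), τ * h ≤ 1 / 100 → 1 / τ + τ * h ≤ κ₀ →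
      ∀ (Z : Finset G) (f : G → ℝ), (∀ x, f x ≠ 0 → 3 / 5 ≤ ‖h • p x‖ ^ 2 ∧ ‖h • p x‖ ^ 2 ≤ 19 / 20) →
      (∀ x, f x ≠ 0 → x ∈ Z ∧ ∀ i, x + n i ∈ Z) →
      9 / 100 * (τ ^ 3 * h ^ 4 * ∑ x ∈ Z, f x ^ 2
        + τ * h ^ 2 * ∑ x ∈ Z, ∑ i, (f (x + n i) - f x) ^ 2)
      ≤ ∑ x ∈ Z, (∑ i, (Real.exp (carlemanWeight τ (h • p x) - carlemanWeight τ (h • p (x + n i)))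
          * f (x + n i) - f x)) ^ 2 := by
  set N : ℝ := (Fintype.card ι : ℝ) with hN
  have hN0 : 0 ≤ N := Nat.cast_nonneg _
  refine ⟨1 / (10 ^ 11 * (N + 1) ^ 3), by positivity, ?_⟩
  intro h hh τ hτ hτh hκ Z f hfs hfZ
  have hτ0 : 0 < τ := by linarith
  have hh1 : h ≤ 1 / 100 := by nlinarith
  set κ := 1 / τ + τ * h with hκdef
  have hκ0 : 0 < κ := by positivity
  have hκN : 10 ^ 11 * (N + 1) ^ 3 * κ ≤ 1 := by
    rw [le_div_iff₀ (by positivity)] at hκ; linarith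
  set W : G → ℝ := fun x => carlemanWeight τ (h • p x) with hW
  have hadd : ∀ x y, h • p (x + y) = h • p x + h • p y := fun x y => by rw [map_add, smul_add]
  have hm : ∀ i, ‖h • p (n i)‖ ≤ h := fun i => by
    rw [norm_smul, Real.norm_eq_abs, abs_of_pos hh]
    have := mul_le_mul_of_nonneg_left (hF.norm_le i) hh.le
    linarith
  have hy : ∀ x, ∑ i, ⟪h • p x, h • p (n i)⟫_ℝ • (h • p (n i)) = (2 * h ^ 2) • (h • p x) :=
    fun x => by
      have := congrArg (fun v => h ^ 3 • v) (hF.frame x)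
      simp only [Finset.smul_sum, smul_smul] at this
      simp only [real_inner_smul_left, real_inner_smul_right, smul_smul]
      rw [show 2 * h ^ 2 * h = h ^ 3 * 2 by ring, ← this]
      exact Finset.sum_congr rfl fun i _ => by congr 1; ring
  have hsyn : ∀ c : ι → ℝ, ‖∑ i, c i • (h • p (n i))‖ ^ 2 ≤ 2 * h ^ 2 * ∑ i, c i ^ 2 := fun c => by
    have e : ∑ i, c i • (h • p (n i)) = h • ∑ i, c i • p (n i) := by
      rw [Finset.smul_sum]; exact Finset.sum_congr rfl fun i _ => smul_comm _ _ _
    rw [e, norm_smul, mul_pow, Real.norm_eq_abs, sq_abs]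
    have := mul_le_mul_of_nonneg_left (hF.norm_sum_smul_sq_le c) (sq_nonneg h)
    linarith
  have hWd : ∀ x i, W (x + n i) - W x = τ * ((‖h • p x‖ ^ 2 - 1)
      + (2 * ⟪h • p x, h • p (n i)⟫_ℝ + ‖h • p (n i)‖ ^ 2)) ^ 2 - τ * (‖h • p x‖ ^ 2 - 1) ^ 2 :=
    fun x i => by simp only [hW, carlemanWeight, hadd, norm_add_sq_sub_one]
  -- symmetric part
  have hcosh : ∀ x, f x ≠ 0 → ∑ i, (Real.cosh (W (x + n i) - W x) - 1)
      ≤ 16 * τ ^ 2 * h ^ 2 * (‖h • p x‖ ^ 2 - 1) ^ 2 * ‖h • p x‖ ^ 2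
        + N * (10 ^ 8 * (h ^ 2 * τ ^ 2 * κ)) := fun x hx => by
    obtain ⟨s1, s2⟩ := hfs x hx
    have hyn : ‖h • p x‖ ≤ 1 := (sq_le_one_iff₀ (norm_nonneg _)).mp (by linarith)
    have hA : ∀ i, |⟪h • p x, h • p (n i)⟫_ℝ| ≤ h := fun i => by
      refine (abs_real_inner_le_norm _ _).trans ?_
      have := mul_le_mul hyn (hm i) (norm_nonneg _) zero_le_one
      linarith
    have hM : ∀ i, |‖h • p (n i)‖ ^ 2| ≤ h ^ 2 := fun i => by
      rw [abs_of_nonneg (by positivity)]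
      exact pow_le_pow_left₀ (norm_nonneg _) (hm i) 2
    have hσ : |‖h • p x‖ ^ 2 - 1| ≤ 1 := by rw [abs_le]; constructor <;> linarith
    have e1 : ∑ i, ⟪h • p x, h • p (n i)⟫_ℝ ^ 2 = 2 * h ^ 2 * ‖h • p x‖ ^ 2 := by
      have := congrArg (fun v => ⟪h • p x, v⟫_ℝ) (hy x)
      simp only [inner_sum, real_inner_smul_right (h • p x) (h • p x), 
        real_inner_self_eq_norm_sq] at this
      rw [← this]
      exact Finset.sum_congr rfl fun i _ => by rw [real_inner_smul_right _ (h • p (n i)), sq]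
    calc ∑ i, (Real.cosh (W (x + n i) - W x) - 1)
        ≤ ∑ i, (8 * τ ^ 2 * (‖h • p x‖ ^ 2 - 1) ^ 2 * ⟪h • p x, h • p (n i)⟫_ℝ ^ 2
          + 10 ^ 8 * (h ^ 2 * τ ^ 2 * κ)) := by
          refine Finset.sum_le_sum fun i _ => ?_
          rw [hWd]
          exact cosh_weight_diff_sub_one_le hτ hh hτh hσ (hA i) (hM i)
      _ = _ := by
          rw [Finset.sum_add_distrib, ← Finset.mul_sum, e1, Finset.sum_const, Finset.card_univ,
            nsmul_eq_mul, ← hN]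
          ring
  -- commutator part
  have hcomm : ∀ x, 64 * τ ^ 3 * h ^ 4 * (‖h • p x‖ ^ 2 - 1) ^ 2 * ‖h • p x‖ ^ 2
        * (12 * ‖h • p x‖ ^ 2 - 4) * f x ^ 2
      - 18 / 5 * τ * h ^ 2 * ∑ i, (f (x + n i) - f x) ^ 2
      - 2 * 10 ^ 8 * (N + 1) ^ 2 * κ *
        (τ ^ 3 * h ^ 4 * (f x ^ 2 + ∑ i, f (x + n i) ^ 2)
          + τ * h ^ 2 * ∑ i, (f (x + n i) - f x) ^ 2)
      ≤ ∑ i, ∑ j, Real.sinh (W (x + n i + n j) - W (x + n i) - W (x + n j) + W x)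
        * Real.cosh (W (x + n i + n j) - W x) * f (x + n i) * f (x + n j) := fun x => by
    by_cases hx : f x = 0 ∧ ∀ i, f (x + n i) = 0
    · simp [hx.1, hx.2]
    -- The form at x also involves the values at neighbours, so x may lie one step outside the
    -- support of f. The range of s is widened accordingly.
    · have hs : 11 / 20 ≤ ‖h • p x‖ ^ 2 ∧ ‖h • p x‖ ^ 2 ≤ 1 := by
        rw [not_and_or, not_forall] at hx
        rcases hx with hx | ⟨i, hx⟩
        · obtain ⟨s1, s2⟩ := hfs x hx
          constructor <;> linarith
        · obtain ⟨s1, s2⟩ := hfs _ hx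
          have h1 : |‖h • p x‖ - ‖h • p (x + n i)‖| ≤ h := by
            refine (abs_norm_sub_norm_le _ _).trans ?_
            rw [hadd, sub_add_cancel_left, norm_neg]
            exact hm i
          have h2 := abs_le.mp (abs_sq_sub_sq_le (norm_nonneg _) (norm_nonneg _)
            ((sq_le_one_iff₀ (norm_nonneg _)).mp (by linarith)) (by linarith) h1)
          constructor <;> linarith [h2.1, h2.2]
      have := commutator_form_ge (ν := ν) (m := fun i => h • p (n i)) (y := h • p x) hτ hh hτh
        (fun i => by rw [hF.neg, map_neg, smul_neg]) hm hsyn (hy x) hs.1 hs.2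
        (fun i => f (x + n i)) (f x)
      simpa only [hW, carlemanWeight, hadd] using this
  set E := ∑ x ∈ Z, ∑ i, (f (x + n i) - f x) ^ 2 with hE
  set Q := ∑ x ∈ Z, f x ^ 2 with hQ
  have hE0 : 0 ≤ E := Finset.sum_nonneg fun _ _ => Finset.sum_nonneg fun _ _ => sq_nonneg _
  have hQ0 : 0 ≤ Q := Finset.sum_nonneg fun _ _ => sq_nonneg _
  refine le_trans ?_ (sum_conjugated_sq_ge hF.neg W f hfZ)
  have h1 := Finset.sum_le_sum fun x (_ : x ∈ Z) => hcomm x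
  have hshift := sum_sum_shift_sq hF.neg f hfZ
  simp only [Finset.sum_sub_distrib, ← Finset.mul_sum, Finset.sum_add_distrib] at h1
  rw [hshift, ← hE, ← hQ, ← hN] at h1
  set S : G → ℝ := fun x => ∑ i, (Real.cosh (W (x + n i) - W x) * f (x + n i) - f x) with hS
  -- From (S + 4τh²f)² ≥ 0. The multiplier makes the gradient gain 4τh²E, which exceeds the loss
  -- (18/5)τh²E.
  have h2 : ∑ x ∈ Z, S x ^ 2 ≥ -(8 * τ * h ^ 2 * ∑ x ∈ Z, S x * f x) - 16 * τ ^ 2 * h ^ 4 * Q := by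
    rw [hQ, Finset.mul_sum, Finset.mul_sum, ← Finset.sum_neg_distrib, ← Finset.sum_sub_distrib]
    refine Finset.sum_le_sum fun x _ => ?_
    linarith [sq_nonneg (S x + 4 * τ * h ^ 2 * f x)]
  have h3 : ∑ x ∈ Z, S x * f x ≤ ∑ x ∈ Z, (16 * τ ^ 2 * h ^ 2 * (‖h • p x‖ ^ 2 - 1) ^ 2
      * ‖h • p x‖ ^ 2) * f x ^ 2 + N * (10 ^ 8 * (h ^ 2 * τ ^ 2 * κ)) * Q - E / 2 := by
    rw [hS, sum_symmetric_mul_self hF.neg W f hfZ, hE, hQ, Finset.mul_sum, Finset.sum_div,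
      ← Finset.sum_add_distrib, ← Finset.sum_sub_distrib]
    refine Finset.sum_le_sum fun x _ => ?_
    rw [Finset.sum_sub_distrib, ← Finset.sum_mul]
    have a1 : (∑ i, (Real.cosh (W (x + n i) - W x) - 1)) * f x ^ 2
        ≤ (16 * τ ^ 2 * h ^ 2 * (‖h • p x‖ ^ 2 - 1) ^ 2 * ‖h • p x‖ ^ 2
        + N * (10 ^ 8 * (h ^ 2 * τ ^ 2 * κ))) * f x ^ 2 := by
      by_cases hx : f x = 0
      · simp [hx]
      · exact mul_le_mul_of_nonneg_right (hcosh x hx) (sq_nonneg _)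
    have a2 : (∑ i, (f (x + n i) - f x) ^ 2) / 2
        ≤ ∑ i, Real.cosh (W (x + n i) - W x) * (f (x + n i) - f x) ^ 2 / 2 := by
      rw [Finset.sum_div]
      refine Finset.sum_le_sum fun i _ => ?_
      have := mul_le_mul_of_nonneg_right (Real.one_le_cosh (W (x + n i) - W x))
        (sq_nonneg (f (x + n i) - f x))
      linarith
    linarith
  -- The difference has coefficient 64(s-1)²s(12s-6), and 64 · (1/400) · (3/5) · (6/5) = 72/625.
  have h4 : 72 / 625 * τ ^ 3 * h ^ 4 * Q ≤ ∑ x ∈ Z, 64 * τ ^ 3 * h ^ 4 * (‖h • p x‖ ^ 2 - 1) ^ 2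
        * ‖h • p x‖ ^ 2 * (12 * ‖h • p x‖ ^ 2 - 4) * f x ^ 2 
      - 8 * τ * h ^ 2 * ∑ x ∈ Z, (16 * τ ^ 2 * h ^ 2 * (‖h • p x‖ ^ 2 - 1) ^ 2
      * ‖h • p x‖ ^ 2) * f x ^ 2 := by
    rw [hQ, Finset.mul_sum, Finset.mul_sum, ← Finset.sum_sub_distrib]
    refine Finset.sum_le_sum fun x _ => ?_
    by_cases hx : f x = 0
    · simp [hx]
    obtain ⟨s1, s2⟩ := hfs x hx
    set s := ‖h • p x‖ ^ 2
    have b1 : 1 / 400 ≤ (s - 1) ^ 2 := by nlinarith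
    have b2 : 1 / 400 * (3 / 5 * (6 / 5)) ≤ (s - 1) ^ 2 * (s * (12 * s - 6)) := by
      apply mul_le_mul b1 (by nlinarith) (by norm_num) (sq_nonneg _)
    have b3 : 0 ≤ τ ^ 3 * h ^ 4 * f x ^ 2 := by positivity
    have b4 := mul_le_mul_of_nonneg_left b2 b3
    linarith
  have h5 : 8 * τ * h ^ 2 * (∑ x ∈ Z, S x * f x) ≤ 8 * τ * h ^ 2 * (∑ x ∈ Z, (16 * τ ^ 2 * h ^ 2 *
      (‖h • p x‖ ^ 2 - 1) ^ 2 * ‖h • p x‖ ^ 2) * f x ^ 2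
      + N * (10 ^ 8 * (h ^ 2 * τ ^ 2 * κ)) * Q - E / 2) :=
    mul_le_mul_of_nonneg_left h3 (by positivity)
  have h6 : 16 * τ ^ 2 * h ^ 4 * Q ≤ 16 * κ * (τ ^ 3 * h ^ 4 * Q) := by
    have c1 : 1 ≤ κ * τ := by
      rw [hκdef, add_mul, one_div, inv_mul_cancel₀ hτ0.ne']
      have : 0 ≤ τ * h * τ := by positivity
      linarith
    have c2 : 0 ≤ τ ^ 2 * h ^ 4 * Q := by positivity
    nlinarith
  -- Here 63/2500 = 72/625 - 9/100 is the room left in the zeroth order term. For the gradient, 4 -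
  -- 18/5 - 3/10 = 1/10 still exceeds 9/100.
  have c3 : κ * (16 + 8 * 10 ^ 8 * N + 2 * 10 ^ 8 * (N + 1) ^ 3) ≤ 63 / 2500 := by
    have : 16 + 8 * 10 ^ 8 * N + 2 * 10 ^ 8 * (N + 1) ^ 3 ≤ 63 / 2500 * (10 ^ 11 * (N + 1) ^ 3) := by
      have : 0 ≤ N ^ 2 := by positivity
      have : 0 ≤ N ^ 3 := by positivity
      linarith
    calc _ ≤ κ * (63 / 2500 * (10 ^ 11 * (N + 1) ^ 3)) := by gcongr
      _ ≤ _ := by linarith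
  have c4 : κ * (2 * 10 ^ 8 * (N + 1) ^ 2) ≤ 3 / 10 := by
    have : 2 * 10 ^ 8 * (N + 1) ^ 2 ≤ 3 / 10 * (10 ^ 11 * (N + 1) ^ 3) := by
      have : 0 ≤ N ^ 2 := by positivity
      have : 0 ≤ N ^ 3 := by positivity
      linarith
    calc _ ≤ κ * (3 / 10 * (10 ^ 11 * (N + 1) ^ 3)) := by gcongr
      _ ≤ _ := by linarith
  have c5 := mul_le_mul_of_nonneg_right c3 (show 0 ≤ τ ^ 3 * h ^ 4 * Q by positivity)
  have c6 := mul_le_mul_of_nonneg_right c4 (show 0 ≤ τ * h ^ 2 * E by positivity)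
  generalize ∑ x ∈ Z, 64 * τ ^ 3 * h ^ 4 * (‖h • p x‖ ^ 2 - 1) ^ 2
        * ‖h • p x‖ ^ 2 * (12 * ‖h • p x‖ ^ 2 - 4) * f x ^ 2 = Q1 at *
  generalize ∑ x ∈ Z, (16 * τ ^ 2 * h ^ 2 * (‖h • p x‖ ^ 2 - 1) ^ 2
      * ‖h • p x‖ ^ 2) * f x ^ 2 = Q2 at *
  change _ ≤ ∑ x ∈ Z, S x ^ 2 + _
  clear_value E Q κ N
  clear hcomm hcosh hWd hS
  have c7 : 0 ≤ τ * h ^ 2 * E := by positivity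
  linarith
end Carleman

/-! ### Radial cut-offs and the Caccioppoli inequality. -/

section Caccioppoli

open scoped InnerProductSpace

theorem exists_taylor_bound {F : ℝ → ℝ} (hF : ContDiff ℝ 2 F) (hc : HasCompactSupport F) :
    ∃ K > (0 : ℝ), (∀ s, |F s| ≤ K) ∧ (∀ s, |deriv F s| ≤ K) ∧ (∀ s t, |F (s + t) - F s| ≤ K * |t|) ∧
      ∀ s t, |F (s + t) - F s - deriv F s * t| ≤ K * t ^ 2 := by
  obtain ⟨C₀, hC₀⟩ := hF.continuous.bounded_above_of_compact_support hc
  obtain ⟨C₁, hC₁⟩ := ContDiff.lipschitzWith_of_hasCompactSupport hc hF (by norm_num)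
  have hF' : ContDiff ℝ 1 (deriv F) := hF.deriv' 
  obtain ⟨C₂, hC₂⟩ := ContDiff.lipschitzWith_of_hasCompactSupport hc.deriv hF' (by norm_num)
  have hC₀' : 0 ≤ C₀ := (norm_nonneg _).trans (hC₀ 0)
  have hd : Differentiable ℝ F := hF.differentiable (by norm_num)
  refine ⟨C₀ + C₁ + C₂ + 1, by positivity, fun s => ?_, fun s => ?_, fun s t => ?_, fun s t => ?_⟩
  · have := hC₀ s
    rw [Real.norm_eq_abs] at this
    linarith [C₁.coe_nonneg, C₂.coe_nonneg]
  · have := norm_deriv_le_of_lipschitz hC₁ (x₀ := s)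
    rw [Real.norm_eq_abs] at this
    linarith [C₁.coe_nonneg, C₂.coe_nonneg]
  · have := hC₁.dist_le_mul (s + t) s
    rw [Real.dist_eq, Real.dist_eq, add_sub_cancel_left] at this
    refine this.trans ?_
    gcongr
    linarith [C₂.coe_nonneg]
  · have h1 : ∀ r ∈ Set.uIcc 0 t, HasDerivWithinAt (fun r => F (s + r) - deriv F s * r)
        (deriv F (s + r) - deriv F s) (Set.uIcc 0 t) r := fun r _ => by
      have a := ((hd (s + r)).hasDerivAt.comp_const_add s r)
      have b := (hasDerivAt_id r).const_mul (deriv F s)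
      simpa using (a.fun_sub b).hasDerivWithinAt
    have h2 : ∀ r ∈ Set.uIcc 0 t, ‖deriv F (s + r) - deriv F s‖ ≤ C₂ * |t| := fun r hr => by
      have := hC₂.dist_le_mul (s + r) s
      rw [Real.dist_eq, Real.dist_eq, add_sub_cancel_left] at this
      rw [Real.norm_eq_abs]
      refine this.trans (mul_le_mul_of_nonneg_left ?_ C₂.coe_nonneg)
      simpa using Set.abs_sub_left_of_mem_uIcc hr
    have h3 := (convex_uIcc 0 t).norm_image_sub_le_of_norm_hasDerivWithin_le h1 h2
      Set.left_mem_uIcc Set.right_mem_uIcc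
    simp only [Real.norm_eq_abs, add_zero, mul_zero, sub_zero] at h3
    rw [mul_assoc, abs_mul_abs_self, ← sq] at h3
    rw [show F (s + t) - F s - deriv F s * t = F (s + t) - deriv F s * t - F s by ring]
    refine h3.trans ?_
    gcongr
    linarith [C₁.coe_nonneg]

variable {G : Type*} [AddCommGroup G] {ι : Type*} [Fintype ι]
  {V : Type*} [NormedAddCommGroup V] [InnerProductSpace ℝ V]
  {p : G →+ V} {n : ι → G} {ν : Equiv.Perm ι}

/-- The first order Taylor terms are odd in the step and cancel in the sum over all steps, so the
Laplacian of a radial cut-off is O(h²), although each difference is only O(h). -/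
theorem exists_cutoff_bound (hF : IsSymmetricFrame p n ν) {F : ℝ → ℝ} (hF2 : ContDiff ℝ 2 F)
    (hc : HasCompactSupport F) :
    ∃ K > (0 : ℝ), (∀ s, |F s| ≤ K) ∧ ∀ h > (0 : ℝ), h ≤ 1 → ∀ x, ‖h • p x‖ ≤ 2 →
      (∀ i, |F (‖h • p (x + n i)‖ ^ 2) - F (‖h • p x‖ ^ 2)| ≤ K * h) ∧
      |∑ i, (F (‖h • p (x + n i)‖ ^ 2) - F (‖h • p x‖ ^ 2))| ≤ K * h ^ 2 := by
  obtain ⟨K, hK, h0, h1, h2, h3⟩ := exists_taylor_bound hF2 hc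
  refine ⟨K * (26 * Fintype.card ι + 6), by positivity, fun s => (h0 s).trans ?_, ?_⟩
  · have : 0 ≤ K * (26 * (Fintype.card ι : ℝ) + 5) := by positivity
    linarith
  intro h hh hh1 x hx
  have hm : ∀ i, ‖h • p (n i)‖ ≤ h := fun i => by
    rw [norm_smul, Real.norm_eq_abs, abs_of_pos hh]
    have := mul_le_mul_of_nonneg_left (hF.norm_le i) hh.le
    linarith
  set A : ι → ℝ := fun i => ⟪h • p x, h • p (n i)⟫_ℝ with hAdef
  have hA : ∀ i, |A i| ≤ 2 * h := fun i =>
    (abs_real_inner_le_norm _ _).trans (mul_le_mul hx (hm i) (norm_nonneg _) zero_le_two)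
  have hM : ∀ i, ‖h • p (n i)‖ ^ 2 ≤ h ^ 2 := fun i =>
    pow_le_pow_left₀ (norm_nonneg _) (hm i) 2
  have hh2 : h ^ 2 ≤ h := by nlinarith
  have hs : ∀ i, ‖h • p (x + n i)‖ ^ 2 = ‖h • p x‖ ^ 2 + (2 * A i + ‖h • p (n i)‖ ^ 2) := fun i => by
    rw [map_add, smul_add, norm_add_sq_real]; ring
  have ht : ∀ i, |2 * A i + ‖h • p (n i)‖ ^ 2| ≤ 5 * h := fun i => by
    have a := abs_le.mp (hA i)
    have b := hM i
    have c := sq_nonneg ‖h • p (n i)‖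
    rw [abs_le]; constructor <;> linarith
  have hN : (0 : ℝ) ≤ Fintype.card ι := Nat.cast_nonneg _
  constructor
  · intro i
    rw [hs]
    refine (h2 _ _).trans ?_
    calc K * |2 * A i + ‖h • p (n i)‖ ^ 2| ≤ K * (5 * h) := by gcongr; exact ht i
      _ ≤ K * (5 * h) + K * (26 * Fintype.card ι + 1) * h := by
        have : 0 ≤ K * (26 * (Fintype.card ι : ℝ) + 1) * h := by positivity
        linarith
      _ = _ := by ring
  · have hodd : ∑ i, A i = 0 := sum_eq_zero_of_odd ν fun i => by
      simp [hAdef, hF.neg]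
    have e : ∑ i, (F (‖h • p (x + n i)‖ ^ 2) - F (‖h • p x‖ ^ 2)) = ∑ i, (F (‖h • p (x + n i)‖ ^ 2)
        - F (‖h • p x‖ ^ 2) - deriv F (‖h • p x‖ ^ 2) * (2 * A i + ‖h • p (n i)‖ ^ 2)
        + deriv F (‖h • p x‖ ^ 2) * ‖h • p (n i)‖ ^ 2) := by
      rw [← sub_eq_zero, ← Finset.sum_sub_distrib, ← mul_zero (2 * deriv F (‖h • p x‖ ^ 2)),
        ← hodd, Finset.mul_sum]
      exact Finset.sum_congr rfl fun i _ => by ring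
    rw [e]
    calc _ ≤ ∑ i : ι, (K * (5 * h) ^ 2 + K * h ^ 2) := by
          refine (Finset.abs_sum_le_sum_abs _ _).trans (Finset.sum_le_sum fun i _ => ?_)
          refine (abs_add_le _ _).trans (add_le_add ?_ ?_)
          · rw [hs]
            refine (h3 _ _).trans ?_
            rw [← sq_abs (2 * A i + _)]
            gcongr
            exact ht i
          · rw [abs_mul, abs_of_nonneg (sq_nonneg ‖h • p (n i)‖)]
            gcongr
            · exact h1 _
            · exact hm i
      _ = K * (26 * Fintype.card ι) * h ^ 2 := by
          rw [Finset.sum_const, Finset.card_univ, nsmul_eq_mul]; ring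
      _ ≤ _ := by gcongr; linarith

/-- The differential inequality satisfied by the solutions of a Schrödinger equation with bounded
coefficients, in the unit ball. -/
def SchrodingerBound (p : G →+ V) (n : ι → G) (P : Finset G) (M h : ℝ) (u : G → ℝ) : Prop :=
  ∀ x, ‖h • p x‖ ^ 2 ≤ 1 → |∑ i, (u (x + n i) - u x)|
    ≤ M * (h * ∑ i, |u (x + n i) - u x| + h ^ 2 * ∑ v ∈ P, |u (x + v)|)

theorem sum_shift_sq_le {ζ u : G → ℝ} {T : Finset G} {v : G} {B : ℝ}
    (hζ : ∀ x, ζ x ≤ B) (hT : ∀ x, ζ x ≠ 0 → x ∈ T ∧ x + v ∈ T) :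
    ∑ x ∈ T, ζ x * u (x + v) ^ 2 ≤ B * ∑ x ∈ T, u x ^ 2 := by
  have h := sum_shift_eq (Z := T) (v := v) (F := fun x => ζ (x - v) * u x ^ 2) fun x hx => by
    have h3 : ζ (x - v) ≠ 0 := fun h0 => hx (by simp [h0])
    have := hT _ h3
    rw [sub_add_cancel] at this
    exact this.symm
  simp only [add_sub_cancel_right] at h
  rw [h, Finset.mul_sum]
  exact Finset.sum_le_sum fun x _ => mul_le_mul_of_nonneg_right (hζ _) (sq_nonneg _)

/-- Summation by parts puts both differences on the cut-off ζ, giving Σ ζ|∇u|² = Σ (Δζ)u² - 2 Σ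
ζuΔu. The equation bounds Δu, and half of the gradient term is absorbed on the left. -/
theorem caccioppoli (hF : IsSymmetricFrame p n ν) {F : ℝ → ℝ} (hF2 : ContDiff ℝ 2 F)
    (hc : HasCompactSupport F) (hF0 : ∀ s, 0 ≤ F s) (P : Finset G) {M : ℝ} (hM : 0 ≤ M) :
    ∃ K > (0 : ℝ), ∀ h > (0 : ℝ), h ≤ 1 → ∀ (u : G → ℝ) (T : Finset G),
      SchrodingerBound p n P M h u → (∀ x ∈ T, ‖h • p x‖ ≤ 2) →
      (∀ x, F (‖h • p x‖ ^ 2) ≠ 0 →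
        ‖h • p x‖ ^ 2 ≤ 1 ∧ x ∈ T ∧ (∀ i, x + n i ∈ T) ∧ ∀ v ∈ P, x + v ∈ T) →
      ∑ x ∈ T, F (‖h • p x‖ ^ 2) * ∑ i, (u (x + n i) - u x) ^ 2
        ≤ K * h ^ 2 * ∑ x ∈ T, u x ^ 2 := by
  obtain ⟨K, hK, hFK, hK1⟩ := exists_cutoff_bound hF hF2 hc
  set N : ℝ := (Fintype.card ι : ℝ) with hN
  set N' : ℝ := (P.card : ℝ) with hN'
  have hN0 : 0 ≤ N := Nat.cast_nonneg _
  have hN'0 : 0 ≤ N' := Nat.cast_nonneg _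
  refine ⟨2 * (K + K * (2 * M ^ 2 * N + 2 * M * N')), by positivity, ?_⟩
  intro h hh hh1 u T hu hT2 hT
  set ζ : G → ℝ := fun x => F (‖h • p x‖ ^ 2) with hζ
  have hζ0 : ∀ x, 0 ≤ ζ x := fun x => hF0 _
  have hζK : ∀ x, ζ x ≤ K := fun x => (le_abs_self _).trans (hFK _)
  have hneg : ∀ (x : G) i, x + n (ν i) = x - n i := fun x i => by rw [hF.neg]; abel
  set E := ∑ x ∈ T, ζ x * ∑ i, (u (x + n i) - u x) ^ 2 with hE
  set U := ∑ x ∈ T, u x ^ 2 with hU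
  have hU0 : 0 ≤ U := Finset.sum_nonneg fun _ _ => sq_nonneg _
  have h1 : E = ∑ x ∈ T, (∑ i, (ζ (x + n i) - ζ x)) * u x ^ 2
      - 2 * ∑ x ∈ T, ζ x * u x * ∑ i, (u (x + n i) - u x) := by
    have e1 : ∑ x ∈ T, ∑ i, ζ x * u (x + n i) ^ 2 = ∑ x ∈ T, ∑ i, ζ (x + n i) * u x ^ 2 := by
      rw [Finset.sum_comm, Finset.sum_comm (f := fun x i => ζ (x + n i) * u x ^ 2),
        ← Equiv.sum_comp ν fun i => ∑ x ∈ T, ζ (x + n i) * u x ^ 2]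
      refine Finset.sum_congr rfl fun i _ => ?_
      rw [← sum_shift_eq (Z := T) (v := n i) (F := fun x => ζ (x + n (ν i)) * u x ^ 2)
        fun x hx => by
          have h3 : ζ (x + n (ν i)) ≠ 0 := fun h0 => hx (by simp [h0])
          have h4 := (hT _ h3).2
          rw [hneg] at h4
          refine ⟨?_, h4.1⟩
          have := h4.2.1 i
          rwa [sub_add_cancel] at this]
      refine Finset.sum_congr rfl fun x _ => ?_
      simp only [hneg, add_sub_cancel_right]
    have e2 : ∑ x ∈ T, (∑ i, (ζ (x + n i) - ζ x)) * u x ^ 2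
        = ∑ x ∈ T, ∑ i, ζ (x + n i) * u x ^ 2 - ∑ x ∈ T, ∑ _i : ι, ζ x * u x ^ 2 := by
      rw [← Finset.sum_sub_distrib]
      refine Finset.sum_congr rfl fun x _ => ?_
      rw [Finset.sum_mul, ← Finset.sum_sub_distrib]
      exact Finset.sum_congr rfl fun i _ => by ring
    rw [e2, ← e1, hE, ← Finset.sum_sub_distrib, Finset.mul_sum, ← Finset.sum_sub_distrib]
    refine Finset.sum_congr rfl fun x _ => ?_
    rw [Finset.mul_sum, Finset.mul_sum, Finset.mul_sum, ← Finset.sum_sub_distrib,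
      ← Finset.sum_sub_distrib]
    exact Finset.sum_congr rfl fun i _ => by ring
  have h2 : ∑ x ∈ T, (∑ i, (ζ (x + n i) - ζ x)) * u x ^ 2 ≤ K * h ^ 2 * U := by
    rw [hU, Finset.mul_sum]
    refine Finset.sum_le_sum fun x hx => mul_le_mul_of_nonneg_right ?_ (sq_nonneg _)
    exact (le_abs_self _).trans (hK1 h hh hh1 x (hT2 x hx)).2
  have h3 : ∀ x, -(2 * (ζ x * u x * ∑ i, (u (x + n i) - u x)))
      ≤ ζ x * (∑ i, (u (x + n i) - u x) ^ 2) / 2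
        + (2 * M ^ 2 * N + M * N') * h ^ 2 * (ζ x * u x ^ 2)
        + M * h ^ 2 * ∑ v ∈ P, ζ x * u (x + v) ^ 2 := fun x => by
    by_cases hx : ζ x = 0
    · simp [hx]
    have a1 := hu x (hT x hx).1
    have a2 : -(2 * (u x * ∑ i, (u (x + n i) - u x)))
        ≤ 2 * |u x| * (M * (h * ∑ i, |u (x + n i) - u x| + h ^ 2 * ∑ v ∈ P, |u (x + v)|)) := by
      calc _ ≤ |2 * (u x * ∑ i, (u (x + n i) - u x))| := neg_le_abs _
        _ = 2 * |u x| * |∑ i, (u (x + n i) - u x)| := by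
          rw [abs_mul, abs_mul, abs_two, mul_assoc]
        _ ≤ _ := by gcongr
    have a3 : 2 * |u x| * M * h * ∑ i, |u (x + n i) - u x|
        ≤ (∑ i, (u (x + n i) - u x) ^ 2) / 2 + 2 * M ^ 2 * N * h ^ 2 * u x ^ 2 := by
      have : 2 * M ^ 2 * N * h ^ 2 * u x ^ 2 = ∑ i : ι, 2 * M ^ 2 * h ^ 2 * u x ^ 2 := by
        rw [Finset.sum_const, Finset.card_univ, nsmul_eq_mul]; ring
      rw [this, Finset.mul_sum, Finset.sum_div, ← Finset.sum_add_distrib]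
      refine Finset.sum_le_sum fun i _ => ?_
      have b := sq_nonneg (|u (x + n i) - u x| - 2 * M * h * |u x|)
      have b1 := sq_abs (u (x + n i) - u x)
      have b2 := sq_abs (u x)
      have e : (|u (x + n i) - u x| - 2 * M * h * |u x|) ^ 2 = |u (x + n i) - u x| ^ 2
        - 4 * M * h * |u x| * |u (x + n i) - u x| + 4 * M ^ 2 * h ^ 2 * |u x| ^ 2 := by ring
      rw [e, b1, b2] at b
      linarith
    have a4 : 2 * |u x| * M * h ^ 2 * ∑ v ∈ P, |u (x + v)|
        ≤ M * N' * h ^ 2 * u x ^ 2 + M * h ^ 2 * ∑ v ∈ P, u (x + v) ^ 2 := by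
      have : M * N' * h ^ 2 * u x ^ 2 = ∑ v ∈ P, M * h ^ 2 * u x ^ 2 := by
        rw [Finset.sum_const, nsmul_eq_mul]; ring
      rw [this, Finset.mul_sum, Finset.mul_sum, ← Finset.sum_add_distrib]
      refine Finset.sum_le_sum fun v _ => ?_
      have b := mul_nonneg (show 0 ≤ M * h ^ 2 by positivity) (sq_nonneg (|u x| - |u (x + v)|))
      have e : M * h ^ 2 * (|u x| - |u (x + v)|) ^ 2 = M * h ^ 2 * |u x| ^ 2
        - 2 * |u x| * M * h ^ 2 * |u (x + v)| + M * h ^ 2 * |u (x + v)| ^ 2 := by ring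
      rw [e, sq_abs, sq_abs] at b
      linarith
    have a5 := mul_le_mul_of_nonneg_left (a2.trans (show _ ≤
      ((∑ i, (u (x + n i) - u x) ^ 2) / 2 + 2 * M ^ 2 * N * h ^ 2 * u x ^ 2)
      + (M * N' * h ^ 2 * u x ^ 2 + M * h ^ 2 * ∑ v ∈ P, u (x + v) ^ 2) by linarith)) (hζ0 x)
    rw [← Finset.mul_sum]
    linarith
  have h4 := Finset.sum_le_sum fun x (_ : x ∈ T) => h3 x
  rw [Finset.sum_neg_distrib, ← Finset.mul_sum, Finset.sum_add_distrib, Finset.sum_add_distrib,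
    ← Finset.sum_div, ← hE, ← Finset.mul_sum, ← Finset.mul_sum, Finset.sum_comm (s := T)] at h4
  have h5 : ∑ x ∈ T, ζ x * u x ^ 2 ≤ K * U := by
    rw [hU, Finset.mul_sum]
    exact Finset.sum_le_sum fun x _ => mul_le_mul_of_nonneg_right (hζK x) (sq_nonneg _)
  have h6 : ∑ v ∈ P, ∑ x ∈ T, ζ x * u (x + v) ^ 2 ≤ N' * (K * U) := by
    rw [hN', ← nsmul_eq_mul, ← Finset.sum_const]
    exact Finset.sum_le_sum fun v hv => sum_shift_sq_le hζK fun x hx =>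
      ⟨(hT x hx).2.1, (hT x hx).2.2.2 v hv⟩
  have h7 := mul_le_mul_of_nonneg_left h5
    (show 0 ≤ (2 * M ^ 2 * N + M * N') * h ^ 2 by positivity)
  have h8 := mul_le_mul_of_nonneg_left h6 (show 0 ≤ M * h ^ 2 by positivity)
  linarith
end Caccioppoli

/-! ### The Carleman estimate for cut-offs of solutions. -/

section Step

variable {G : Type*} [AddCommGroup G] {ι : Type*} [Fintype ι]
  {V : Type*} [NormedAddCommGroup V] [InnerProductSpace ℝ V]
  {p : G →+ V} {n : ι → G} {ν : Equiv.Perm ι}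

theorem abs_norm_smul_add_sub_le (p : G →+ V) {h R : ℝ} (hh : 0 < h) {v : G} (hv : ‖p v‖ ≤ R)
    (x : G) : |‖h • p (x + v)‖ - ‖h • p x‖| ≤ h * R := by
  refine (abs_norm_sub_norm_le _ _).trans ?_
  rw [map_add, smul_add, add_sub_cancel_left, norm_smul, Real.norm_eq_abs, abs_of_pos hh]
  gcongr

theorem abs_sq_norm_smul_add_sub_le (p : G →+ V) {h R : ℝ} (hh : 0 < h) (hR : h * R ≤ 1) {v : G}
    (hv : ‖p v‖ ≤ R) {x : G} (hx : ‖h • p x‖ ^ 2 ≤ 1) :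
    |‖h • p (x + v)‖ ^ 2 - ‖h • p x‖ ^ 2| ≤ 3 * (h * R) :=
  abs_sq_sub_sq_le (norm_nonneg _) (norm_nonneg _) ((sq_le_one_iff₀ (norm_nonneg _)).mp hx) hR
    (abs_norm_smul_add_sub_le p hh hv x)

theorem abs_carlemanWeight_sub_le (p : G →+ V) {τ h R : ℝ} (hτ : 0 ≤ τ) (hh : 0 < h)
    (hR : 3 * (h * R) ≤ 1) {v : G} (hv : ‖p v‖ ≤ R) {x : G} (hx : ‖h • p x‖ ^ 2 ≤ 1) :
    |carlemanWeight τ (h • p (x + v)) - carlemanWeight τ (h • p x)| ≤ 6 * (τ * (h * R)) := by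
  have h0 : 0 ≤ h * R := mul_nonneg hh.le ((norm_nonneg _).trans hv)
  have h1 := abs_sq_norm_smul_add_sub_le p hh (by linarith) hv hx
  have h2 : |‖h • p (x + v)‖ ^ 2 + ‖h • p x‖ ^ 2 - 2| ≤ 2 := by
    have := abs_le.mp h1
    rw [abs_le]
    constructor <;> linarith [sq_nonneg ‖h • p x‖, sq_nonneg ‖h • p (x + v)‖]
  have e : carlemanWeight τ (h • p (x + v)) - carlemanWeight τ (h • p x)
      = τ * ((‖h • p (x + v)‖ ^ 2 - ‖h • p x‖ ^ 2)
        * (‖h • p (x + v)‖ ^ 2 + ‖h • p x‖ ^ 2 - 2)) := by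
    simp only [carlemanWeight]; ring
  rw [e, abs_mul, abs_mul, abs_of_nonneg hτ]
  calc τ * (|‖h • p (x + v)‖ ^ 2 - ‖h • p x‖ ^ 2| * |‖h • p (x + v)‖ ^ 2 + ‖h • p x‖ ^ 2 - 2|)
      ≤ τ * (3 * (h * R) * 2) := by gcongr
    _ = _ := by ring

theorem sq_sum_abs_le {α : Type*} (s : Finset α) (g : α → ℝ) :
    (∑ i ∈ s, |g i|) ^ 2 ≤ s.card * ∑ i ∈ s, g i ^ 2 := by
  have := sq_sum_le_card_mul_sum_sq (s := s) (f := fun i => |g i|)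
  simpa [sq_abs] using this

theorem add_add_sq_le (a b c : ℝ) : (a + b + c) ^ 2 ≤ 3 * (a ^ 2 + b ^ 2 + c ^ 2) := by
  linarith [sq_nonneg (a - b), sq_nonneg (b - c), sq_nonneg (a - c)]

/-- Removes the differences and shifts from the error terms of the cut-off, at the cost of a
slightly thicker shell: one width ρ lets the Caccioppoli cut-off decay, the other accommodates the
shifts by steps and path vectors. -/
theorem shell_bound (hF : IsSymmetricFrame p n ν) (P : Finset G) {R M : ℝ} (hR : 1 ≤ R)
    (hP : ∀ v ∈ P, ‖p v‖ ≤ R) (hM : 0 ≤ M) {c r ρ : ℝ} (hr : 0 < r) (hρ : 0 < ρ)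
    (hcr : c + r + 2 * ρ ≤ 1) :
    ∃ K > (0 : ℝ), ∀ h > (0 : ℝ), h * R ≤ 1 → 3 * (h * R) ≤ ρ → ∀ (u : G → ℝ) (Z : Finset G),
      (∀ x, x ∈ Z ↔ ‖h • p x‖ ^ 2 ≤ 1) → SchrodingerBound p n P M h u →
      ∑ x ∈ Z with |‖h • p x‖ ^ 2 - c| ≤ r,
        (h * ∑ i, |u (x + n i) - u x| + h ^ 2 * |u x| + h ^ 2 * ∑ v ∈ P, |u (x + v)|) ^ 2
      ≤ K * h ^ 4 * ∑ x ∈ Z with |‖h • p x‖ ^ 2 - c| ≤ r + 2 * ρ, u x ^ 2 := by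
  let b : ContDiffBump c := ⟨r, r + ρ, hr, by linarith⟩
  obtain ⟨K, hK, hcac⟩ := caccioppoli hF b.contDiff b.hasCompactSupport (fun _ => b.nonneg) P hM
  set N : ℝ := (Fintype.card ι : ℝ) with hN
  set N' : ℝ := (P.card : ℝ) with hN'
  have hN0 : 0 ≤ N := Nat.cast_nonneg _
  have hN'0 : 0 ≤ N' := Nat.cast_nonneg _
  refine ⟨3 * (N * K + 1 + N' * N'), by positivity, ?_⟩
  intro h hh hhR hhρ u Z hZ hu
  have hh1 : h ≤ 1 := by nlinarith
  set T := Z.filter fun x => |‖h • p x‖ ^ 2 - c| ≤ r + 2 * ρ with hT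
  set A := Z.filter fun x => |‖h • p x‖ ^ 2 - c| ≤ r with hA
  have hnR : ∀ i, ‖p (n i)‖ ≤ R := fun i => (hF.norm_le i).trans hR
  have hshift : ∀ x v, |‖h • p x‖ ^ 2 - c| < r + ρ → ‖p v‖ ≤ R → x + v ∈ T := fun x v hx hv => by
    have hx' := abs_lt.mp hx
    have h1 := abs_le.mp
      (abs_sq_norm_smul_add_sub_le p hh hhR hv (x := x) (by linarith [hx'.2]))
    rw [hT, Finset.mem_filter, hZ, abs_le]
    refine ⟨?_, ?_, ?_⟩ <;> linarith [h1.1, h1.2, hx'.1, hx'.2]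
  have hself : ∀ x, |‖h • p x‖ ^ 2 - c| < r + ρ → x ∈ T := fun x hx => by
    have := hshift x 0 hx (by rw [map_zero, norm_zero]; linarith)
    rwa [add_zero] at this
  have hAr : ∀ x ∈ A, |‖h • p x‖ ^ 2 - c| < r + ρ := fun x hx =>
    (Finset.mem_filter.mp hx).2.trans_lt (by linarith)
  set U := ∑ x ∈ T, u x ^ 2 with hU
  have h1 : ∑ x ∈ A, ∑ i, (u (x + n i) - u x) ^ 2 ≤ K * h ^ 2 * U := by
    refine le_trans ?_ (hcac h hh hh1 u T hu (fun x hx => ?_) fun x hx => ?_)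
    · have hsub : A ⊆ T := fun x hx => hself x (hAr x hx)
      refine le_trans ?_ (Finset.sum_le_sum_of_subset_of_nonneg hsub fun x _ _ =>
        mul_nonneg b.nonneg (Finset.sum_nonneg fun i _ => sq_nonneg _))
      refine Finset.sum_le_sum fun x hx => ?_
      rw [b.one_of_mem_closedBall, one_mul]
      rw [Metric.mem_closedBall, Real.dist_eq]
      exact (Finset.mem_filter.mp hx).2
    · have := (hZ x).mp (Finset.mem_filter.mp hx).1
      linarith [(sq_le_one_iff₀ (norm_nonneg _)).mp this]
    · have h3 : |‖h • p x‖ ^ 2 - c| < r + ρ := by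
        have : ‖h • p x‖ ^ 2 ∈ Function.support b := hx
        rwa [b.support_eq, Metric.mem_ball, Real.dist_eq] at this
      exact ⟨by linarith [(abs_lt.mp h3).2], hself x h3, fun i => hshift x _ h3 (hnR i),
        fun v hv => hshift x v h3 (hP v hv)⟩
  have h2 : ∀ v, ‖p v‖ ≤ R → ∑ x ∈ A, u (x + v) ^ 2 ≤ U := fun v hv => by
    classical
    have := sum_shift_sq_le (ζ := fun x => if x ∈ A then (1 : ℝ) else 0) (u := u) (T := T) (v := v)
      (B := 1) (fun x => by split_ifs <;> norm_num) fun x hx => by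
        have hx' : x ∈ A := by by_contra h0; simp [h0] at hx
        exact ⟨hself x (hAr x hx'), hshift x v (hAr x hx') hv⟩
    rw [one_mul] at this
    refine le_trans (le_of_eq ?_) this
    simp only [ite_mul, one_mul, zero_mul]
    rw [← Finset.sum_filter]
    refine Finset.sum_congr ?_ fun _ _ => rfl
    ext x
    exact ⟨fun hx => Finset.mem_filter.mpr ⟨hself x (hAr x hx), hx⟩,
      fun hx => (Finset.mem_filter.mp hx).2⟩
  have h3 : ∑ x ∈ A, u x ^ 2 ≤ U := by
    simpa using h2 0 (by rw [map_zero, norm_zero]; linarith)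
  have h4 : ∑ v ∈ P, ∑ x ∈ A, u (x + v) ^ 2 ≤ N' * U := by
    rw [hN', ← nsmul_eq_mul, ← Finset.sum_const]
    exact Finset.sum_le_sum fun v hv => h2 v (hP v hv)
  calc _ ≤ ∑ x ∈ A, 3 * (h ^ 2 * (N * ∑ i, (u (x + n i) - u x) ^ 2) + h ^ 4 * u x ^ 2
        + h ^ 4 * (N' * ∑ v ∈ P, u (x + v) ^ 2)) := by
        refine Finset.sum_le_sum fun x _ => (add_add_sq_le _ _ _).trans ?_
        have a1 := sq_sum_abs_le Finset.univ fun i => u (x + n i) - u x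
        have a2 := sq_sum_abs_le P fun v => u (x + v)
        rw [Finset.card_univ] at a1
        rw [mul_pow, mul_pow, mul_pow, sq_abs, ← pow_mul]
        gcongr
    _ = 3 * (h ^ 2 * (N * ∑ x ∈ A, ∑ i, (u (x + n i) - u x) ^ 2) + h ^ 4 * ∑ x ∈ A, u x ^ 2
        + h ^ 4 * (N' * ∑ v ∈ P, ∑ x ∈ A, u (x + v) ^ 2)) := by
        rw [Finset.sum_comm (s := P)]
        simp only [← Finset.mul_sum, Finset.sum_add_distrib]
    _ ≤ 3 * (h ^ 2 * (N * (K * h ^ 2 * U)) + h ^ 4 * U + h ^ 4 * (N' * (N' * U))) := by gcongr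
    _ = _ := by ring

theorem sum_shift_sq_le_of_support {f : G → ℝ} {Z : Finset G} {v : G}
    (hf : ∀ x, f x ≠ 0 → x ∈ Z ∧ x - v ∈ Z) : ∑ x ∈ Z, f (x + v) ^ 2 = ∑ x ∈ Z, f x ^ 2 :=
  sum_shift_eq (F := fun x => f x ^ 2) fun x hx => hf x fun h0 => hx (by simp [h0])

set_option maxHeartbeats 2000000 in
/-- The Carleman estimate for cut-offs of solutions. -/
theorem carleman_cutoff (hF : IsSymmetricFrame p n ν) (P : Finset G) {R M : ℝ} (hR : 1 ≤ R)
    (hP : ∀ v ∈ P, ‖p v‖ ≤ R) (hM : 0 ≤ M) :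
    ∃ K > (0 : ℝ), ∃ δ₀ > (0 : ℝ), ∃ τ₀ ≥ (1 : ℝ), 600 * δ₀ * R ≤ 1 ∧
      ∀ h > (0 : ℝ), ∀ τ ≥ τ₀, τ * h ≤ δ₀ →
      ∀ (u : G → ℝ) (Z : Finset G), (∀ x, x ∈ Z ↔ ‖h • p x‖ ^ 2 ≤ 1) →
      SchrodingerBound p n P M h u →
      h ^ 4 * ∑ x ∈ Z with 13 / 20 ≤ ‖h • p x‖ ^ 2 ∧ ‖h • p x‖ ^ 2 ≤ 9 / 10,
        (Real.exp (carlemanWeight τ (h • p x)) * u x) ^ 2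
      ≤ K * ∑ x ∈ Z with |‖h • p x‖ ^ 2 - 5 / 8| ≤ 7 / 200 ∨ |‖h • p x‖ ^ 2 - 37 / 40| ≤ 7 / 200,
        (Real.exp (carlemanWeight τ (h • p x)) * (h * ∑ i, |u (x + n i) - u x| + h ^ 2 * |u x|
          + h ^ 2 * ∑ v ∈ P, |u (x + v)|)) ^ 2 := by
  obtain ⟨κ₀, hκ₀, hcarl⟩ := carleman_estimate hF
  -- Equal to 1 for 13/20 ≤ s ≤ 9/10 and supported in 3/5 ≤ s ≤ 19/20, the range of the Carleman
  -- estimate.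
  let b : ContDiffBump (31 / 40 : ℝ) := ⟨1 / 8, 7 / 40, by norm_num, by norm_num⟩
  obtain ⟨Kb, hKb, -, hbK⟩ := exists_cutoff_bound hF b.contDiff b.hasCompactSupport
  set N : ℝ := (Fintype.card ι : ℝ) with hN
  set N' : ℝ := (P.card : ℝ) with hN'
  have hN0 : 0 ≤ N := Nat.cast_nonneg _
  have hN'0 : 0 ≤ N' := Nat.cast_nonneg _
  set K₁ := M + Kb with hK₁
  have hK₁0 : 0 < K₁ := by positivity
  -- The middle term makes 1/τ ≤ κ₀/2; the last lets the left side of the Carleman estimate absorb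
  -- the lower order terms.
  set τ₀ := 1 + 2 / κ₀ + 6 * M ^ 2 * (N + 144 * N ^ 2 + 9 * N' ^ 2) * 100 with hτ₀
  refine ⟨50 * K₁ ^ 2, by positivity, min (κ₀ / 2) (1 / (600 * R)), by positivity, τ₀, ?_, ?_, ?_⟩
  · have : 0 ≤ 2 / κ₀ + 6 * M ^ 2 * (N + 144 * N ^ 2 + 9 * N' ^ 2) * 100 := by positivity
    rw [hτ₀]; linarith
  · calc 600 * min (κ₀ / 2) (1 / (600 * R)) * R ≤ 600 * (1 / (600 * R)) * R := by
          gcongr; exact min_le_right _ _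
      _ = 1 := by field_simp
      _ ≤ 1 := le_rfl
  intro h hh τ hτ hτh u Z hZ hu
  have hM0 : 0 ≤ 6 * M ^ 2 * (N + 144 * N ^ 2 + 9 * N' ^ 2) * 100 := by positivity
  have hτ1 : 1 ≤ τ := by
    have : 0 ≤ 2 / κ₀ := by positivity
    linarith
  have hτ0 : 0 < τ := by linarith
  have hτκ : 1 / τ ≤ κ₀ / 2 := by
    have : 2 / κ₀ ≤ τ := by linarith
    rw [div_le_iff₀ hκ₀] at this
    rw [div_le_iff₀ hτ0]
    linarith
  have hτhR : 600 * (τ * (h * R)) ≤ 1 := by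
    have := hτh.trans (min_le_right _ _)
    rw [le_div_iff₀ (by positivity)] at this
    linarith
  have hhR0 : 0 < h * R := by positivity
  have hhR : 600 * (h * R) ≤ 1 := by nlinarith
  have hτhh : 600 * (τ * h) ≤ 1 := by
    have : τ * h ≤ τ * (h * R) := by
      apply mul_le_mul_of_nonneg_left _ hτ0.le
      exact le_mul_of_one_le_right hh.le hR
    linarith
  have hh1 : h ≤ 1 := by nlinarith
  have hτh' : 0 < τ * h := by positivity
  set s : G → ℝ := fun x => ‖h • p x‖ ^ 2 with hs
  set χ : G → ℝ := fun x => b (s x) with hχ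
  set W : G → ℝ := fun x => carlemanWeight τ (h • p x) with hW
  set w : G → ℝ := fun x => χ x * u x with hw
  set f : G → ℝ := fun x => Real.exp (W x) * w x with hf
  have hχ0 : ∀ x, χ x ≠ 0 → 3 / 5 < s x ∧ s x < 19 / 20 := fun x hx => by
    have h1 : s x ∈ Function.support b := hx
    rw [b.support_eq, Metric.mem_ball, Real.dist_eq, abs_lt] at h1
    change -(7 / 40) < _ ∧ _ < 7 / 40 at h1
    constructor <;> linarith [h1.1, h1.2]
  have hχ1 : ∀ x, 13 / 20 ≤ s x → s x ≤ 9 / 10 → χ x = 1 := fun x h1 h2 => by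
    refine b.one_of_mem_closedBall ?_
    rw [Metric.mem_closedBall, Real.dist_eq, abs_le]
    change -(1 / 8) ≤ _ ∧ _ ≤ 1 / 8
    constructor <;> linarith
  have hχle : ∀ x, |χ x| ≤ 1 := fun x => by
    rw [abs_of_nonneg b.nonneg]; exact b.le_one
  have hf0 : ∀ x, f x ≠ 0 → χ x ≠ 0 := fun x hx h0 => hx (by simp [hf, hw, h0])
  have hnR : ∀ i, ‖p (n i)‖ ≤ R := fun i => (hF.norm_le i).trans hR
  have hsd : ∀ x v, s x ≤ 1 → ‖p v‖ ≤ R → |s (x + v) - s x| ≤ 1 / 200 := fun x v hx hv =>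
    (abs_sq_norm_smul_add_sub_le p hh (by linarith) hv hx).trans (by linarith)
  have hfZ : ∀ v, ‖p v‖ ≤ R → ∀ x, f x ≠ 0 → x + v ∈ Z := fun v hv x hx => by
    have h1 := hχ0 x (hf0 x hx)
    have h2 := abs_le.mp (hsd x v (by linarith) hv)
    rw [hZ]; change s (x + v) ≤ 1; linarith
  have hfZ0 : ∀ x, f x ≠ 0 → x ∈ Z := fun x hx => by
    have := hfZ 0 (by rw [map_zero, norm_zero]; linarith) x hx
    rwa [add_zero] at this
  have hcar := hcarl h hh τ hτ1 (by linarith) (by linarith [hτh.trans (min_le_left _ _)]) Z f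
    (fun x hx => ⟨(hχ0 x (hf0 x hx)).1.le, (hχ0 x (hf0 x hx)).2.le⟩)
    (fun x hx => ⟨hfZ0 x hx, fun i => hfZ _ (hnR i) x hx⟩)
  set g : G → ℝ := fun x => ∑ i, (Real.exp (W x - W (x + n i)) * f (x + n i) - f x) with hg
  have hgw : ∀ x, g x = Real.exp (W x) * ∑ i, (w (x + n i) - w x) := fun x => by
    simp only [hg, hf]
    rw [Finset.mul_sum]
    refine Finset.sum_congr rfl fun i _ => ?_
    rw [← mul_assoc, ← Real.exp_add, sub_add_cancel]; ring
  set D : G → ℝ := fun x => h * ∑ i, |u (x + n i) - u x| + h ^ 2 * |u x|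
    + h ^ 2 * ∑ v ∈ P, |u (x + v)| with hD
  have hD0 : ∀ x, 0 ≤ D x := fun x => by
    have : 0 ≤ ∑ i, |u (x + n i) - u x| := Finset.sum_nonneg fun _ _ => abs_nonneg _
    have : 0 ≤ ∑ v ∈ P, |u (x + v)| := Finset.sum_nonneg fun _ _ => abs_nonneg _
    simp only [hD]; positivity
  set A : G → ℝ := fun x => h * ∑ i, |w (x + n i) - w x| + h ^ 2 * ∑ v ∈ P, |w (x + v)| with hA
  have hA0 : ∀ x, 0 ≤ A x := fun x => by
    have : 0 ≤ ∑ i, |w (x + n i) - w x| := Finset.sum_nonneg fun _ _ => abs_nonneg _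
    have : 0 ≤ ∑ v ∈ P, |w (x + v)| := Finset.sum_nonneg fun _ _ => abs_nonneg _
    simp only [hA]; positivity
  -- the cut-off function solves the differential inequality away from the shells
  have hpt : ∀ x ∈ Z, |∑ i, (w (x + n i) - w x)| ≤ M * A x + K₁ *
      (if |s x - 5 / 8| ≤ 7 / 200 ∨ |s x - 37 / 40| ≤ 7 / 200 then D x else 0) := fun x hxZ => by
    have hx1 : s x ≤ 1 := (hZ x).mp hxZ
    split_ifs with hsh
    · have e : ∑ i, (w (x + n i) - w x) = χ x * ∑ i, (u (x + n i) - u x)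
          + ∑ i, (χ (x + n i) - χ x) * (u (x + n i) - u x) + (∑ i, (χ (x + n i) - χ x)) * u x := by
        rw [Finset.mul_sum, Finset.sum_mul, ← Finset.sum_add_distrib, ← Finset.sum_add_distrib]
        exact Finset.sum_congr rfl fun i _ => by simp only [hw]; ring
      have hx2 : ‖h • p x‖ ≤ 2 := by
        linarith [(sq_le_one_iff₀ (norm_nonneg (h • p x))).mp hx1]
      obtain ⟨b1, b2⟩ := hbK h hh hh1 x hx2
      have a1 : |χ x * ∑ i, (u (x + n i) - u x)| ≤ M * D x := by
        rw [abs_mul]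
        calc |χ x| * |∑ i, (u (x + n i) - u x)|
            ≤ 1 * (M * (h * ∑ i, |u (x + n i) - u x| + h ^ 2 * ∑ v ∈ P, |u (x + v)|)) :=
              mul_le_mul (hχle x) (hu x hx1) (abs_nonneg _) zero_le_one
          _ ≤ M * D x := by
              rw [one_mul]
              apply mul_le_mul_of_nonneg_left _ hM
              simp only [hD]
              have : 0 ≤ h ^ 2 * |u x| := by positivity
              linarith
      have a2 : |∑ i, (χ (x + n i) - χ x) * (u (x + n i) - u x)|
          ≤ Kb * (h * ∑ i, |u (x + n i) - u x|) := by
        rw [← mul_assoc, Finset.mul_sum]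
        refine (Finset.abs_sum_le_sum_abs _ _).trans (Finset.sum_le_sum fun i _ => ?_)
        rw [abs_mul]
        exact mul_le_mul_of_nonneg_right (b1 i) (abs_nonneg _)
      have a3 : |(∑ i, (χ (x + n i) - χ x)) * u x| ≤ Kb * (h ^ 2 * |u x|) := by
        rw [abs_mul, ← mul_assoc]
        exact mul_le_mul_of_nonneg_right b2 (abs_nonneg _)
      have a4 : Kb * (h * ∑ i, |u (x + n i) - u x|) + Kb * (h ^ 2 * |u x|) ≤ Kb * D x := by
        rw [← mul_add]
        apply mul_le_mul_of_nonneg_left _ hKb.le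
        simp only [hD]
        have : 0 ≤ h ^ 2 * ∑ v ∈ P, |u (x + v)| :=
          mul_nonneg (by positivity) (Finset.sum_nonneg fun _ _ => abs_nonneg _)
        linarith
      have a5 := mul_nonneg hM (hA0 x)
      rw [e]
      refine (abs_add_three _ _ _).trans ?_
      rw [hK₁, add_mul]
      linarith
    · rw [not_or, not_le, not_le] at hsh
      rw [mul_zero, add_zero]
      -- The shells cover the transition zones of the cut-off with a margin 1/100 in s, and a shift
      -- moves s by at most 1/200. Off the shells the cut-off is therefore constant on the whole
      -- stencil.
      have hcase : (∀ v, ‖p v‖ ≤ R → χ (x + v) = 0) ∨ (∀ v, ‖p v‖ ≤ R → χ (x + v) = 1) := by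
        by_cases c1 : s x < 59 / 100
        · left
          intro v hv
          by_contra h0
          linarith [(hχ0 _ h0).1, (abs_le.mp (hsd x v hx1 hv)).2]
        · have c2 : 66 / 100 < s x := by
            by_contra h0
            have := hsh.1
            rw [lt_abs] at this
            rcases this with h | h <;> linarith
          by_cases c3 : s x < 89 / 100
          · right
            intro v hv
            have := abs_le.mp (hsd x v hx1 hv)
            exact hχ1 _ (by linarith) (by linarith)
          · have c4 : 96 / 100 < s x := by
              by_contra h0
              have := hsh.2
              rw [lt_abs] at this
              rcases this with h | h <;> linarith
            left
            intro v hv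
            by_contra h0
            linarith [(hχ0 _ h0).2, (abs_le.mp (hsd x v hx1 hv)).1]
      have hR0 : ‖p (0 : G)‖ ≤ R := by rw [map_zero, norm_zero]; linarith
      rcases hcase with h0 | h1
      · have h00 : χ x = 0 := by simpa using h0 0 hR0
        have : ∑ i, (w (x + n i) - w x) = 0 :=
          Finset.sum_eq_zero fun i _ => by simp [hw, h00, h0 _ (hnR i)]
        rw [this, abs_zero]
        exact mul_nonneg hM (hA0 x)
      · have h11 : χ x = 1 := by simpa using h1 0 hR0
        have e1 : ∀ i, w (x + n i) = u (x + n i) := fun i => by simp [hw, h1 _ (hnR i)]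
        have e2 : w x = u x := by simp [hw, h11]
        have e3 : ∑ v ∈ P, |w (x + v)| = ∑ v ∈ P, |u (x + v)| :=
          Finset.sum_congr rfl fun v hv => by simp [hw, h1 _ (hP v hv)]
        simp only [hA, e1, e2, e3]
        exact hu x hx1
  -- conjugated lower order terms
  have hWd : ∀ x v, ‖p v‖ ≤ R → f (x + v) ≠ 0 → |W (x + v) - W x| ≤ 6 * (τ * (h * ‖p v‖)) :=
    fun x v hv hx => by
      have h1 := (hχ0 _ (hf0 _ hx)).2
      have h2 : h * ‖p v‖ ≤ h * R := by gcongr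
      -- The base point is x + v, known to be in the unit ball because f does not vanish there; x
      -- itself need not be. Taking the radius to be ‖p v‖ gives a bound without R for the unit
      -- steps.
      have := abs_carlemanWeight_sub_le p hτ0.le hh (R := ‖p v‖) (v := -v) (x := x + v)
        (by linarith) (by rw [map_neg, norm_neg]) (by change s (x + v) ≤ 1; linarith)
      rwa [add_neg_cancel_right, abs_sub_comm] at this
  have hlow : ∀ x, Real.exp (W x) * A x ≤ h * ∑ i, |f (x + n i) - f x|
      + 12 * (τ * h ^ 2) * ∑ i, |f (x + n i)| + 3 * h ^ 2 * ∑ v ∈ P, |f (x + v)| := fun x => by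
    have q1 : ∀ i, Real.exp (W x) * |w (x + n i) - w x|
        ≤ |f (x + n i) - f x| + 12 * (τ * h) * |f (x + n i)| := fun i => by
      by_cases h0 : f (x + n i) = 0
      · have : w (x + n i) = 0 := by
          simpa [hf, (Real.exp_pos _).ne'] using h0
        rw [this, h0]
        simp only [hf, zero_sub, abs_neg, abs_mul, Real.abs_exp, abs_zero, mul_zero, add_zero]
        exact le_rfl
      · have h1 := hWd x (n i) (hnR i) h0
        have h2 : |W x - W (x + n i)| ≤ 6 * (τ * h) := by
          rw [abs_sub_comm]
          refine h1.trans ?_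
          have := mul_le_mul_of_nonneg_left (hF.norm_le i) hτh'.le
          linarith
        have h3 : |Real.exp (W x - W (x + n i)) - 1| ≤ 2 * |W x - W (x + n i)| :=
          Real.abs_exp_sub_one_le (by linarith)
        have e : Real.exp (W x) * (w (x + n i) - w x) = (f (x + n i) - f x)
            + (Real.exp (W x - W (x + n i)) - 1) * f (x + n i) := by
          have : Real.exp (W x) = Real.exp (W x - W (x + n i)) * Real.exp (W (x + n i)) := by
            rw [← Real.exp_add, sub_add_cancel]
          simp only [hf]
          linear_combination w (x + n i) * this
        rw [← Real.abs_exp (W x), ← abs_mul, e]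
        refine (abs_add_le _ _).trans (add_le_add le_rfl ?_)
        rw [abs_mul]
        exact mul_le_mul_of_nonneg_right (by linarith) (abs_nonneg _)
    have q2 : ∀ v ∈ P, Real.exp (W x) * |w (x + v)| ≤ 3 * |f (x + v)| := fun v hv => by
      by_cases h0 : f (x + v) = 0
      · have : w (x + v) = 0 := by
          simpa [hf, (Real.exp_pos _).ne'] using h0
        rw [this, h0, abs_zero, mul_zero, mul_zero]
      · have h1 := hWd x v (hP v hv) h0
        have h2 : τ * (h * ‖p v‖) ≤ τ * (h * R) := by gcongr; exact hP v hv
        have h3 : W x ≤ W (x + v) + 1 := by linarith [(abs_le.mp h1).1]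
        have h4 : Real.exp (W x) ≤ 3 * Real.exp (W (x + v)) := by
          calc Real.exp (W x) ≤ Real.exp (W (x + v) + 1) := Real.exp_le_exp.mpr h3
            _ = Real.exp 1 * Real.exp (W (x + v)) := by rw [Real.exp_add, mul_comm]
            _ ≤ _ := by gcongr; exact Real.exp_one_lt_three.le
        simp only [hf, abs_mul, Real.abs_exp]
        rw [← mul_assoc]
        exact mul_le_mul_of_nonneg_right h4 (abs_nonneg _)
    have r1 := Finset.sum_le_sum fun i (_ : i ∈ Finset.univ) => q1 i
    have r2 := Finset.sum_le_sum q2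
    rw [← Finset.mul_sum, Finset.sum_add_distrib, ← Finset.mul_sum] at r1
    rw [← Finset.mul_sum, ← Finset.mul_sum] at r2
    have r1' := mul_le_mul_of_nonneg_left r1 hh.le
    have r2' := mul_le_mul_of_nonneg_left r2 (sq_nonneg h)
    simp only [hA]
    linarith
  set E := ∑ x ∈ Z, ∑ i, (f (x + n i) - f x) ^ 2 with hE
  set Q := ∑ x ∈ Z, f x ^ 2 with hQ
  have hE0 : 0 ≤ E := Finset.sum_nonneg fun _ _ => Finset.sum_nonneg fun _ _ => sq_nonneg _
  have hQ0 : 0 ≤ Q := Finset.sum_nonneg fun _ _ => sq_nonneg _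
  have hAsum : ∑ x ∈ Z, (Real.exp (W x) * A x) ^ 2
      ≤ 3 * (h ^ 2 * (N * E) + 144 * τ ^ 2 * h ^ 4 * (N * (N * Q)) + 9 * h ^ 4 * (N' * (N' * Q))) := by
    have s1 : ∑ x ∈ Z, ∑ i, f (x + n i) ^ 2 = N * Q :=
      sum_sum_shift_sq hF.neg f fun x hx => ⟨hfZ0 x hx, fun i => hfZ _ (hnR i) x hx⟩
    have s2 : ∑ v ∈ P, ∑ x ∈ Z, f (x + v) ^ 2 = N' * Q := by
      rw [hN', ← nsmul_eq_mul, ← Finset.sum_const]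
      refine Finset.sum_congr rfl fun v hv => sum_shift_sq_le_of_support fun x hx =>
        ⟨hfZ0 x hx, ?_⟩
      rw [sub_eq_add_neg]
      exact hfZ (-v) (by rw [map_neg, norm_neg]; exact hP v hv) x hx
    calc _ ≤ ∑ x ∈ Z, 3 * (h ^ 2 * (N * ∑ i, (f (x + n i) - f x) ^ 2)
          + 144 * τ ^ 2 * h ^ 4 * (N * ∑ i, f (x + n i) ^ 2)
          + 9 * h ^ 4 * (N' * ∑ v ∈ P, f (x + v) ^ 2)) := by
          refine Finset.sum_le_sum fun x _ => ?_
          refine (pow_le_pow_left₀ (mul_nonneg (Real.exp_pos _).le (hA0 x)) (hlow x) 2).trans ?_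
          refine (add_add_sq_le _ _ _).trans ?_
          have a1 := sq_sum_abs_le Finset.univ fun i => f (x + n i) - f x
          have a2 := sq_sum_abs_le Finset.univ fun i => f (x + n i)
          have a3 := sq_sum_abs_le P fun v => f (x + v)
          rw [Finset.card_univ] at a1 a2
          rw [mul_pow h, mul_pow (12 * (τ * h ^ 2)), mul_pow (3 * h ^ 2), show (12 * (τ * h ^ 2)) ^ 2 = 144 * τ ^ 2 * h ^ 4 by ring,
            show (3 * h ^ 2) ^ 2 = 9 * h ^ 4 by ring]
          gcongr
      _ = _ := by
          rw [← s1, ← s2, hE, Finset.sum_comm (s := P)]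
          simp only [← Finset.mul_sum, Finset.sum_add_distrib]
  set B := ∑ x ∈ Z with |s x - 5 / 8| ≤ 7 / 200 ∨ |s x - 37 / 40| ≤ 7 / 200,
    (Real.exp (W x) * D x) ^ 2 with hB
  have hgsum : ∑ x ∈ Z, g x ^ 2 ≤ 2 * M ^ 2 * ∑ x ∈ Z, (Real.exp (W x) * A x) ^ 2
      + 2 * K₁ ^ 2 * B := by
    rw [hB, Finset.sum_filter, Finset.mul_sum, Finset.mul_sum, ← Finset.sum_add_distrib]
    refine Finset.sum_le_sum fun x hx => ?_
    have h1 := mul_le_mul_of_nonneg_left (hpt x hx) (Real.exp_pos (W x)).le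
    have h2 : |g x| ≤ M * (Real.exp (W x) * A x) + K₁ * (Real.exp (W x) *
        (if |s x - 5 / 8| ≤ 7 / 200 ∨ |s x - 37 / 40| ≤ 7 / 200 then D x else 0)) := by
      rw [hgw, abs_mul, Real.abs_exp]; linarith
    rw [← sq_abs]
    refine (pow_le_pow_left₀ (abs_nonneg _) h2 2).trans (add_sq_le.trans_eq ?_)
    split_ifs <;> ring
  have hfin : Q * (τ ^ 3 * h ^ 4) * (9 / 100) + τ * h ^ 2 * E * (9 / 100)
      ≤ 6 * M ^ 2 * (N * (h ^ 2 * E) + (144 * N ^ 2 + 9 * N' ^ 2) * (τ ^ 2 * h ^ 4 * Q))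
        + 2 * K₁ ^ 2 * B := by
    have h1 := mul_le_mul_of_nonneg_left hAsum (show 0 ≤ 2 * M ^ 2 by positivity)
    have h2 : M ^ 2 * N' ^ 2 * (h ^ 4 * Q) * 1 ≤ M ^ 2 * N' ^ 2 * (h ^ 4 * Q) * τ ^ 2 := by
      gcongr
      exact one_le_pow₀ hτ1
    linarith
  have hτM : 6 * M ^ 2 * (N + 144 * N ^ 2 + 9 * N' ^ 2) * 100 ≤ τ := by
    have : 0 ≤ 2 / κ₀ := by positivity
    linarith
  have hE1 : 6 * M ^ 2 * (N * (h ^ 2 * E)) ≤ τ * h ^ 2 * E * (9 / 100) := by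
    have h1 : 6 * M ^ 2 * N * 100 ≤ τ := by
      have : 0 ≤ 6 * M ^ 2 * (144 * N ^ 2 + 9 * N' ^ 2) * 100 := by positivity
      linarith
    have h2 := mul_le_mul_of_nonneg_right h1 (show 0 ≤ h ^ 2 * E by positivity)
    have h3 : 0 ≤ τ * (h ^ 2 * E) := by positivity
    linarith
  have hQ1 : 6 * M ^ 2 * ((144 * N ^ 2 + 9 * N' ^ 2) * (τ ^ 2 * h ^ 4 * Q))
      ≤ Q * (τ ^ 3 * h ^ 4) * (1 / 100) := by
    have h1 : 6 * M ^ 2 * (144 * N ^ 2 + 9 * N' ^ 2) * 100 ≤ τ := by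
      have : 0 ≤ 6 * M ^ 2 * N * 100 := by positivity
      linarith
    have h2 := mul_le_mul_of_nonneg_right h1 (show 0 ≤ τ ^ 2 * h ^ 4 * Q by positivity)
    linarith
  have hB0 : 0 ≤ K₁ ^ 2 * B :=
    mul_nonneg (sq_nonneg _) (Finset.sum_nonneg fun _ _ => sq_nonneg _)
  -- The gain τ³ is no longer needed once the lower order terms are absorbed, and is given away.
  have hQB : h ^ 4 * Q ≤ 50 * K₁ ^ 2 * B := by
    have h1 : Q * h ^ 4 * 1 ≤ Q * h ^ 4 * τ ^ 3 := by
      gcongr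
      exact one_le_pow₀ hτ1
    linarith
  refine le_trans ?_ hQB
  apply mul_le_mul_of_nonneg_left _ (by positivity)
  rw [hQ]
  refine le_trans (Finset.sum_le_sum fun x hx => ?_) (Finset.sum_le_sum_of_subset_of_nonneg
    (Finset.filter_subset (fun x => 13 / 20 ≤ s x ∧ s x ≤ 9 / 10) Z) fun _ _ _ => sq_nonneg _)
  obtain ⟨-, h1, h2⟩ := Finset.mem_filter.mp hx
  simp only [hf, hw, hχ1 x h1 h2, one_mul]
  exact le_rfl
end Step

/-! ### The three balls inequality: one step, dilation and iteration. -/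

section Chain

variable {G : Type*} [AddCommGroup G] {ι : Type*} [Fintype ι]
  {V : Type*} [NormedAddCommGroup V] [InnerProductSpace ℝ V]
  {p : G →+ V} {n : ι → G} {ν : Equiv.Perm ι}

theorem sqrt_add_le {a b : ℝ} (ha : 0 ≤ a) (hb : 0 ≤ b) : √(a + b) ≤ √a + √b :=
  Real.sqrt_le_iff.mpr ⟨by positivity, by
    nlinarith [Real.sq_sqrt ha, Real.sq_sqrt hb, mul_nonneg (Real.sqrt_nonneg a) (Real.sqrt_nonneg b)]⟩

/-- Three balls inequality, with radii `√(17/25) < √(4/5) < 1`. -/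
theorem three_balls_step (hF : IsSymmetricFrame p n ν) (P : Finset G) {M : ℝ} (hM : 0 ≤ M) :
    ∃ C > (0 : ℝ), ∃ δ₀ > (0 : ℝ), ∃ τ₀ ≥ (1 : ℝ), ∀ h > (0 : ℝ), ∀ τ ≥ τ₀, τ * h ≤ δ₀ →
      ∀ (u : G → ℝ) (Z : Finset G), (∀ x, x ∈ Z ↔ ‖h • p x‖ ^ 2 ≤ 1) →
      SchrodingerBound p n P M h u →
      √(∑ x ∈ Z with ‖h • p x‖ ^ 2 ≤ 4 / 5, u x ^ 2)
      ≤ C * (Real.exp (13 / 100 * τ) * √(∑ x ∈ Z with ‖h • p x‖ ^ 2 ≤ 17 / 25, u x ^ 2)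
        + Real.exp (-(1 / 50) * τ) * √(∑ x ∈ Z, u x ^ 2)) := by
  obtain ⟨R, hR, hP⟩ : ∃ R : ℝ, 1 ≤ R ∧ ∀ v ∈ P, ‖p v‖ ≤ R := by
    refine ⟨1 + ∑ v ∈ P, ‖p v‖, ?_, fun v hv => ?_⟩
    · linarith [Finset.sum_nonneg fun v (_ : v ∈ P) => norm_nonneg (p v)]
    · linarith [Finset.single_le_sum (fun v _ => norm_nonneg (p v)) hv]
  obtain ⟨K, hK, δ₀, hδ₀, τ₀, hτ₀, hδR, hcar⟩ := carleman_cutoff hF P hR hP hM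
  -- The thickened inner shell ends at s = 17/25, which fixes the inner ball; the thickened outer
  -- one ends at 49/50, inside the unit ball.
  obtain ⟨K₁, hK₁, hsh₁⟩ := shell_bound hF P hR hP hM (c := 5 / 8) (r := 7 / 200) (ρ := 1 / 100)
    (by norm_num) (by norm_num) (by norm_num)
  obtain ⟨K₂, hK₂, hsh₂⟩ := shell_bound hF P hR hP hM (c := 37 / 40) (r := 7 / 200) (ρ := 1 / 100)
    (by norm_num) (by norm_num) (by norm_num)
  set C := 1 + K * (K₁ + K₂) with hC
  have hC1 : 1 ≤ C := by
    have : 0 ≤ K * (K₁ + K₂) := by positivity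
    linarith
  refine ⟨C, by linarith, δ₀, hδ₀, τ₀, hτ₀, ?_⟩
  intro h hh τ hτ hτh u Z hZ hu
  have hτ1 : 1 ≤ τ := le_trans hτ₀ hτ
  have hτ0 : 0 < τ := by linarith
  have hhR : 600 * (h * R) ≤ 1 := by
    have h1 : h ≤ τ * h := le_mul_of_one_le_left hh.le hτ1
    have h2 : h * R ≤ δ₀ * R := by gcongr; linarith
    linarith
  have hcar := hcar h hh τ hτ hτh u Z hZ hu
  have hsh₁ := hsh₁ h hh (by linarith) (by linarith) u Z hZ hu
  have hsh₂ := hsh₂ h hh (by linarith) (by linarith) u Z hZ hu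
  set s : G → ℝ := fun x => ‖h • p x‖ ^ 2 with hs
  have hs0 : ∀ x, 0 ≤ s x := fun x => sq_nonneg _
  set S₁ := ∑ x ∈ Z with s x ≤ 17 / 25, u x ^ 2 with hS₁
  set S₂ := ∑ x ∈ Z, u x ^ 2 with hS₂
  set S := ∑ x ∈ Z with s x ≤ 4 / 5, u x ^ 2 with hS
  have hS₁0 : 0 ≤ S₁ := Finset.sum_nonneg fun _ _ => sq_nonneg _
  have hS₂0 : 0 ≤ S₂ := Finset.sum_nonneg fun _ _ => sq_nonneg _
  set D : G → ℝ := fun x => h * ∑ i, |u (x + n i) - u x| + h ^ 2 * |u x|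
    + h ^ 2 * ∑ v ∈ P, |u (x + v)| with hD
  have hinner : ∑ x ∈ Z with |s x - 5 / 8| ≤ 7 / 200, D x ^ 2 ≤ K₁ * h ^ 4 * S₁ := by
    refine hsh₁.trans (mul_le_mul_of_nonneg_left ?_ (by positivity))
    refine Finset.sum_le_sum_of_subset_of_nonneg (fun x hx => ?_) fun _ _ _ => sq_nonneg _
    rw [Finset.mem_filter] at hx ⊢
    exact ⟨hx.1, by linarith [(abs_le.mp hx.2).2]⟩
  have houter : ∑ x ∈ Z with |s x - 37 / 40| ≤ 7 / 200, D x ^ 2 ≤ K₂ * h ^ 4 * S₂ := by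
    refine hsh₂.trans (mul_le_mul_of_nonneg_left ?_ (by positivity))
    exact Finset.sum_le_sum_of_subset_of_nonneg (Finset.filter_subset _ _) fun _ _ _ => sq_nonneg _
  have hWle : ∀ x q, 0 ≤ q → |s x - 1| ≤ q →
      Real.exp (carlemanWeight τ (h • p x)) ^ 2 ≤ Real.exp (2 * (τ * q ^ 2)) := fun x q hq hx => by
    rw [← Real.exp_nat_mul]
    apply Real.exp_le_exp.mpr
    have : (s x - 1) ^ 2 ≤ q ^ 2 := by rw [← sq_abs]; gcongr
    simp only [carlemanWeight]
    push_cast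
    gcongr
  have hup : ∑ x ∈ Z with |s x - 5 / 8| ≤ 7 / 200 ∨ |s x - 37 / 40| ≤ 7 / 200,
      (Real.exp (carlemanWeight τ (h • p x)) * D x) ^ 2
      ≤ Real.exp (2 * (τ * (41 / 100) ^ 2)) * (K₁ * h ^ 4 * S₁)
        + Real.exp (2 * (τ * (11 / 100) ^ 2)) * (K₂ * h ^ 4 * S₂) := by
    calc _ ≤ ∑ x ∈ Z with |s x - 5 / 8| ≤ 7 / 200,
            (Real.exp (carlemanWeight τ (h • p x)) * D x) ^ 2
          + ∑ x ∈ Z with |s x - 37 / 40| ≤ 7 / 200,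
            (Real.exp (carlemanWeight τ (h • p x)) * D x) ^ 2 := by
          rw [Finset.sum_filter, Finset.sum_filter, Finset.sum_filter, ← Finset.sum_add_distrib]
          refine Finset.sum_le_sum fun x _ => ?_
          have := sq_nonneg (Real.exp (carlemanWeight τ (h • p x)) * D x)
          by_cases h1 : |s x - 5 / 8| ≤ 7 / 200 <;> by_cases h2 : |s x - 37 / 40| ≤ 7 / 200 <;>
            simp only [h1, h2, or_true, or_false, if_true, if_false] <;> linarith
      _ ≤ Real.exp (2 * (τ * (41 / 100) ^ 2)) * ∑ x ∈ Z with |s x - 5 / 8| ≤ 7 / 200, D x ^ 2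
          + Real.exp (2 * (τ * (11 / 100) ^ 2))
            * ∑ x ∈ Z with |s x - 37 / 40| ≤ 7 / 200, D x ^ 2 := by
          rw [Finset.mul_sum, Finset.mul_sum]
          refine add_le_add (Finset.sum_le_sum fun x hx => ?_) (Finset.sum_le_sum fun x hx => ?_)
          · rw [mul_pow]
            have := abs_le.mp (Finset.mem_filter.mp hx).2
            refine mul_le_mul_of_nonneg_right (hWle x _ (by norm_num) ?_) (sq_nonneg _)
            rw [abs_le]; constructor <;> linarith [this.1, this.2]
          · rw [mul_pow]
            have := abs_le.mp (Finset.mem_filter.mp hx).2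
            refine mul_le_mul_of_nonneg_right (hWle x _ (by norm_num) ?_) (sq_nonneg _)
            rw [abs_le]; constructor <;> linarith [this.1, this.2]
      _ ≤ _ := by gcongr
  have hlow : Real.exp (2 * (τ * (1 / 5) ^ 2)) * (S - S₁)
      ≤ ∑ x ∈ Z with 13 / 20 ≤ s x ∧ s x ≤ 9 / 10,
        (Real.exp (carlemanWeight τ (h • p x)) * u x) ^ 2 := by
    rw [hS, hS₁, Finset.sum_filter, Finset.sum_filter, Finset.sum_filter,
      ← Finset.sum_sub_distrib, Finset.mul_sum]
    refine Finset.sum_le_sum fun x _ => ?_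
    have h0 := sq_nonneg (Real.exp (carlemanWeight τ (h • p x)) * u x)
    by_cases h1 : s x ≤ 17 / 25
    · rw [if_pos h1, if_pos (by linarith), sub_self, mul_zero]
      split_ifs <;> linarith
    · rw [if_neg h1, sub_zero]
      by_cases h2 : s x ≤ 4 / 5
      · rw [if_pos h2, if_pos ⟨by linarith, by linarith⟩, mul_pow]
        apply mul_le_mul_of_nonneg_right _ (sq_nonneg _)
        rw [← Real.exp_nat_mul]
        apply Real.exp_le_exp.mpr
        have : (1 / 5) ^ 2 ≤ (s x - 1) ^ 2 := by nlinarith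
        simp only [carlemanWeight]
        push_cast
        gcongr
      · rw [if_neg h2, mul_zero]
        split_ifs <;> linarith
  have hmain : Real.exp (2 * (τ * (1 / 5) ^ 2)) * (S - S₁)
      ≤ K * (Real.exp (2 * (τ * (41 / 100) ^ 2)) * (K₁ * S₁)
        + Real.exp (2 * (τ * (11 / 100) ^ 2)) * (K₂ * S₂)) := by
    have h4 : 0 < h ^ 4 := by positivity
    refine le_of_mul_le_mul_left ?_ h4
    calc _ ≤ h ^ 4 * ∑ x ∈ Z with 13 / 20 ≤ s x ∧ s x ≤ 9 / 10,
        (Real.exp (carlemanWeight τ (h • p x)) * u x) ^ 2 := by gcongr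
      _ ≤ _ := hcar
      _ ≤ K * _ := mul_le_mul_of_nonneg_left hup hK.le
      _ = _ := by ring
  have hS : S ≤ C * (Real.exp (13 / 100 * τ) ^ 2 * S₁ + Real.exp (-(1 / 50) * τ) ^ 2 * S₂) := by
    rw [← Real.exp_nat_mul, ← Real.exp_nat_mul]
    -- The squared distances 0.41², 0.11² and 0.2² bound (s - 1)² on the inner shell, on the outer
    -- shell (both from above) and for s ≤ 4/5 (from below). Then 0.1681 - 0.04 ≤ 13/100 and 0.04 -
    -- 0.0121 ≥ 1/50.
    have e1 : Real.exp (2 * (τ * (41 / 100) ^ 2)) ≤ Real.exp (2 * (τ * (1 / 5) ^ 2))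
        * Real.exp ((2 : ℕ) * (13 / 100 * τ)) := by
      rw [← Real.exp_add]; apply Real.exp_le_exp.mpr; push_cast; linarith
    have e2 : Real.exp (2 * (τ * (11 / 100) ^ 2)) ≤ Real.exp (2 * (τ * (1 / 5) ^ 2))
        * Real.exp ((2 : ℕ) * (-(1 / 50) * τ)) := by
      rw [← Real.exp_add]; apply Real.exp_le_exp.mpr; push_cast; linarith
    have e3 : 1 ≤ Real.exp ((2 : ℕ) * (13 / 100 * τ)) := Real.one_le_exp (by positivity)
    have e4 := Real.exp_pos ((2 : ℕ) * (-(1 / 50) * τ))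
    set X := Real.exp (2 * (τ * (1 / 5) ^ 2))
    set Y₁ := Real.exp ((2 : ℕ) * (13 / 100 * τ))
    set Y₂ := Real.exp ((2 : ℕ) * (-(1 / 50) * τ))
    have hX : 0 < X := Real.exp_pos _
    have h1 : X * (S - S₁) ≤ X * (K * (Y₁ * (K₁ * S₁) + Y₂ * (K₂ * S₂))) := by
      refine hmain.trans ?_
      calc _ ≤ K * ((X * Y₁) * (K₁ * S₁) + (X * Y₂) * (K₂ * S₂)) := by gcongr
        _ = _ := by ring
    have h2 := le_of_mul_le_mul_left h1 hX
    have h3 : S₁ ≤ Y₁ * S₁ := le_mul_of_one_le_left hS₁0 e3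
    have h4 : 0 ≤ K * K₂ * (Y₁ * S₁) := by positivity
    have h5 : 0 ≤ K * K₁ * (Y₂ * S₂) := by positivity
    have h6 : 0 ≤ Y₂ * S₂ := by positivity
    rw [hC]
    linarith
  have hsq : √C ≤ C := Real.sqrt_le_iff.mpr ⟨by linarith, by nlinarith⟩
  calc √S ≤ √(C * (Real.exp (13 / 100 * τ) ^ 2 * S₁ + Real.exp (-(1 / 50) * τ) ^ 2 * S₂)) :=
        Real.sqrt_le_sqrt hS
    _ = √C * √(Real.exp (13 / 100 * τ) ^ 2 * S₁ + Real.exp (-(1 / 50) * τ) ^ 2 * S₂) :=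
        Real.sqrt_mul (by linarith) _
    _ ≤ C * (√(Real.exp (13 / 100 * τ) ^ 2 * S₁) + √(Real.exp (-(1 / 50) * τ) ^ 2 * S₂)) := by
        gcongr
        exact sqrt_add_le (mul_nonneg (sq_nonneg _) hS₁0) (mul_nonneg (sq_nonneg _) hS₂0)
    _ = _ := by
        rw [Real.sqrt_mul (sq_nonneg _), Real.sqrt_mul (sq_nonneg _),
          Real.sqrt_sq (Real.exp_pos _).le, Real.sqrt_sq (Real.exp_pos _).le]

/-- The three balls inequality with squared radii `1/4`, `t`, `4`, and constants which do not depend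
on the mesh size. -/
def ThreeBalls (p : G →+ V) (n : ι → G) (P : Finset G) (M t : ℝ) : Prop :=
  ∃ C > (0 : ℝ), ∃ c₁ > (0 : ℝ), ∃ c₂ > (0 : ℝ), ∃ δ₀ > (0 : ℝ), ∃ τ₀ ≥ (1 : ℝ),
    ∀ h > (0 : ℝ), ∀ τ ≥ τ₀, τ * h ≤ δ₀ →
      ∀ (u : G → ℝ) (Z : Finset G), (∀ x, x ∈ Z ↔ ‖h • p x‖ ^ 2 ≤ 4) →
      (∀ x, ‖h • p x‖ ^ 2 ≤ 4 → |∑ i, (u (x + n i) - u x)|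
        ≤ M * (h * ∑ i, |u (x + n i) - u x| + h ^ 2 * ∑ v ∈ P, |u (x + v)|)) →
      √(∑ x ∈ Z with ‖h • p x‖ ^ 2 ≤ t, u x ^ 2)
      ≤ C * (Real.exp (c₁ * τ) * √(∑ x ∈ Z with ‖h • p x‖ ^ 2 ≤ 1 / 4, u x ^ 2)
        + Real.exp (-c₂ * τ) * √(∑ x ∈ Z, u x ^ 2))

/-- Dilation by √a replaces h by h/√a. Since a ≤ 4, the bound on the coefficients grows at most to
4M, and since a ≥ 1/4, the mesh at most doubles; the constants are therefore uniform in a. -/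
theorem three_balls_step_scaled (hF : IsSymmetricFrame p n ν) (P : Finset G) {M : ℝ}
    (hM : 0 ≤ M) :
    ∃ C > (0 : ℝ), ∃ δ₀ > (0 : ℝ), ∃ τ₀ ≥ (1 : ℝ), ∀ a ≥ (1 / 4 : ℝ), a ≤ 4 →
      ∀ h > (0 : ℝ), ∀ τ ≥ τ₀, τ * h ≤ δ₀ →
      ∀ (u : G → ℝ) (Z : Finset G), (∀ x, x ∈ Z ↔ ‖h • p x‖ ^ 2 ≤ 4) →
      (∀ x, ‖h • p x‖ ^ 2 ≤ 4 → |∑ i, (u (x + n i) - u x)|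
        ≤ M * (h * ∑ i, |u (x + n i) - u x| + h ^ 2 * ∑ v ∈ P, |u (x + v)|)) →
      √(∑ x ∈ Z with ‖h • p x‖ ^ 2 ≤ 4 / 5 * a, u x ^ 2)
      ≤ C * (Real.exp (13 / 100 * τ) * √(∑ x ∈ Z with ‖h • p x‖ ^ 2 ≤ 17 / 25 * a, u x ^ 2)
        + Real.exp (-(1 / 50) * τ) * √(∑ x ∈ Z, u x ^ 2)) := by
  obtain ⟨C, hC, δ₀, hδ₀, τ₀, hτ₀, hstep⟩ :=
    three_balls_step hF P (M := 4 * M) (by positivity)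
  refine ⟨C, hC, δ₀ / 2, by positivity, τ₀, hτ₀, ?_⟩
  intro a ha ha4 h hh τ hτ hτh u Z hZ hu
  have ha0 : 0 < a := by linarith
  have hτ1 : 1 ≤ τ := le_trans hτ₀ hτ
  have hsa : 0 < √a := Real.sqrt_pos.mpr ha0
  have hsa2 : √a ≤ 2 := Real.sqrt_le_iff.mpr ⟨by norm_num, by linarith⟩
  have hsa1 : 1 / 2 ≤ √a := Real.le_sqrt_of_sq_le (by linarith)
  have hsq : √a ^ 2 = a := Real.sq_sqrt ha0.le
  set h' := h / √a with hh'
  have hh'0 : 0 < h' := by positivity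
  have hhh : h = √a * h' := by rw [hh']; field_simp
  have hnorm : ∀ x, ‖h • p x‖ ^ 2 = a * ‖h' • p x‖ ^ 2 := fun x => by
    rw [hhh, mul_smul, norm_smul, mul_pow, Real.norm_eq_abs, sq_abs, hsq]
  have hiff : ∀ x t, ‖h • p x‖ ^ 2 ≤ t * a ↔ ‖h' • p x‖ ^ 2 ≤ t := fun x t => by
    rw [hnorm, mul_comm t]; exact mul_le_mul_iff_right₀ ha0
  set Z' := Z.filter fun x => ‖h' • p x‖ ^ 2 ≤ 1 with hZ'
  have hZ'mem : ∀ x, x ∈ Z' ↔ ‖h' • p x‖ ^ 2 ≤ 1 := fun x => by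
    rw [hZ', Finset.mem_filter, hZ]
    refine ⟨fun hx => hx.2, fun hx => ⟨?_, hx⟩⟩
    rw [hnorm]
    calc a * ‖h' • p x‖ ^ 2 ≤ 4 * 1 := by gcongr
      _ = 4 := by norm_num
  have hτh' : τ * h' ≤ δ₀ := by
    have : h' ≤ 2 * h := by
      rw [hh', div_le_iff₀ hsa]; nlinarith
    have := mul_le_mul_of_nonneg_left this (show 0 ≤ τ by linarith)
    linarith
  have hb : SchrodingerBound p n P (4 * M) h' u := fun x hx => by
    have hx4 : ‖h • p x‖ ^ 2 ≤ 4 := (hZ x).mp (Finset.mem_filter.mp ((hZ'mem x).mpr hx)).1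
    refine (hu x hx4).trans ?_
    have p1 : 0 ≤ ∑ i, |u (x + n i) - u x| := Finset.sum_nonneg fun _ _ => abs_nonneg _
    have p2 : 0 ≤ ∑ v ∈ P, |u (x + v)| := Finset.sum_nonneg fun _ _ => abs_nonneg _
    have q1 : h ≤ 4 * h' := by rw [hhh]; nlinarith
    have q2 : h ^ 2 ≤ 4 * h' ^ 2 := by rw [hhh, mul_pow, hsq]; gcongr
    calc _ ≤ M * (4 * h' * ∑ i, |u (x + n i) - u x| + 4 * h' ^ 2 * ∑ v ∈ P, |u (x + v)|) := by
          gcongr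
      _ = _ := by ring
  have key := hstep h' hh'0 τ hτ hτh' u Z' hZ'mem hb
  have hf : ∀ t ≤ (1 : ℝ), Z'.filter (fun x => ‖h' • p x‖ ^ 2 ≤ t)
      = Z.filter (fun x => ‖h • p x‖ ^ 2 ≤ t * a) := fun t ht => by
    ext x
    simp only [hZ', Finset.mem_filter, hiff]
    exact ⟨fun hx => ⟨hx.1.1, hx.2⟩, fun hx => ⟨⟨hx.1, hx.2.trans ht⟩, hx.2⟩⟩
  rw [hf _ (by norm_num), hf _ (by norm_num)] at key
  refine key.trans ?_
  have : ∑ x ∈ Z', u x ^ 2 ≤ ∑ x ∈ Z, u x ^ 2 :=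
    Finset.sum_le_sum_of_subset_of_nonneg (Finset.filter_subset _ _) fun _ _ _ => sq_nonneg _
  gcongr

/-- Insert the known inequality for t into the one-step inequality with a = 25t/17, which goes from
t to 20t/17. -/
theorem ThreeBalls.step (hF : IsSymmetricFrame p n ν) {P : Finset G} {M t : ℝ} (hM : 0 ≤ M)
    (ht : 17 / 100 ≤ t) (ht' : t ≤ 68 / 25) (h : ThreeBalls p n P M t) :
    ThreeBalls p n P M (20 / 17 * t) := by
  obtain ⟨C', hC', δ', hδ', τ', hτ', hstep⟩ := three_balls_step_scaled hF P hM
  obtain ⟨C, hC, c₁, hc₁, c₂, hc₂, δ₀, hδ₀, τ₀, hτ₀, hind⟩ := h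
  -- The known inequality is used at Kτ, so that its decay beats the growth of the step: c₂K = c₂ +
  -- 3/20, and 13/100 - 3/20 = -1/50.
  set K := 1 + 3 / 20 / c₂ with hK
  have hK1 : 1 ≤ K := by
    have : 0 ≤ 3 / 20 / c₂ := by positivity
    linarith
  refine ⟨C' * C + C', by positivity, 13 / 100 + c₁ * K, by positivity, 1 / 50, by norm_num,
    min (δ₀ / K) δ', by positivity, max τ₀ τ', le_max_of_le_left hτ₀, ?_⟩
  intro h hh τ hτ hτh u Z hZ hu
  have hττ₀ : τ₀ ≤ τ := (le_max_left _ _).trans hτ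
  have hττ' : τ' ≤ τ := (le_max_right _ _).trans hτ
  have hτ0 : 0 < τ := by linarith
  have h1 := hind h hh (K * τ) (hττ₀.trans (le_mul_of_one_le_left hτ0.le hK1)) (by
    have := hτh.trans (min_le_left _ _)
    rw [le_div_iff₀ (by linarith)] at this
    linarith) u Z hZ hu
  have h2 := hstep (25 / 17 * t) (by linarith) (by linarith) h hh τ hττ'
    (hτh.trans (min_le_right _ _)) u Z hZ hu
  rw [show 4 / 5 * (25 / 17 * t) = 20 / 17 * t by ring,
    show 17 / 25 * (25 / 17 * t) = t by ring] at h2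
  set N₀ := √(∑ x ∈ Z with ‖h • p x‖ ^ 2 ≤ 1 / 4, u x ^ 2)
  set N₁ := √(∑ x ∈ Z with ‖h • p x‖ ^ 2 ≤ t, u x ^ 2)
  set N₂ := √(∑ x ∈ Z, u x ^ 2)
  have hN₀ : 0 ≤ N₀ := Real.sqrt_nonneg _
  have hN₂ : 0 ≤ N₂ := Real.sqrt_nonneg _
  have e1 : Real.exp (13 / 100 * τ) * Real.exp (c₁ * (K * τ))
      = Real.exp ((13 / 100 + c₁ * K) * τ) := by rw [← Real.exp_add]; ring_nf
  have e2 : Real.exp (13 / 100 * τ) * Real.exp (-c₂ * (K * τ)) ≤ Real.exp (-(1 / 50) * τ) := by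
    rw [← Real.exp_add]
    apply Real.exp_le_exp.mpr
    have : c₂ * K = c₂ + 3 / 20 := by rw [hK]; field_simp
    rw [show -c₂ * (K * τ) = -(c₂ * K * τ) by ring, this]
    nlinarith
  calc _ ≤ C' * (Real.exp (13 / 100 * τ) * N₁ + Real.exp (-(1 / 50) * τ) * N₂) := h2
    _ ≤ C' * (Real.exp (13 / 100 * τ) * (C * (Real.exp (c₁ * (K * τ)) * N₀
        + Real.exp (-c₂ * (K * τ)) * N₂)) + Real.exp (-(1 / 50) * τ) * N₂) := by gcongr
    _ = C' * (C * ((Real.exp (13 / 100 * τ) * Real.exp (c₁ * (K * τ))) * N₀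
        + (Real.exp (13 / 100 * τ) * Real.exp (-c₂ * (K * τ))) * N₂)
        + Real.exp (-(1 / 50) * τ) * N₂) := by ring
    _ ≤ C' * (C * (Real.exp ((13 / 100 + c₁ * K) * τ) * N₀
        + Real.exp (-(1 / 50) * τ) * N₂) + Real.exp (-(1 / 50) * τ) * N₂) := by
        rw [e1]; gcongr
    _ = (C' * C + C') * (Real.exp ((13 / 100 + c₁ * K) * τ) * N₀
        + Real.exp (-(1 / 50) * τ) * N₂) - C' * (Real.exp ((13 / 100 + c₁ * K) * τ) * N₀) := by ring
    _ ≤ _ := sub_le_self _ (by positivity)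

theorem ThreeBalls.mono {P : Finset G} {M t t' : ℝ} (h : ThreeBalls p n P M t) (ht : t' ≤ t) :
    ThreeBalls p n P M t' := by
  obtain ⟨C, hC, c₁, hc₁, c₂, hc₂, δ₀, hδ₀, τ₀, hτ₀, hind⟩ := h
  refine ⟨C, hC, c₁, hc₁, c₂, hc₂, δ₀, hδ₀, τ₀, hτ₀, fun h hh τ hτ hτh u Z hZ hu =>
    le_trans (Real.sqrt_le_sqrt ?_) (hind h hh τ hτ hτh u Z hZ hu)⟩
  refine Finset.sum_le_sum_of_subset_of_nonneg (fun x hx => ?_) fun _ _ _ => sq_nonneg _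
  rw [Finset.mem_filter] at hx ⊢
  exact ⟨hx.1, hx.2.trans ht⟩

theorem threeBalls_one (hF : IsSymmetricFrame p n ν) (P : Finset G) {M : ℝ} (hM : 0 ≤ M) :
    ThreeBalls p n P M 1 := by
  have h0 : ThreeBalls p n P M (1 / 4) := by
    refine ⟨1, one_pos, 1, one_pos, 1, one_pos, 1, one_pos, 1, le_rfl, ?_⟩
    intro h hh τ hτ _ u Z _ _
    have h1 : 1 ≤ Real.exp (1 * τ) := Real.one_le_exp (by linarith)
    have h2 := mul_nonneg (Real.exp_pos (-1 * τ)).le (Real.sqrt_nonneg (∑ x ∈ Z, u x ^ 2))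
    have h3 := le_mul_of_one_le_left
      (Real.sqrt_nonneg (∑ x ∈ Z with ‖h • p x‖ ^ 2 ≤ 1 / 4, u x ^ 2)) h1
    linarith
  -- Nine steps suffice because (20/17)⁹ ≥ 4; every intermediate radius stays in the range required
  -- by the step.
  have hm : ∀ m ≤ 9, ThreeBalls p n P M ((20 / 17) ^ m * (1 / 4)) := fun m => by
    induction m with
    | zero => intro _; simpa using h0
    | succ m ih =>
      intro hm
      have h1 : (1 : ℝ) ≤ (20 / 17) ^ m := one_le_pow₀ (by norm_num)
      have h2 : (20 / 17 : ℝ) ^ m ≤ (20 / 17) ^ 8 := pow_le_pow_right₀ (by norm_num) (by omega)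
      have h3 : (20 / 17 : ℝ) ^ 8 ≤ 10 := by norm_num
      have := (ih (by omega)).step hF hM (by linarith) (by linarith)
      rwa [← mul_assoc, ← pow_succ'] at this
  exact (hm 9 le_rfl).mono (by norm_num)

end Chain

/-- Optimisation in the parameter `τ`. -/
theorem le_rpow_mul_rpow_add_of_forall_exp {a m b C c₁ c₂ τ₀ T : ℝ} (ha : 0 ≤ a) (ham : a ≤ m)
    (hmb : m ≤ b) (hC : 0 < C) (hc₁ : 0 < c₁) (hc₂ : 0 < c₂) (hτ₀ : 0 < τ₀) (hT : 2 * τ₀ < T)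
    (h : ∀ τ, τ₀ < τ → τ < T → m ≤ C * (Real.exp (c₁ * τ) * a + Real.exp (-c₂ * τ) * b)) :
    m ≤ (2 * C + Real.exp (c₂ * τ₀)) * (a ^ (c₂ / (c₁ + c₂)) * b ^ (1 - c₂ / (c₁ + c₂))
      + Real.exp (-(c₂ * (T / 2))) * b) := by
  have hc : 0 < c₁ + c₂ := by positivity
  have hα : 0 < c₂ / (c₁ + c₂) := by positivity
  have hb : 0 ≤ b := by linarith
  have hX : 0 ≤ a ^ (c₂ / (c₁ + c₂)) * b ^ (1 - c₂ / (c₁ + c₂)) :=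
    mul_nonneg (Real.rpow_nonneg ha _) (Real.rpow_nonneg hb _)
  have hY : 0 ≤ Real.exp (-(c₂ * (T / 2))) * b := mul_nonneg (Real.exp_pos _).le hb
  have hE := Real.exp_pos (c₂ * τ₀)
  have hCX := mul_nonneg hC.le hX
  have hCY := mul_nonneg hC.le hY
  have hEX := mul_nonneg hE.le hX
  have hEY := mul_nonneg hE.le hY
  have hhalf := h (T / 2) (by linarith) (by linarith)
  rw [neg_mul] at hhalf
  rcases ha.eq_or_lt with ha0 | ha0
  · rw [← ha0, mul_zero, zero_add] at hhalf
    linarith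
  obtain ⟨A, rfl⟩ : ∃ A, a = Real.exp A := ⟨Real.log a, (Real.exp_log ha0).symm⟩
  obtain ⟨B, rfl⟩ : ∃ B, b = Real.exp B := ⟨Real.log b, (Real.exp_log (by linarith)).symm⟩
  have eX : Real.exp A ^ (c₂ / (c₁ + c₂)) * Real.exp B ^ (1 - c₂ / (c₁ + c₂))
      = Real.exp ((c₂ * A + c₁ * B) / (c₁ + c₂)) := by
    rw [← Real.exp_mul, ← Real.exp_mul, ← Real.exp_add]
    congr 1; field_simp; ring
  rw [eX] at hX hCX hEX ⊢
  -- The two exponentials balance at τ = (B - A)/(c₁ + c₂). Below the admissible range a and b are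
  -- comparable and m ≤ b suffices; above T/2 the choice τ = T/2 leaves the b term dominant.
  by_cases h1 : B - A ≤ (c₁ + c₂) * τ₀
  · have : Real.exp B ≤ Real.exp (c₂ * τ₀) * Real.exp ((c₂ * A + c₁ * B) / (c₁ + c₂)) := by
      rw [← Real.exp_add]
      apply Real.exp_le_exp.mpr
      rw [← sub_le_iff_le_add', le_div_iff₀ hc]
      nlinarith
    linarith
  · by_cases h2 : (c₁ + c₂) * (T / 2) ≤ B - A
    · have : Real.exp (c₁ * (T / 2)) * Real.exp A ≤ Real.exp (-(c₂ * (T / 2))) * Real.exp B := by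
        rw [← Real.exp_add, ← Real.exp_add]
        apply Real.exp_le_exp.mpr
        linarith
      have := mul_le_mul_of_nonneg_left this hC.le
      linarith
    · push Not at h1 h2
      have hτ1 : τ₀ < (B - A) / (c₁ + c₂) := by rw [lt_div_iff₀ hc]; linarith
      have hτ2 : (B - A) / (c₁ + c₂) < T / 2 := by rw [div_lt_iff₀ hc]; linarith
      have := h ((B - A) / (c₁ + c₂)) hτ1 (by linarith)
      rw [← Real.exp_add, ← Real.exp_add,
        show c₁ * ((B - A) / (c₁ + c₂)) + A = (c₂ * A + c₁ * B) / (c₁ + c₂) by field_simp; ring,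
        show -c₂ * ((B - A) / (c₁ + c₂)) + B = (c₂ * A + c₁ * B) / (c₁ + c₂) by
          field_simp; ring] at this
      linarith

/-! ### The tight frame attached to the graph. -/

section Frame

open scoped InnerProductSpace

namespace OnePointPeriodicGraph

variable {d k : ℕ} {Γ : OnePointPeriodicGraph d} {e : Fin k → Γ.lattice}

/-- Connectedness: a linear functional that vanishes on the edges is zero. -/
theorem IsEdgeSystem.eq_zero_of_dotProduct (he : IsEdgeSystem e) {v : Fin d → ℝ}
    (hv : ∀ j, (e j : Fin d → ℝ) ⬝ᵥ v = 0) : v = 0 := by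
  have hL : ∀ x : Γ.lattice, (x : Fin d → ℝ) ⬝ᵥ v = 0 := by
    intro x
    obtain ⟨w⟩ := Γ.connected.preconnected x 0
    generalize hz : (0 : Γ.lattice) = z at w
    induction w with
    | nil => subst hz; simp
    | cons hadj _ ih =>
      have := ih hz
      obtain ⟨j, hj | hj⟩ := (he.adj_iff _ _).1 hadj
      · rw [hj] at this
        simpa [add_dotProduct, hv j] using this
      · rw [hj] at this
        simpa [sub_dotProduct, hv j] using this
  have hall : ∀ w : Fin d → ℝ, w ⬝ᵥ v = 0 := by
    intro w
    rw [← Γ.basis.sum_repr w, sum_dotProduct]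
    refine Finset.sum_eq_zero fun i _ => ?_
    rw [smul_dotProduct, hL ⟨Γ.basis i, Submodule.subset_span ⟨i, rfl⟩⟩, smul_zero]
  exact dotProduct_self_eq_zero.1 (hall v)

/-- The matrix `EᵀE`. -/
def gram (e : Fin k → Γ.lattice) : Matrix (Fin d) (Fin d) ℝ := (edgeMatrix e)ᵀ * edgeMatrix e

theorem edgeMatrix_mulVec (e : Fin k → Γ.lattice) (v : Fin d → ℝ) (j : Fin k) :
    (edgeMatrix e *ᵥ v) j = (e j : Fin d → ℝ) ⬝ᵥ v := rfl

theorem IsEdgeSystem.isUnit_det_gram (he : IsEdgeSystem e) : IsUnit (gram e).det := by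
  refine isUnit_iff_ne_zero.2 fun h => ?_
  obtain ⟨v, hv0, hv⟩ := Matrix.exists_mulVec_eq_zero_iff.2 h
  refine hv0 (he.eq_zero_of_dotProduct fun j => ?_)
  have h1 : (edgeMatrix e *ᵥ v) ⬝ᵥ (edgeMatrix e *ᵥ v) = 0 := by
    rw [Matrix.dotProduct_mulVec, ← Matrix.mulVec_transpose, Matrix.mulVec_mulVec, ← gram, hv,
      zero_dotProduct]
  rw [← edgeMatrix_mulVec, dotProduct_self_eq_zero.1 h1]
  rfl

/-- The linear embedding `x ↦ E (EᵀE)⁻¹ x`, isometric for the graph norm. -/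
noncomputable def frameMap (e : Fin k → Γ.lattice) : Γ.lattice →+ EuclideanSpace ℝ (Fin k) :=
  AddMonoidHom.mk' (fun x => WithLp.toLp 2 ((edgeMatrix e * (gram e)⁻¹) *ᵥ (x : Fin d → ℝ)))
    fun x y => by simp [Matrix.mulVec_add]

theorem frameMap_apply (e : Fin k → Γ.lattice) (x : Γ.lattice) :
    frameMap e x = WithLp.toLp 2 ((edgeMatrix e * (gram e)⁻¹) *ᵥ (x : Fin d → ℝ)) := rfl

theorem IsEdgeSystem.transpose_mulVec_frameMap (he : IsEdgeSystem e) (x : Γ.lattice) :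
    (edgeMatrix e)ᵀ *ᵥ (frameMap e x).ofLp = (x : Fin d → ℝ) := by
  rw [frameMap_apply]
  change (edgeMatrix e)ᵀ *ᵥ ((edgeMatrix e * (gram e)⁻¹) *ᵥ (x : Fin d → ℝ)) = _
  rw [Matrix.mulVec_mulVec, ← Matrix.mul_assoc, ← gram, Matrix.mul_nonsing_inv _ he.isUnit_det_gram,
    Matrix.one_mulVec]

theorem IsEdgeSystem.inner_frameMap (he : IsEdgeSystem e) (x y : Γ.lattice) :
    ⟪frameMap e x, frameMap e y⟫_ℝ = (x : Fin d → ℝ) ⬝ᵥ ((gram e)⁻¹ *ᵥ (y : Fin d → ℝ)) := by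
  conv_rhs => rw [← he.transpose_mulVec_frameMap x]
  rw [Matrix.mulVec_transpose, ← Matrix.dotProduct_mulVec, Matrix.mulVec_mulVec]
  rw [EuclideanSpace.inner_eq_star_dotProduct, frameMap_apply e y, dotProduct_comm]
  rfl

/-- The coordinates of the embedding are themselves the frame coefficients; this makes the frame a
Parseval frame. -/
theorem IsEdgeSystem.inner_frameMap_edge (he : IsEdgeSystem e) (x : Γ.lattice) (j : Fin k) :
    ⟪frameMap e x, frameMap e (e j)⟫_ℝ = frameMap e x j := by
  rw [real_inner_comm, he.inner_frameMap, frameMap_apply]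
  change _ = ((edgeMatrix e * (gram e)⁻¹) *ᵥ (x : Fin d → ℝ)) j
  rw [← Matrix.mulVec_mulVec, edgeMatrix_mulVec]

/-- Since Eᵀ inverts the embedding, x = Σ_j (φx)_j e_j with φ = E(EᵀE)⁻¹; applying φ gives the
reproducing formula. -/
theorem IsEdgeSystem.sum_frameMap_smul (he : IsEdgeSystem e) (x : Γ.lattice) :
    ∑ j, ⟪frameMap e x, frameMap e (e j)⟫_ℝ • frameMap e (e j) = frameMap e x := by
  have h1 : ∑ j, (frameMap e x j) • (e j : Fin d → ℝ) = x := by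
    conv_rhs => rw [← he.transpose_mulVec_frameMap x]
    ext i
    simp [Matrix.mulVec, dotProduct, edgeMatrix, mul_comm]
  simp_rw [he.inner_frameMap_edge x]
  conv_rhs => rw [frameMap_apply, ← h1]
  rw [Matrix.mulVec_sum, WithLp.toLp_sum]
  simp_rw [Matrix.mulVec_smul]
  rfl

/-- The neighbours of the origin. -/
def neighborVec (e : Fin k → Γ.lattice) : Fin k ⊕ Fin k → Γ.lattice :=
  Sum.elim e fun j => -e j

theorem IsEdgeSystem.isSymmetricFrame (he : IsEdgeSystem e) :
    IsSymmetricFrame (frameMap e) (neighborVec e) (Equiv.sumComm (Fin k) (Fin k)) where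
  neg := by rintro (j | j) <;> simp [neighborVec]
  frame x := by
    simp only [Fintype.sum_sum_type, neighborVec, Sum.elim_inl, Sum.elim_inr, map_neg,
      inner_neg_right, smul_neg, neg_smul, neg_neg, he.sum_frameMap_smul, two_smul]
  norm_le := by
    -- Here ‖φe_j‖² is the j-th coordinate of φe_j, hence at most ‖φe_j‖.
    have key : ∀ j, ‖frameMap e (e j)‖ ≤ 1 := by
      intro j
      have h1 := he.inner_frameMap_edge (e j) j
      have h2 := PiLp.norm_apply_le (frameMap e (e j)) j
      rw [real_inner_self_eq_norm_sq] at h1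
      rw [← h1, Real.norm_of_nonneg (sq_nonneg _)] at h2
      by_contra! hc
      nlinarith
    rintro (j | j) <;> simp [neighborVec, key]

theorem IsEdgeSystem.graphNorm_smul (he : IsEdgeSystem e) (h : ℝ) (x : Γ.lattice) :
    graphNorm e (h • (x : Fin d → ℝ)) = ‖h • frameMap e x‖ := by
  rw [norm_smul, graphNorm, ← gram, Matrix.mulVec_smul, dotProduct_smul, smul_dotProduct,
    ← he.inner_frameMap, real_inner_self_eq_norm_sq, smul_eq_mul, smul_eq_mul, ← mul_assoc,
    ← sq, ← mul_pow, Real.sqrt_sq_eq_abs, abs_mul, abs_norm, Real.norm_eq_abs]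

theorem IsEdgeSystem.scale_mem_ball (he : IsEdgeSystem e) (h : ℝ) (x : Γ.lattice) {r : ℝ}
    (hr : 0 ≤ r) : (Γ.scale h x : Fin d → ℝ) ∈ ball e r ↔ ‖h • frameMap e x‖ ^ 2 ≤ r ^ 2 := by
  rw [sq_le_sq₀ (norm_nonneg _) hr, ← he.graphNorm_smul]
  rfl

/-- Through the left inverse Eᵀ these points lie in a bounded subset of ℝᵈ, which meets the lattice
in a finite set. -/
theorem IsEdgeSystem.finite_ball (he : IsEdgeSystem e) {h : ℝ} (hh : h ≠ 0) (r : ℝ) :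
    {x : Γ.lattice | ‖h • frameMap e x‖ ^ 2 ≤ r}.Finite := by
  have hc : Continuous fun y : EuclideanSpace ℝ (Fin k) => (edgeMatrix e)ᵀ *ᵥ y.ofLp := by
    fun_prop
  have hb : Bornology.IsBounded
      ((fun y : EuclideanSpace ℝ (Fin k) => (edgeMatrix e)ᵀ *ᵥ y.ofLp) ''
        Metric.closedBall 0 (√r / |h|)) :=
    ((isCompact_closedBall _ _).image hc).isBounded
  have hf := ZSpan.setFinite_inter Γ.basis hb
  refine Set.Finite.of_finite_image (f := fun x : Γ.lattice => (x : Fin d → ℝ)) (hf.subset ?_)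
    Subtype.val_injective.injOn
  rintro _ ⟨x, hx, rfl⟩
  refine ⟨⟨frameMap e x, ?_, he.transpose_mulVec_frameMap x⟩, x.2⟩
  rw [mem_closedBall_zero_iff, le_div_iff₀ (abs_pos.2 hh), mul_comm, ← Real.norm_eq_abs,
    ← norm_smul]
  exact Real.le_sqrt_of_sq_le hx

end OnePointPeriodicGraph

end Frame

/-! ### From the scaled graph to the abstract setting. -/

section Application

namespace OnePointPeriodicGraph

variable {d k : ℕ} {Γ : OnePointPeriodicGraph d} {e : Fin k → Γ.lattice}

theorem scale_add (h : ℝ) (a b : Γ.lattice) : Γ.scale h (a + b) = Γ.scale h a + Γ.scale h b :=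
  Subtype.ext (smul_add h (a : Fin d → ℝ) b)

theorem scale_sub (h : ℝ) (a b : Γ.lattice) : Γ.scale h (a - b) = Γ.scale h a - Γ.scale h b :=
  Subtype.ext (smul_sub h (a : Fin d → ℝ) b)

theorem scale_bijective {h : ℝ} (hh : h ≠ 0) : Function.Bijective (Γ.scale h) := by
  constructor
  · intro a b hab
    exact Subtype.ext (smul_right_injective (Fin d → ℝ) hh (congrArg Subtype.val hab))
  · rintro ⟨x, hx⟩
    obtain ⟨y, hy, rfl⟩ := Submodule.mem_smul_pointwise_iff_exists _ _ _ |>.1 hx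
    exact ⟨⟨y, hy⟩, rfl⟩

theorem IsEdgeSystem.neighborVec_injective (he : IsEdgeSystem e) :
    Function.Injective (neighborVec e) := by
  have h0 : ∀ j, e j ≠ -e j := by
    intro j hj
    have h1 : e j = 0 := Subtype.ext (self_eq_neg.1 (congrArg Subtype.val hj))
    exact Γ.graph.loopless.irrefl 0 ((he.adj_iff 0 0).2 ⟨j, Or.inl (by simp [h1])⟩)
  have h1 : Function.Injective e := fun i j hij => by
    by_contra hne
    exact (he.ne i j hne).1 hij
  have h2 : ∀ i j, e i ≠ -e j := fun i j hij => by
    by_cases hne : i = j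
    · subst hne
      exact h0 i hij
    · exact (he.ne i j hne).2 hij
  rintro (i | i) (j | j) hij
  · rw [h1 hij]
  · exact absurd hij (h2 i j)
  · exact absurd hij.symm (h2 j i)
  · rw [h1 (neg_injective hij)]

theorem IsEdgeSystem.laplacian_scale (he : IsEdgeSystem e) {h : ℝ} (hh : h ≠ 0)
    (f : Γ.vertices h → ℝ) (a : Γ.lattice) :
    Γ.laplacian h f (Γ.scale h a)
      = ∑ i, (f (Γ.scale h (a + neighborVec e i)) - f (Γ.scale h a)) := by
  have hset : {y | Γ.ScaledAdj h (Γ.scale h a) y}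
      = Set.range fun i => Γ.scale h (a + neighborVec e i) := by
    ext y
    constructor
    · rintro ⟨b, c, hbc, hab, rfl⟩
      obtain rfl := (scale_bijective hh).1 hab
      obtain ⟨j, rfl | rfl⟩ := (he.adj_iff _ _).1 hbc
      · exact ⟨Sum.inl j, rfl⟩
      · exact ⟨Sum.inr j, by simp [neighborVec, sub_eq_add_neg]⟩
    · rintro ⟨j | j, rfl⟩
      · exact ⟨a, a + e j, (he.adj_iff _ _).2 ⟨j, Or.inl rfl⟩, rfl, rfl⟩
      · exact ⟨a, a + -e j, (he.adj_iff _ _).2 ⟨j, Or.inr (sub_eq_add_neg _ _).symm⟩, rfl, rfl⟩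
  rw [laplacian, hset, finsum_mem_range, finsum_eq_sum_of_fintype]
  exact (scale_bijective hh).1.comp ((add_right_injective a).comp he.neighborVec_injective)

theorem finite_pathVectors (e : Fin k → Γ.lattice) (L : ℕ) : (pathVectors e L).Finite := by
  refine ((Set.finite_Icc (fun _ : Fin k => -(L : ℤ)) fun _ => (L : ℤ)).image
    fun α => ∑ j, α j • e j).subset ?_
  rintro _ ⟨α, hα, rfl⟩
  refine ⟨α, ?_, rfl⟩
  have h1 : ∀ j, |α j| ≤ (L : ℤ) := fun j =>
    (Finset.single_le_sum (f := fun j => |α j|) (fun i _ => abs_nonneg _)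
      (Finset.mem_univ j)).trans hα
  exact ⟨fun j => (abs_le.1 (h1 j)).1, fun j => (abs_le.1 (h1 j)).2⟩

/-- Solve the equation for the Laplacian after multiplying by h²; each symmetric difference is a
difference of two edge differences at the same vertex. -/
theorem IsEdgeSystem.abs_laplacian_le (he : IsEdgeSystem e) {L : ℕ} {M h : ℝ} (hM : 0 ≤ M)
    (hh : 0 < h) {B : Fin k → Γ.vertices h → ℝ} {W : Γ.lattice → Γ.vertices h → ℝ}
    (hB : ∀ j x, |B j x| ≤ M) (hW : ∀ v ∈ pathVectors e L, ∀ x, |W v x| ≤ M)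
    {u : Γ.vertices h → ℝ} {a : Γ.lattice} (hu : schrodinger e L h B W u (Γ.scale h a) = 0) :
    |∑ i, (u (Γ.scale h (a + neighborVec e i)) - u (Γ.scale h a))|
      ≤ M * (h * ∑ i, |u (Γ.scale h (a + neighborVec e i)) - u (Γ.scale h a)|
        + h ^ 2 * ∑ v ∈ (finite_pathVectors e L).toFinset, |u (Γ.scale h (a + v))|) := by
  rw [schrodinger, he.laplacian_scale hh.ne', finsum_mem_eq_finite_toFinset_sum _
    (finite_pathVectors e L)] at hu
  simp only [← scale_add] at hu
  set S := ∑ i, (u (Γ.scale h (a + neighborVec e i)) - u (Γ.scale h a)) with hS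
  have h1 : |∑ j, B j (Γ.scale h a) * centralDiff e h j u (Γ.scale h a)|
      ≤ M * ∑ i, |u (Γ.scale h (a + neighborVec e i)) - u (Γ.scale h a)| := by
    rw [Fintype.sum_sum_type, ← Finset.sum_add_distrib, Finset.mul_sum]
    refine (Finset.abs_sum_le_sum_abs _ _).trans (Finset.sum_le_sum fun j _ => ?_)
    rw [abs_mul]
    refine mul_le_mul (hB _ _) ?_ (abs_nonneg _) hM
    rw [centralDiff, ← scale_add, ← scale_sub, sub_eq_add_neg a]
    simp only [neighborVec, Sum.elim_inl, Sum.elim_inr]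
    rw [show u (Γ.scale h (a + e j)) - u (Γ.scale h (a + -e j))
      = (u (Γ.scale h (a + e j)) - u (Γ.scale h a))
        - (u (Γ.scale h (a + -e j)) - u (Γ.scale h a)) by ring]
    exact abs_sub _ _
  have h2 : |∑ v ∈ (finite_pathVectors e L).toFinset,
        W v (Γ.scale h (a + v)) * u (Γ.scale h (a + v))|
      ≤ M * ∑ v ∈ (finite_pathVectors e L).toFinset, |u (Γ.scale h (a + v))| := by
    rw [Finset.mul_sum]
    refine (Finset.abs_sum_le_sum_abs _ _).trans (Finset.sum_le_sum fun v hv => ?_)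
    rw [abs_mul]
    exact mul_le_mul_of_nonneg_right (hW v ((finite_pathVectors e L).mem_toFinset.1 hv) _)
      (abs_nonneg _)
  set X := ∑ j, B j (Γ.scale h a) * centralDiff e h j u (Γ.scale h a)
  set Y := ∑ v ∈ (finite_pathVectors e L).toFinset,
        W v (Γ.scale h (a + v)) * u (Γ.scale h (a + v))
  have h3 : S = -(h * X + h ^ 2 * Y) := by
    field_simp at hu
    linear_combination hu
  rw [h3, abs_neg]
  refine (abs_add_le _ _).trans ?_
  rw [abs_mul, abs_mul, abs_of_pos hh, abs_of_pos (pow_pos hh 2)]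
  have h4 := mul_le_mul_of_nonneg_left h1 hh.le
  have h5 := mul_le_mul_of_nonneg_left h2 (sq_nonneg h)
  linarith

theorem IsEdgeSystem.l2Norm_eq (he : IsEdgeSystem e) {h : ℝ} (hh : h ≠ 0) {r t : ℝ} (hr : 0 ≤ r)
    (hrt : r ^ 2 = t) {Z : Finset Γ.lattice}
    (hZ : ∀ x, ‖h • frameMap e x‖ ^ 2 ≤ t → x ∈ Z) (u : Γ.vertices h → ℝ) :
    l2Norm e h r u = √(∑ x ∈ Z with ‖h • frameMap e x‖ ^ 2 ≤ t, u (Γ.scale h x) ^ 2) := by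
  subst hrt
  rw [l2Norm]
  congr 1
  have hm : ∀ x, Γ.scale h x ∈ {y : Γ.vertices h | (y : Fin d → ℝ) ∈ ball e r} ↔
    ‖h • frameMap e x‖ ^ 2 ≤ r ^ 2 := fun x => he.scale_mem_ball h x hr
  refine (tsum_subtype {y : Γ.vertices h | (y : Fin d → ℝ) ∈ ball e r} fun x => u x ^ 2).trans ?_
  rw [← (Equiv.ofBijective _ (scale_bijective hh)).tsum_eq, Finset.sum_filter,
    tsum_eq_sum (s := Z)]
  · refine Finset.sum_congr rfl fun x _ => ?_
    rw [Equiv.ofBijective_apply]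
    split_ifs with hx
    · rw [Set.indicator_of_mem ((hm x).2 hx)]
    · rw [Set.indicator_of_notMem fun hc => hx ((hm x).1 hc)]
  · intro x hx
    rw [Equiv.ofBijective_apply, Set.indicator_of_notMem fun hc => hx (hZ x ((hm x).1 hc))]

theorem IsEdgeSystem.exists_three_balls (he : IsEdgeSystem e) (L : ℕ) (M : ℝ) :
    ∃ C > (0 : ℝ), ∃ c₁ > (0 : ℝ), ∃ c₂ > (0 : ℝ), ∃ δ₀ > (0 : ℝ), ∃ τ₀ ≥ (1 : ℝ),
      ∀ h > (0 : ℝ), ∀ τ ≥ τ₀, τ * h ≤ δ₀ →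
      ∀ (B : Fin k → Γ.vertices h → ℝ) (W : Γ.lattice → Γ.vertices h → ℝ),
      (∀ j x, |B j x| ≤ M) → (∀ v ∈ pathVectors e L, ∀ x, |W v x| ≤ M) →
      ∀ u : Γ.vertices h → ℝ,
      (∀ x : Γ.vertices h, (x : Fin d → ℝ) ∈ ball e 4 → schrodinger e L h B W u x = 0) →
      l2Norm e h 1 u ≤ C * (Real.exp (c₁ * τ) * l2Norm e h (1 / 2) u
          + Real.exp (-c₂ * τ) * l2Norm e h 2 u) := by
  obtain ⟨C, hC, c₁, hc₁, c₂, hc₂, δ₀, hδ₀, τ₀, hτ₀, H⟩ :=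
    threeBalls_one he.isSymmetricFrame (finite_pathVectors e L).toFinset (le_max_right M 0)
  refine ⟨C, hC, c₁, hc₁, c₂, hc₂, δ₀, hδ₀, τ₀, hτ₀, fun h hh τ hτ hτh B W hB hW u hu => ?_⟩
  have hZ : ∀ x, x ∈ (he.finite_ball hh.ne' 4).toFinset ↔ ‖h • frameMap e x‖ ^ 2 ≤ 4 := fun x => by
    simp
  have h1 := H h hh τ hτ hτh (fun x => u (Γ.scale h x)) _ hZ fun x hx =>
    he.abs_laplacian_le (le_max_right M 0) hh (fun j y => (hB j y).trans (le_max_left _ _))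
      (fun v hv y => (hW v hv y).trans (le_max_left _ _))
      -- Only the equation on B_2 is used. Passing to max M 0 above covers negative M.
      (hu _ ((he.scale_mem_ball h x (by norm_num)).2 (hx.trans (by norm_num))))
  rw [he.l2Norm_eq hh.ne' (t := 1) zero_le_one (by norm_num)
      (fun x hx => (hZ x).2 (hx.trans (by norm_num))),
    he.l2Norm_eq hh.ne' (t := 1 / 4) (by norm_num) (by norm_num)
      (fun x hx => (hZ x).2 (hx.trans (by norm_num))),
    he.l2Norm_eq hh.ne' (t := 4) zero_le_two (by norm_num) (fun x hx => (hZ x).2 hx),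
    Finset.filter_true_of_mem fun x hx => (hZ x).1 hx]
  exact h1

theorem IsEdgeSystem.l2Norm_mono (he : IsEdgeSystem e) {h : ℝ} (hh : h ≠ 0) {r s : ℝ} (hr : 0 ≤ r)
    (hrs : r ≤ s) (u : Γ.vertices h → ℝ) : l2Norm e h r u ≤ l2Norm e h s u := by
  have hZ : ∀ x, ‖h • frameMap e x‖ ^ 2 ≤ s ^ 2 → x ∈ (he.finite_ball hh (s ^ 2)).toFinset :=
    fun x hx => by simpa using hx
  have hsq : r ^ 2 ≤ s ^ 2 := pow_le_pow_left₀ hr hrs 2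
  rw [he.l2Norm_eq hh hr rfl (fun x hx => hZ x (hx.trans hsq)),
    he.l2Norm_eq hh (hr.trans hrs) rfl hZ]
  exact Real.sqrt_le_sqrt (Finset.sum_le_sum_of_subset_of_nonneg
    (Finset.monotone_filter_right _ fun x _ hx => hx.trans hsq) fun _ _ _ => sq_nonneg _)

end OnePointPeriodicGraph

end Application

/-! ### The two inequalities. -/

theorem theorem4p1 {d k : ℕ} (Γ : OnePointPeriodicGraph d) (e : Fin k → Γ.lattice)
    (he : OnePointPeriodicGraph.IsEdgeSystem e) (L : ℕ) (M : ℝ) :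
    (∃ h₀ ∈ Set.Ioo (0 : ℝ) 1, ∃ δ₀ ∈ Set.Ioo (0 : ℝ) 1, ∃ c₁ > (0 : ℝ), ∃ c₂ > (0 : ℝ),
      ∃ τ₀ > (1 : ℝ), ∃ C > (0 : ℝ), ∀ h ∈ Set.Ioo (0 : ℝ) h₀, ∀ τ ∈ Set.Ioo τ₀ (δ₀ * h⁻¹),
      ∀ (B : Fin k → Γ.vertices h → ℝ) (V : Γ.lattice → Γ.vertices h → ℝ),
      (∀ j x, |B j x| ≤ M) →
      (∀ v ∈ OnePointPeriodicGraph.pathVectors e L, ∀ x, |V v x| ≤ M) →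
      ∀ u : Γ.vertices h → ℝ,
      (∀ x : Γ.vertices h, (x : Fin d → ℝ) ∈ OnePointPeriodicGraph.ball e 4 →
        OnePointPeriodicGraph.schrodinger e L h B V u x = 0) →
      OnePointPeriodicGraph.l2Norm e h 1 u ≤
        C * (Real.exp (c₁ * τ) * OnePointPeriodicGraph.l2Norm e h (1 / 2) u
          + Real.exp (-c₂ * τ) * OnePointPeriodicGraph.l2Norm e h 2 u)) ∧
    (∃ α ∈ Set.Ioo (0 : ℝ) 1, ∃ c₀ > (0 : ℝ), ∃ h₀ ∈ Set.Ioo (0 : ℝ) 1, ∃ D > (1 : ℝ),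
      ∀ h ∈ Set.Ioo (0 : ℝ) h₀,
      ∀ (B : Fin k → Γ.vertices h → ℝ) (V : Γ.lattice → Γ.vertices h → ℝ),
      (∀ j x, |B j x| ≤ M) →
      (∀ v ∈ OnePointPeriodicGraph.pathVectors e L, ∀ x, |V v x| ≤ M) →
      ∀ u : Γ.vertices h → ℝ,
      (∀ x : Γ.vertices h, (x : Fin d → ℝ) ∈ OnePointPeriodicGraph.ball e 4 →
        OnePointPeriodicGraph.schrodinger e L h B V u x = 0) →
      OnePointPeriodicGraph.l2Norm e h 1 u ≤
        D * (OnePointPeriodicGraph.l2Norm e h (1 / 2) u ^ α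
            * OnePointPeriodicGraph.l2Norm e h 2 u ^ (1 - α)
          + Real.exp (-c₀ * h⁻¹) * OnePointPeriodicGraph.l2Norm e h 2 u)) := by

  obtain ⟨C, hC, c₁, hc₁, c₂, hc₂, δ, hδ, τ₀, hτ₀, H⟩ := he.exists_three_balls L M
  constructor
  · refine ⟨1 / 2, by norm_num, min δ (1 / 2), ⟨lt_min hδ (by norm_num),
      (min_le_right _ _).trans_lt (by norm_num)⟩, c₁, hc₁, c₂, hc₂, τ₀ + 1, by linarith, C, hC,
      fun h hh τ hτ => H h hh.1 τ (by linarith [hτ.1]) ?_⟩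
    have h1 := mul_le_mul_of_nonneg_right hτ.2.le hh.1.le
    rw [inv_mul_cancel_right₀ hh.1.ne'] at h1
    exact h1.trans (min_le_left _ _)
  · have hα : 0 < c₂ / (c₁ + c₂) := by positivity
    have hα1 : c₂ / (c₁ + c₂) < 1 := (div_lt_one (by positivity)).2 (by linarith)
    have hD : 1 < 2 * C + Real.exp (c₂ * τ₀) := by
      have := Real.one_le_exp (x := c₂ * τ₀) (by positivity)
      linarith
    have hq : 0 < δ / (2 * τ₀) := by positivity
    -- The exponent is the balance point of the two exponentials, c₂δ/2 comes from τ = δ/(2h), and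
    -- h₀ ensures 2τ₀ < δ/h, so that this τ is admissible.
    refine ⟨c₂ / (c₁ + c₂), ⟨hα, hα1⟩, c₂ * δ / 2, by positivity, min (1 / 2) (δ / (2 * τ₀)),
      ⟨lt_min (by norm_num) hq, (min_le_left _ _).trans_lt (by norm_num)⟩, _, hD,
      fun h hh B V hB hV u hu => ?_⟩
    have h1 : h * (2 * τ₀) < δ :=
      (lt_div_iff₀ (by positivity)).1 (hh.2.trans_le (min_le_right _ _))
    have h2 := le_rpow_mul_rpow_add_of_forall_exp (T := δ * h⁻¹) (Real.sqrt_nonneg _)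
      (he.l2Norm_mono hh.1.ne' (by norm_num) (by norm_num) u)
      (he.l2Norm_mono hh.1.ne' zero_le_one one_le_two u) hC hc₁ hc₂ (by linarith)
      (by rw [← div_eq_mul_inv, lt_div_iff₀ hh.1]; linarith)
      fun τ hτ hτ' => H h hh.1 τ hτ.le (by
        have h3 := mul_le_mul_of_nonneg_right hτ'.le hh.1.le
        rwa [inv_mul_cancel_right₀ hh.1.ne'] at h3) B V hB hV u hu
    rwa [show -(c₂ * (δ * h⁻¹ / 2)) = -(c₂ * δ / 2) * h⁻¹ by ring] at h2
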